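/- Let $(M,\sigma)$ be a connected, complete (smooth) Riemannian manifold of dimension $m\ge 2$ with $\mathrm{Ric}\ge 0$. Fix $o\in M$, let $r$ be the Riemannian distance from $o$ and $B_R=\{x\in M: r(x)<R\}$, and write $\mathrm{vol}$ for the Riemannian volume of $\sigma$. Let $u\in C^\infty(M)$ solve the minimal hypersurface equation $$\mathrm{div}\left(\frac{Du}{\sqrt{1+|Du|^2}}\right)=0\quad\text{on } M,$$ where $\mathrm{div}$, $D$ and $|\cdot|$ refer to $\sigma$. Put $W=\sqrt{1+|Du|^2}$, and let $\mathrm{d}v_g$ be the volume of the graph metric $g=\sigma+\mathrm{d}u\otimes \mathrm{d}u$. Assume that $u\ge -f(r)$ on $M$ for some non-decreasing $f:[0,\infty)\to(0,\infty)$, and let $h:(0,\infty)\to(0,\infty)$ and $t_0,A\in[0,\infty)$ be such that $$t\,h(t)>2\ \text{ for each } t>t_0,\qquad h(t)\to 0\ \text{ and }\ f(t)h(t)\to A\ \text{ as } t\to\infty.$$ Set $\ell=\liminf_{t\to\infty}t\,h(t)\in[2,\infty]$. Let $s_0>1$ and $\mu>0$, set $\Lambda=e^{\mu}/\sqrt{1-s_0^{-2}}$,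 and for each $R>0$ set $$C_R=\Lambda h(R),\quad z_R=We^{-C_Ru},\quad s_1(R)=s_0\exp(\Lambda f(R)h(R)),\quad E_R=\{x\in B_R: z_R(x)>s_1(R)\}.$$ Then, for every $R>0$, $\mathrm{vol}(B_R)$ is finite and $e^{-2C_Ru}$ is integrable on $E_R\cap B_{R/2}$ with respect to $\mathrm{d}v_g$, and $$\int_{E_R\cap B_{R/2}}e^{-2C_Ru}\,\mathrm{d}v_g\ \le\ e^{-\mu Rh(R)}\,\mathrm{vol}(B_{2R})\left(\frac{e^{2\Lambda A}}{1-e^{-4\Lambda\ell}}+o(1)\right)\qquad\text{as } R\to\infty,$$ with the convention $e^{-\infty}=0$ if $\ell=\infty$. If, moreover, $\mathrm{vol}(B_{2R})=o\big(e^{\mu Rh(R)}\big)$ as $R\to\infty$, then $$\sup_M W\le s_0e^{A\Lambda}<\infty .$$ -/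

import Mathlib

open Set Filter Topology Asymptotics MeasureTheory Bundle Manifold
open scoped ContDiff ENNReal

noncomputable section

namespace MinimalGraph

/-! ### The parameters -/

/-- `Λ = e^μ / √(1 - s₀⁻²)`. -/
def Lam (s₀ μ : ℝ) : ℝ := Real.exp μ / √(1 - (s₀ ^ 2)⁻¹)

/-- `C_R = Λ h(R)`. -/
def CR (h : ℝ → ℝ) (s₀ μ R : ℝ) : ℝ := Lam s₀ μ * h R

/-- `s₁(R) = s₀ exp(Λ f(R) h(R))`. -/
def s₁ (f h : ℝ → ℝ) (s₀ μ R : ℝ) : ℝ := s₀ * Real.exp (Lam s₀ μ * f R * h R)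

/-- `ℓ = liminf_{t → ∞} t h(t)`, in the extended reals. -/
def ell (h : ℝ → ℝ) : EReal := liminf (fun t : ℝ => ((t * h t : ℝ) : EReal)) atTop

/-- `e^{2ΛA} / (1 - e^{-4Λℓ})`, where `e^{-∞} = 0`. -/
def limitConst (h : ℝ → ℝ) (s₀ μ A : ℝ) : ℝ :=
  Real.exp (2 * Lam s₀ μ * A) /
    (1 - (EReal.exp (((-(4 * Lam s₀ μ) : ℝ) : EReal) * ell h)).toReal)

variable {m : ℕ} {M : Type*} [TopologicalSpace M] [ChartedSpace (EuclideanSpace ℝ (Fin m)) M]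

/-! ### Local coordinates

For `p : M`, the chart at `p` is `extChartAt (𝓡 m) p`; a point of its target is denoted by `y`. -/

/-- The partial derivative `∂F/∂xⁱ` at `y` of a function `F` on `ℝᵐ`. -/
def partialDeriv (i : Fin m) (F : EuclideanSpace ℝ (Fin m) → ℝ)
    (y : EuclideanSpace ℝ (Fin m)) : ℝ :=
  fderiv ℝ F y (EuclideanSpace.single i 1)

/-- The coordinate vector `∂/∂xⁱ` of the chart at `p`, at the point with coordinates `y`. -/
def coordVector (p : M) (i : Fin m) (y : EuclideanSpace ℝ (Fin m)) :
    TangentSpace (𝓡 m) ((extChartAt (𝓡 m) p).symm y) :=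
  mfderiv 𝓘(ℝ, EuclideanSpace ℝ (Fin m)) (𝓡 m) (extChartAt (𝓡 m) p).symm y
    (EuclideanSpace.single i (1 : ℝ) : EuclideanSpace ℝ (Fin m))

/-- The matrix of components `b_ij = b(∂/∂xⁱ, ∂/∂xʲ)` of a field `b` of bilinear forms, in the
chart at `p`. -/
def coeffMatrix (b : ∀ x : M, TangentSpace (𝓡 m) x → TangentSpace (𝓡 m) x → ℝ)
    (p : M) (y : EuclideanSpace ℝ (Fin m)) : Matrix (Fin m) (Fin m) ℝ :=
  Matrix.of fun i j => b _ (coordVector p i y) (coordVector p j y)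

/-- The volume measure of a Riemannian metric `b`. In each chart it is `√det(b_ij) dx¹⋯dxᵐ`; these
measures on the chart domains agree on overlaps, and the measure on `M` that they
define is their least upper bound. -/
def volumeOf [MeasurableSpace M]
    (b : ∀ x : M, TangentSpace (𝓡 m) x → TangentSpace (𝓡 m) x → ℝ) : Measure M :=
  ⨆ p : M, Measure.map (extChartAt (𝓡 m) p).symm
    ((volume.restrict (extChartAt (𝓡 m) p).target).withDensity
      fun y => ENNReal.ofReal √(coeffMatrix b p y).det)

/-- The component `vⁱ = dxⁱ(v)` in the chart at `p` of a tangent vector `v` at `x`. -/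
def chartComponent (p : M) (i : Fin m) {x : M} (v : TangentSpace (𝓡 m) x) : ℝ :=
  let w : EuclideanSpace ℝ (Fin m) :=
    mfderiv (𝓡 m) 𝓘(ℝ, EuclideanSpace ℝ (Fin m)) (extChartAt (𝓡 m) p) x v
  w i

/-! ### The Riemannian metric `σ` of `M` -/

variable [RiemannianBundle (fun x : M => TangentSpace (𝓡 m) x)]

/-- The Riemannian metric `σ`. -/
def metric (x : M) (v w : TangentSpace (𝓡 m) x) : ℝ := inner ℝ v w

/-- The matrix `σ_ij` in the chart at `p`. -/
def metricCoeff (p : M) (y : EuclideanSpace ℝ (Fin m)) : Matrix (Fin m) (Fin m) ℝ :=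
  coeffMatrix (metric (m := m)) p y

/-- The Christoffel symbol `Γᵏ_ij = ½ σᵏˡ (∂_i σ_jl + ∂_j σ_il - ∂_l σ_ij)` in the chart at `p`. -/
def christoffel (p : M) (k i j : Fin m) (y : EuclideanSpace ℝ (Fin m)) : ℝ :=
  1 / 2 * ∑ l, (metricCoeff p y)⁻¹ k l *
    (partialDeriv i (fun y' => metricCoeff p y' j l) y
      + partialDeriv j (fun y' => metricCoeff p y' i l) y
      - partialDeriv l (fun y' => metricCoeff p y' i j) y)

/-- The component
`Ric_ij = ∂_k Γᵏ_ij - ∂_j Γᵏ_ik + Γᵏ_kl Γˡ_ij - Γᵏ_jl Γˡ_ik` of the Ricci tensor in the chart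
at `p`. -/
def ricci (p : M) (i j : Fin m) (y : EuclideanSpace ℝ (Fin m)) : ℝ :=
  ∑ k, partialDeriv k (christoffel p k i j) y - ∑ k, partialDeriv j (christoffel p k i k) y
    + ∑ k, ∑ l, (christoffel p k k l y * christoffel p l i j y
      - christoffel p k j l y * christoffel p l i k y)

variable (m M) in
/-- `Ric ≥ 0`: the Ricci tensor is positive semidefinite at every point of every chart domain. -/
def RicciNonneg : Prop :=
  ∀ p : M, ∀ y ∈ (extChartAt (𝓡 m) p).target, ∀ v : Fin m → ℝ,
    0 ≤ ∑ i, ∑ j, ricci p i j y * v i * v j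

/-- The divergence `(det σ)^(-1/2) ∂_i ((det σ)^(1/2) Xⁱ)` of a vector field `X` in the chart at
`p`, at the point with coordinates `y`. -/
def divergence (p : M) (X : ∀ x : M, TangentSpace (𝓡 m) x) (y : EuclideanSpace ℝ (Fin m)) : ℝ :=
  (√(metricCoeff p y).det)⁻¹ * ∑ i, partialDeriv i
    (fun y' => √(metricCoeff p y').det *
      chartComponent p i (X ((extChartAt (𝓡 m) p).symm y'))) y

/-- The differential `du` at `x`. -/
def differential (u : M → ℝ) (x : M) (v : TangentSpace (𝓡 m) x) : ℝ :=
  (mfderiv (𝓡 m) 𝓘(ℝ, ℝ) u x v : ℝ)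

/-- The gradient `Du` at `x` with respect to `σ`: the vector with `σ(Du, v) = du(v)` for all `v`. -/
def gradient (u : M → ℝ) (x : M) : TangentSpace (𝓡 m) x :=
  haveI : FiniteDimensional ℝ (TangentSpace (𝓡 m) x) :=
    inferInstanceAs (FiniteDimensional ℝ (EuclideanSpace ℝ (Fin m)))
  haveI : CompleteSpace (TangentSpace (𝓡 m) x) := FiniteDimensional.complete ℝ _
  (InnerProductSpace.toDual ℝ (TangentSpace (𝓡 m) x)).symm
    (mfderiv (𝓡 m) 𝓘(ℝ, ℝ) u x : TangentSpace (𝓡 m) x →L[ℝ] ℝ)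

/-- `W = √(1 + |Du|²)`. -/
def W (u : M → ℝ) (x : M) : ℝ := √(1 + ‖gradient (m := m) u x‖ ^ 2)

/-- The minimal hypersurface equation `div (Du / √(1 + |Du|²)) = 0` on `M`. -/
def MinimalHypersurfaceEq (m : ℕ) {M : Type*} [TopologicalSpace M]
    [ChartedSpace (EuclideanSpace ℝ (Fin m)) M]
    [RiemannianBundle (fun x : M => TangentSpace (𝓡 m) x)] (u : M → ℝ) : Prop :=
  ∀ p : M, ∀ y ∈ (extChartAt (𝓡 m) p).target,
    divergence (m := m) p (fun x => (W (m := m) u x)⁻¹ • gradient u x) y = 0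

/-- `E_R = {x ∈ B_R : z_R(x) > s₁(R)}`, where `B_R` is the open ball of radius `R` about `o` and
`z_R = W e^{-C_R u}`. -/
def superlevel (m : ℕ) {M : Type*} [MetricSpace M]
    [ChartedSpace (EuclideanSpace ℝ (Fin m)) M]
    [RiemannianBundle (fun x : M => TangentSpace (𝓡 m) x)] (o : M) (u : M → ℝ)
    (f h : ℝ → ℝ) (s₀ μ R : ℝ) : Set M :=
  {x ∈ Metric.ball o R | s₁ f h s₀ μ R < W (m := m) u x * Real.exp (-(CR h s₀ μ R) * u x)}

/-- The graph metric `g = σ + du ⊗ du`. -/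
def graphMetric (u : M → ℝ) (x : M) (v w : TangentSpace (𝓡 m) x) : ℝ :=
  metric x v w + differential u x v * differential u x w

variable [MeasurableSpace M]

variable (m M) in
/-- The Riemannian volume `vol` of `(M, σ)`. -/
def vol : Measure M := volumeOf (metric (m := m))

variable (m) in
/-- The Riemannian volume `vol_g` of the graph metric. -/
def volGraph (u : M → ℝ) : Measure M := volumeOf (graphMetric (m := m) u)

end MinimalGraph

end

/-!
Write `v = W = √(1 + |Du|²)`, let `g` be the graph metric, and fix `R`, `C = C_R`, `c = e^μ h(R)`, so
that `C² (1 - s₀⁻²) = c²`. The estimate comes from two integral inequalities on `M`, both taken with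
respect to `dv_g = W dvol` and with the weight `e^{-2Cu}`.

* On a minimal graph over a manifold with `Ric ≥ 0` one has `Δ_g log W ≥ |∇ log W|²_g`
  (`IsLocalMinimalGraph.le_divergence_flux`): the Bochner formula for `div (∇_P P - (div P) P)`,
  `P = Du`, holds for every function, and the minimal surface equation identifies this vector field
  with the graph gradient of `|Du|² / 2` and the remaining quadratic term with the norm of the
  second fundamental form. As `Δ_g u = 0`, the function `ζ = log W - C u` satisfies
  `Δ_g ζ ≥ |∇ζ + C ∇u|²_g`. Testing this with `λ(ζ) e^{-2Cu} φ²`, for a nondecreasing `λ ≥ 0`, gives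
  `∫ λ(ζ) e^{-2Cu} (C² (1 - W⁻²) φ² - |dφ|²) dv_g ≤ 0` (`integral_logZ_le`).
* Testing the minimal surface equation itself with `e^{-2Cu} θ²` gives
  `∫ e^{-2Cu} (C (1 - W⁻²) θ² - C⁻¹ W⁻² |dθ|²) dv_g ≤ 0` (`integral_exp_le`).

On the support of `λ(ζ)` in `B_R` one has `W ≥ s₀`, hence `C² (1 - W⁻²) ≥ c²`. With
`ϱ = min (R - r, R / 2)` and `φ = cosh (c ϱ) - 1` the identity `(cosh t - 1)² - sinh² t =
-4 sinh² (t / 2)` bounds `∫ λ(ζ) e^{-2Cu} dv_g` over `B_{R/2}`, up to a factor, by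
`∫ λ(ζ) e^{-2Cu} θ² dv_g` with `θ = 2 sinh (c ϱ / 2)`; this second integral is controlled by the
second inequality, and `u ≥ -f(R)` on `B_R` bounds what is left
(`sinh_sq_mul_setIntegral_le`):
`4 sinh² (c R / 4) ∫_{B_{R/2}} λ(ζ) e^{-2Cu} dv_g ≤ e^{2 C f(R)} vol (B_R)`.
Letting `λ` increase to the indicator function of `(log s₁(R), ∞)`, and using
`4 sinh² (c R / 4) ≥ e^{μ R h(R)}`, valid since `R h(R) > 2`, gives the estimate with the constant
`e^{2Λ f(R) h(R)}`, which tends to `e^{2ΛA}` (`setIntegral_superlevel_le_exp`). This is at most the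
constant of the statement, because `1 - e^{-4Λℓ} ≤ 1`.

If `W (x₀) > s₀ e^{AΛ}`, then a fixed neighbourhood of `x₀` lies in `E_R ∩ B_{R/2}` for all large
`R`, and `e^{-2 C_R u} → 1` there, as `C_R → 0`. So the integrals cannot tend to zero
(`W_le_of_tendsto_zero`).

The differential inequalities are proved in coordinates, on an open set of `ℝᵐ` with a matrix of
metric coefficients. The cutoff functions are only Lipschitz, so the integration by parts rests on
Rademacher's theorem (`integral_flux_add_le_zero`), and the bound on the differential of the
distance function is needed at points of differentiability only (`sum_inv_mul_partialDeriv_le`).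
The inequalities in the charts are localized by a smooth function `χ` and are linear in `χ` and
`dχ`, so they can be summed over a partition of unity (`integral_nonpos_of_forall_chart`).
Compactness of balls is the Hopf–Rinow theorem (`properSpace_of_complete`).
-/
noncomputable section

namespace MinimalGraph

variable {m : ℕ}

/-! ### Algebraic identities behind the Bochner formula -/

lemma sum_rotate (f : Fin m → Fin m → Fin m → ℝ) :
    ∑ i, ∑ j, ∑ k, f i j k = ∑ j, ∑ k, ∑ i, f i j k := by
  rw [Finset.sum_comm]
  exact Finset.sum_congr rfl fun j _ => Finset.sum_comm

lemma sum_reverse (f : Fin m → Fin m → Fin m → ℝ) :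
    ∑ i, ∑ j, ∑ k, f i j k = ∑ k, ∑ j, ∑ i, f i j k := by
  rw [sum_rotate, Finset.sum_comm]

/-- The algebra of the Bochner formula at a point. Here `V = ∇P` for the Christoffel symbols `γ`,
with `a s i = ∂_i Pˢ`, `d s i k = ∂_k ∂_i Pˢ` and `δ j s i k = ∂_j γˢ_ik`, and `DV i s k = ∂_i Vˢ_k`;
the last sum is the Ricci curvature in the direction `P`. -/
lemma covariant_divergence_algebra (P : Fin m → ℝ) (a : Fin m → Fin m → ℝ)
    (d γ : Fin m → Fin m → Fin m → ℝ) (δ : Fin m → Fin m → Fin m → Fin m → ℝ)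
    (hd : ∀ s i k, d s i k = d s k i) (hγ : ∀ s i k, γ s i k = γ s k i)
    (hδ : ∀ j s i k, δ j s i k = δ j s k i) (V : Fin m → Fin m → ℝ)
    (DV : Fin m → Fin m → Fin m → ℝ)
    (hV : ∀ s i, V s i = a s i + ∑ n, γ s i n * P n)
    (hDV : ∀ i s k, DV i s k = d s i k + ∑ n, (δ i s k n * P n + γ s k n * a n i)) :
    ∑ i, (∑ k, (DV i i k * P k + V i k * a k i) - (a i i * ∑ k, V k k + P i * ∑ k, DV i k k))
      + ∑ i, ∑ k, γ k k i * (∑ n, V i n * P n - P i * ∑ n, V n n)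
    = ∑ i, ∑ k, V i k * V k i - (∑ k, V k k) ^ 2
      + ∑ i, ∑ j, (∑ k, δ k k i j - ∑ k, δ j k i k
        + ∑ k, ∑ l, (γ k k l * γ l i j - γ k j l * γ l i k)) * P i * P j := by
  have e1 : ∑ i, ∑ k, DV i i k * P k = ∑ i, ∑ k, d i i k * P k
      + ∑ i, ∑ k, ∑ n, δ i i k n * P n * P k + ∑ i, ∑ k, ∑ n, γ i k n * a n i * P k := by
    simp only [hDV, add_mul, Finset.sum_mul, Finset.sum_add_distrib]
    ring
  have e2 : ∑ i, P i * ∑ k, DV i k k = ∑ i, ∑ k, d k i k * P i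
      + ∑ i, ∑ k, ∑ n, δ i k k n * P n * P i + ∑ i, ∑ k, ∑ n, γ k k n * a n i * P i := by
    simp only [hDV, mul_comm (P _), add_mul, Finset.sum_mul, Finset.sum_add_distrib]
    ring
  have e3 : ∑ i, ∑ k, d i i k * P k = ∑ i, ∑ k, d k i k * P i := by
    rw [Finset.sum_comm]
    exact Finset.sum_congr rfl fun i _ => Finset.sum_congr rfl fun k _ => by rw [hd]
  have e4 : (∑ k, V k k) ^ 2 = ∑ i, a i i * ∑ k, V k k
      + ∑ i, ∑ k, γ k k i * (P i * ∑ n, V n n) := by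
    rw [sq, ← Finset.sum_mul]
    conv_lhs => enter [1]; simp only [hV, Finset.sum_add_distrib]
    rw [add_mul, Finset.sum_comm (f := fun k n => γ k k n * P n)]
    simp only [Finset.sum_mul, mul_assoc]
  have e5 : ∑ i, ∑ k, γ k k i * ∑ n, V i n * P n
      = ∑ i, ∑ k, ∑ n, γ k k n * a n i * P i
        + ∑ i, ∑ j, ∑ k, ∑ l, γ k k l * γ l i j * P i * P j := by
    have h1 : ∑ i, ∑ k, ∑ n, γ k k n * a n i * P i = ∑ i, ∑ k, ∑ n, γ k k i * (a i n * P n) := by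
      rw [sum_reverse]
      simp only [mul_assoc]
    have h2 : ∑ i, ∑ j, ∑ k, ∑ l, γ k k l * γ l i j * P i * P j
        = ∑ l, ∑ k, ∑ i, ∑ j, γ k k l * (γ l i j * P j * P i) := by
      rw [sum_rotate fun i j k => ∑ l, γ k k l * γ l i j * P i * P j]
      rw [sum_rotate fun j k i => ∑ l, γ k k l * γ l i j * P i * P j]
      simp_rw [fun k i => Finset.sum_comm (s := Finset.univ) (t := Finset.univ)
        (f := fun j l => γ k k l * γ l i j * P i * P j)]
      rw [sum_rotate fun k i l => ∑ j, γ k k l * γ l i j * P i * P j, Finset.sum_comm]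
      refine Finset.sum_congr rfl fun l _ => ?_
      rw [Finset.sum_comm]
      refine Finset.sum_congr rfl fun k _ => Finset.sum_congr rfl fun i _ =>
        Finset.sum_congr rfl fun j _ => by ring
    rw [h1, h2]
    simp only [hV, add_mul, Finset.mul_sum, Finset.sum_mul, mul_add, Finset.sum_add_distrib]
  have e6 : ∑ i, ∑ k, V i k * V k i = ∑ i, ∑ k, V i k * a k i
      + ∑ i, ∑ k, ∑ n, γ i k n * a n i * P k
      + ∑ i, ∑ j, ∑ k, ∑ l, γ k j l * γ l i k * P i * P j := by
    have h1 : ∑ i, ∑ k, ∑ n, γ i k n * a n i * P k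
        = ∑ i, ∑ k, ∑ n, a i k * (γ k i n * P n) := by
      rw [sum_rotate]
      rw [sum_rotate]
      refine Finset.sum_congr rfl fun l _ => Finset.sum_congr rfl fun k _ =>
        Finset.sum_congr rfl fun i _ => by rw [hγ]; ring
    have h2 : ∑ i, ∑ j, ∑ k, ∑ l, γ k j l * γ l i k * P i * P j
        = ∑ k, ∑ l, ∑ i, ∑ j, (γ k l j * P j) * (γ l k i * P i) := by
      rw [sum_rotate fun i j k => ∑ l, γ k j l * γ l i k * P i * P j]
      rw [sum_rotate fun j k i => ∑ l, γ k j l * γ l i k * P i * P j]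
      refine Finset.sum_congr rfl fun k _ => ?_
      rw [sum_reverse]
      refine Finset.sum_congr rfl fun l _ => ?_
      rw [Finset.sum_comm]
      refine Finset.sum_congr rfl fun j _ => Finset.sum_congr rfl fun i _ => ?_
      rw [hγ k l i, hγ l k j]; ring
    rw [h1, h2]
    have h3 : ∀ i k, V i k * V k i = V i k * a k i + (∑ n, a i k * (γ k i n * P n)
        + ∑ i', ∑ j, (γ i k j * P j) * (γ k i i' * P i')) := by
      intro i k
      rw [hV k i, mul_add]
      congr 1
      rw [hV i k, add_mul, Finset.mul_sum, Finset.sum_mul_sum, Finset.sum_comm]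
    simp only [h3, Finset.sum_add_distrib]
    ring
  have e7 : ∑ i, ∑ j, (∑ k, δ k k i j) * P i * P j
      = ∑ i, ∑ k, ∑ n, δ i i k n * P n * P k := by
    simp only [Finset.sum_mul]
    rw [sum_rotate, sum_rotate]
    refine Finset.sum_congr rfl fun l _ => Finset.sum_congr rfl fun k _ =>
        Finset.sum_congr rfl fun i _ => by ring
  have e8 : ∑ i, ∑ j, (∑ k, δ j k i k) * P i * P j
      = ∑ i, ∑ k, ∑ n, δ i k k n * P n * P i := by
    simp only [Finset.sum_mul]
    rw [sum_rotate]
    refine Finset.sum_congr rfl fun l _ => Finset.sum_congr rfl fun k _ =>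
        Finset.sum_congr rfl fun i _ => by rw [hδ]
  simp only [Finset.sum_sub_distrib, Finset.sum_add_distrib, add_mul, sub_mul, mul_sub]
  rw [e7, e8, e6, e1, e2, e3, e4]
  have e9 : ∑ i, ∑ j, (∑ k, ∑ l, γ k k l * γ l i j) * P i * P j
      = ∑ i, ∑ j, ∑ k, ∑ l, γ k k l * γ l i j * P i * P j := by simp only [Finset.sum_mul]
  have e10 : ∑ i, ∑ j, (∑ k, ∑ l, γ k j l * γ l i k) * P i * P j
      = ∑ i, ∑ j, ∑ k, ∑ l, γ k j l * γ l i k * P i * P j := by simp only [Finset.sum_mul]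
  rw [e9, e10, e5]
  ring

/-- A positive semidefinite `g` and a symmetric `H` satisfy `tr (gHgH) ≥ 0`. -/
lemma trace_mul_symm_sq_nonneg {g H : Matrix (Fin m) (Fin m) ℝ} (hg : g.PosSemidef)
    (hH : H.transpose = H) : 0 ≤ ((g * H) * (g * H)).trace := by
  obtain ⟨B, rfl⟩ : ∃ B : Matrix (Fin m) (Fin m) ℝ, g = B.conjTranspose * B :=
    by
      open scoped MatrixOrder in
      exact (CStarAlgebra.nonneg_iff_eq_star_mul_self).1 hg.nonneg
  have : (B.conjTranspose * B * H * (B.conjTranspose * B * H)).trace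
      = ((B * H * B.conjTranspose).conjTranspose * (B * H * B.conjTranspose)).trace := by
    simp only [Matrix.conjTranspose_mul, Matrix.conjTranspose_conjTranspose]
    rw [show H.conjTranspose = H by simpa using hH]
    rw [Matrix.mul_assoc, Matrix.mul_assoc, Matrix.trace_mul_comm]
    simp only [Matrix.mul_assoc]
  rw [this]
  exact (Matrix.posSemidef_conjTranspose_mul_self _).trace_nonneg

/-! ### Partial derivatives and the derivative of a determinant -/

section partialDeriv

variable {F G : EuclideanSpace ℝ (Fin m) → ℝ} {y : EuclideanSpace ℝ (Fin m)} {T : Set (EuclideanSpace ℝ (Fin m))}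

lemma partialDeriv_congr (i : Fin m) (h : F =ᶠ[𝓝 y] G) :
    partialDeriv i F y = partialDeriv i G y := by
  rw [partialDeriv, partialDeriv, h.fderiv_eq]

lemma partialDeriv_const (i : Fin m) (c : ℝ) : partialDeriv i (fun _ : EuclideanSpace ℝ (Fin m) => c) y = 0 := by
  simp [partialDeriv]

lemma partialDeriv_add (i : Fin m) (hF : DifferentiableAt ℝ F y) (hG : DifferentiableAt ℝ G y) :
    partialDeriv i (fun z => F z + G z) y = partialDeriv i F y + partialDeriv i G y := by
  simp [partialDeriv, fderiv_fun_add hF hG]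

lemma partialDeriv_sub (i : Fin m) (hF : DifferentiableAt ℝ F y) (hG : DifferentiableAt ℝ G y) :
    partialDeriv i (fun z => F z - G z) y = partialDeriv i F y - partialDeriv i G y := by
  simp [partialDeriv, fderiv_fun_sub hF hG]

lemma partialDeriv_mul (i : Fin m) (hF : DifferentiableAt ℝ F y) (hG : DifferentiableAt ℝ G y) :
    partialDeriv i (fun z => F z * G z) y
      = partialDeriv i F y * G y + F y * partialDeriv i G y := by
  simp [partialDeriv, fderiv_fun_mul hF hG]
  ring

lemma partialDeriv_const_mul (i : Fin m) (c : ℝ) (hF : DifferentiableAt ℝ F y) :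
    partialDeriv i (fun z => c * F z) y = c * partialDeriv i F y := by
  simp [partialDeriv, fderiv_const_mul hF]

lemma partialDeriv_sum {ι : Type*} (i : Fin m) (s : Finset ι) {A : ι → EuclideanSpace ℝ (Fin m) → ℝ}
    (hA : ∀ k ∈ s, DifferentiableAt ℝ (A k) y) :
    partialDeriv i (fun z => ∑ k ∈ s, A k z) y = ∑ k ∈ s, partialDeriv i (A k) y := by
  simp [partialDeriv, fderiv_fun_sum hA]

lemma partialDeriv_sum_mul {ι : Type*} (i : Fin m) (s : Finset ι)
    {A B : ι → EuclideanSpace ℝ (Fin m) → ℝ} (hA : ∀ k, DifferentiableAt ℝ (A k) y)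
    (hB : ∀ k, DifferentiableAt ℝ (B k) y) :
    partialDeriv i (fun z => ∑ k ∈ s, A k z * B k z) y
      = ∑ k ∈ s, (partialDeriv i (A k) y * B k y + A k y * partialDeriv i (B k) y) := by
  have h := partialDeriv_sum (A := fun k z => A k z * B k z) i s
    fun k _ => (hA k).mul (hB k)
  rw [h]
  exact Finset.sum_congr rfl fun k _ => partialDeriv_mul i (hA k) (hB k)

lemma partialDeriv_comp (i : Fin m) {φ : ℝ → ℝ} {φ' : ℝ} (hφ : HasDerivAt φ φ' (F y))
    (hF : DifferentiableAt ℝ F y) :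
    partialDeriv i (fun z => φ (F z)) y = φ' * partialDeriv i F y := by
  have := (hφ.hasFDerivAt.comp y hF.hasFDerivAt).fderiv
  rw [partialDeriv, partialDeriv]
  erw [this]
  simp [mul_comm]

lemma contDiffOn_partialDeriv (i : Fin m) (hT : IsOpen T) (hF : ContDiffOn ℝ ∞ F T) :
    ContDiffOn ℝ ∞ (partialDeriv i F) T :=
  (hF.fderiv_of_isOpen hT (by simp)).clm_apply contDiffOn_const

lemma differentiableAt_of_contDiffOn (hT : IsOpen T) (hF : ContDiffOn ℝ ∞ F T) (hy : y ∈ T) :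
    DifferentiableAt ℝ F y :=
  (hF.differentiableOn (by simp)).differentiableAt (hT.mem_nhds hy)

lemma partialDeriv_comm (i j : Fin m) (hT : IsOpen T) (hF : ContDiffOn ℝ ∞ F T) (hy : y ∈ T) :
    partialDeriv i (partialDeriv j F) y = partialDeriv j (partialDeriv i F) y := by
  have hd : DifferentiableAt ℝ (fderiv ℝ F) y :=
    ((hF.fderiv_of_isOpen hT (m := ∞) (by simp)).differentiableOn (by simp)).differentiableAt
      (hT.mem_nhds hy)
  have h := (hF.contDiffAt (hT.mem_nhds hy)).isSymmSndFDerivAt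
    (by rw [minSmoothness_of_isRCLikeNormedField]; exact WithTop.coe_le_coe.2 le_top)
  have key : ∀ i j : Fin m, partialDeriv i (partialDeriv j F) y
      = fderiv ℝ (fderiv ℝ F) y (EuclideanSpace.single i 1) (EuclideanSpace.single j 1) := by
    intro i j
    change fderiv ℝ (fun z => fderiv ℝ F z (EuclideanSpace.single j 1)) y _ = _
    rw [fderiv_clm_apply hd (by fun_prop)]
    simp
  rw [key, key]
  exact h _ _

lemma fderiv_apply_eq_sum (F : EuclideanSpace ℝ (Fin m) → ℝ) (y w : EuclideanSpace ℝ (Fin m)) :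
    fderiv ℝ F y w = ∑ i, w i * partialDeriv i F y := by
  conv_lhs => rw [show w = ∑ i, w i • EuclideanSpace.single i (1 : ℝ) by
    simpa using ((EuclideanSpace.basisFun (Fin m) ℝ).sum_repr w).symm]
  simp [partialDeriv]

end partialDeriv

section determinant

variable {y : EuclideanSpace ℝ (Fin m)} {T : Set (EuclideanSpace ℝ (Fin m))} {S : EuclideanSpace ℝ (Fin m) → Matrix (Fin m) (Fin m) ℝ}

lemma contDiffOn_det (hS : ∀ i j, ContDiffOn ℝ ∞ (fun z => S z i j) T) :
    ContDiffOn ℝ ∞ (fun z => (S z).det) T := by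
  simp only [Matrix.det_apply']
  exact ContDiffOn.sum fun σ _ => contDiffOn_const.mul (contDiffOn_prod fun i _ => hS _ _)

lemma contDiffOn_inv_entry (hS : ∀ i j, ContDiffOn ℝ ∞ (fun z => S z i j) T)
    (hdet : ∀ z ∈ T, (S z).det ≠ 0) (i j : Fin m) :
    ContDiffOn ℝ ∞ (fun z => (S z)⁻¹ i j) T := by
  simp only [Matrix.inv_def, Ring.inverse_eq_inv', Matrix.smul_apply, smul_eq_mul,
    Matrix.adjugate_apply]
  refine ((contDiffOn_det hS).inv hdet).mul (contDiffOn_det fun a b => ?_)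
  simp only [Matrix.updateRow_apply]
  split_ifs
  · exact contDiffOn_const
  · exact hS _ _

/-- Jacobi's formula for the derivative of a determinant. -/
lemma partialDeriv_det (n : Fin m) (hS : ∀ i j, DifferentiableAt ℝ (fun z => S z i j) y)
    (hdet : (S y).det ≠ 0) :
    partialDeriv n (fun z => (S z).det) y
      = (S y).det * ∑ i, ∑ l, (S y)⁻¹ i l * partialDeriv n (fun z => S z l i) y := by
  have h1 : partialDeriv n (fun z => (S z).det) y
      = ∑ i, ((S y).updateCol i fun l => partialDeriv n (fun z => S z l i) y).det := by
    simp only [Matrix.det_apply']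
    rw [partialDeriv_sum]
    · rw [Finset.sum_comm]
      refine Finset.sum_congr rfl fun σ _ => ?_
      rw [partialDeriv_const_mul, ← Finset.mul_sum]
      · congr 1
        rw [partialDeriv, fderiv_finsetProd fun i _ => hS _ _]
        simp only [FunLike.coe_sum, Finset.sum_apply, FunLike.coe_smul, Pi.smul_apply, smul_eq_mul]
        refine Finset.sum_congr rfl fun i _ => ?_
        rw [← Finset.mul_prod_erase _ _ (Finset.mem_univ i), mul_comm]
        simp only [Matrix.updateCol_self]
        congr 1
        refine Finset.prod_congr rfl fun j hj => ?_
        rw [Matrix.updateCol_ne (Finset.ne_of_mem_erase hj)]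
      · exact (HasFDerivAt.finsetProd fun i _ => (hS _ _).hasFDerivAt).differentiableAt
    · intro σ _
      exact ((HasFDerivAt.finsetProd fun i _ => (hS _ _).hasFDerivAt).differentiableAt).const_mul _
  have h2 : (S y).adjugate = (S y).det • (S y)⁻¹ := by
    rw [Matrix.inv_def, Ring.inverse_eq_inv', smul_smul, mul_inv_cancel₀ hdet, one_smul]
  rw [h1, Finset.mul_sum]
  refine Finset.sum_congr rfl fun i _ => ?_
  rw [← Matrix.cramer_apply, Matrix.cramer_eq_adjugate_mulVec, h2]
  simp [Matrix.mulVec, dotProduct, Finset.mul_sum, mul_assoc]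

end determinant

/-! ### Riemannian geometry of a graph in a coordinate patch -/

/-- The coefficients `S = (σ_ij)` of a smooth Riemannian metric on an open set `T` of `ℝᵐ`. -/
structure IsLocalMetric (T : Set (EuclideanSpace ℝ (Fin m)))
    (S : EuclideanSpace ℝ (Fin m) → Matrix (Fin m) (Fin m) ℝ) : Prop where
  isOpen : IsOpen T
  contDiffOn : ∀ i j, ContDiffOn ℝ ∞ (fun y => S y i j) T
  posDef : ∀ y ∈ T, (S y).PosDef

/-- The Christoffel symbol `Γᵏ_ij` of the metric with coefficients `S`. -/
def localChristoffel (S : EuclideanSpace ℝ (Fin m) → Matrix (Fin m) (Fin m) ℝ) (k i j : Fin m)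
    (y : EuclideanSpace ℝ (Fin m)) : ℝ :=
  1 / 2 * ∑ l, (S y)⁻¹ k l *
    (partialDeriv i (fun y' => S y' j l) y + partialDeriv j (fun y' => S y' i l) y
      - partialDeriv l (fun y' => S y' i j) y)

/-- The component `Ric_ij` of the Ricci tensor of the metric with coefficients `S`. -/
def localRicci (S : EuclideanSpace ℝ (Fin m) → Matrix (Fin m) (Fin m) ℝ) (i j : Fin m)
    (y : EuclideanSpace ℝ (Fin m)) : ℝ :=
  ∑ k, partialDeriv k (localChristoffel S k i j) y
    - ∑ k, partialDeriv j (localChristoffel S k i k) y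
    + ∑ k, ∑ l, (localChristoffel S k k l y * localChristoffel S l i j y
      - localChristoffel S k j l y * localChristoffel S l i k y)

/-- The component `Pⁱ = σ^{ij} ∂_j U` of the gradient of `U`. -/
def localGrad (S : EuclideanSpace ℝ (Fin m) → Matrix (Fin m) (Fin m) ℝ)
    (U : EuclideanSpace ℝ (Fin m) → ℝ) (i : Fin m) (y : EuclideanSpace ℝ (Fin m)) : ℝ :=
  ∑ j, (S y)⁻¹ i j * partialDeriv j U y

/-- The squared norm `|DU|²` of the gradient of `U`. -/
def localNormSq (S : EuclideanSpace ℝ (Fin m) → Matrix (Fin m) (Fin m) ℝ)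
    (U : EuclideanSpace ℝ (Fin m) → ℝ) (y : EuclideanSpace ℝ (Fin m)) : ℝ :=
  ∑ i, localGrad S U i y * partialDeriv i U y

/-- The area element `v = √(1 + |DU|²)` of the graph of `U`. -/
def localW (S : EuclideanSpace ℝ (Fin m) → Matrix (Fin m) (Fin m) ℝ)
    (U : EuclideanSpace ℝ (Fin m) → ℝ) (y : EuclideanSpace ℝ (Fin m)) : ℝ :=
  √(1 + localNormSq S U y)

/-- The covariant derivative `Vˢ_i = ∂_i Pˢ + Γˢ_in Pⁿ` of the gradient of `U`. -/
def localHess (S : EuclideanSpace ℝ (Fin m) → Matrix (Fin m) (Fin m) ℝ)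
    (U : EuclideanSpace ℝ (Fin m) → ℝ) (s i : Fin m) (y : EuclideanSpace ℝ (Fin m)) : ℝ :=
  partialDeriv i (localGrad S U s) y + ∑ n, localChristoffel S s i n y * localGrad S U n y

/-- The vector field `B = ∇_P P - (div P) P`, where `P` is the gradient of `U`. -/
def bochnerField (S : EuclideanSpace ℝ (Fin m) → Matrix (Fin m) (Fin m) ℝ)
    (U : EuclideanSpace ℝ (Fin m) → ℝ) (i : Fin m) (y : EuclideanSpace ℝ (Fin m)) : ℝ :=
  ∑ k, localHess S U i k y * localGrad S U k y - localGrad S U i y * ∑ k, localHess S U k k y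

/-- The half gradient `F_k = ½ ∂_k |DU|²`. -/
def halfGradNormSq (S : EuclideanSpace ℝ (Fin m) → Matrix (Fin m) (Fin m) ℝ)
    (U : EuclideanSpace ℝ (Fin m) → ℝ) (k : Fin m) (y : EuclideanSpace ℝ (Fin m)) : ℝ :=
  1 / 2 * partialDeriv k (localNormSq S U) y

variable {T : Set (EuclideanSpace ℝ (Fin m))}
  {S : EuclideanSpace ℝ (Fin m) → Matrix (Fin m) (Fin m) ℝ}
  {U : EuclideanSpace ℝ (Fin m) → ℝ} {y : EuclideanSpace ℝ (Fin m)}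

namespace IsLocalMetric

lemma det_pos (h : IsLocalMetric T S) (hy : y ∈ T) : 0 < (S y).det := (h.posDef y hy).det_pos

lemma symm (h : IsLocalMetric T S) (hy : y ∈ T) (i j : Fin m) : S y i j = S y j i := by
  simpa using congrFun (congrFun (h.posDef y hy).isHermitian j) i

lemma inv_symm (h : IsLocalMetric T S) (hy : y ∈ T) (i j : Fin m) :
    (S y)⁻¹ i j = (S y)⁻¹ j i := by
  simpa using congrFun (congrFun (h.posDef y hy).inv.isHermitian j) i

lemma sum_mul_inv (h : IsLocalMetric T S) (hy : y ∈ T) (i k : Fin m) :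
    ∑ j, S y i j * (S y)⁻¹ j k = if i = k then 1 else 0 := by
  have := congrFun (congrFun (Matrix.mul_nonsing_inv (S y) (h.det_pos hy).ne'.isUnit) i) k
  rwa [Matrix.mul_apply, Matrix.one_apply] at this

lemma sum_inv_mul (h : IsLocalMetric T S) (hy : y ∈ T) (i k : Fin m) :
    ∑ j, (S y)⁻¹ i j * S y j k = if i = k then 1 else 0 := by
  have := congrFun (congrFun (Matrix.nonsing_inv_mul (S y) (h.det_pos hy).ne'.isUnit) i) k
  rwa [Matrix.mul_apply, Matrix.one_apply] at this

lemma contDiffOn_inv (h : IsLocalMetric T S) (i j : Fin m) :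
    ContDiffOn ℝ ∞ (fun z => (S z)⁻¹ i j) T :=
  contDiffOn_inv_entry h.contDiffOn (fun _ hz => (h.det_pos hz).ne') i j

lemma contDiffOn_christoffel (h : IsLocalMetric T S) (k i j : Fin m) :
    ContDiffOn ℝ ∞ (localChristoffel S k i j) T :=
  contDiffOn_const.mul <| ContDiffOn.sum fun l _ => (h.contDiffOn_inv k l).mul <|
    ((contDiffOn_partialDeriv i h.isOpen (h.contDiffOn j l)).add
      (contDiffOn_partialDeriv j h.isOpen (h.contDiffOn i l))).sub
      (contDiffOn_partialDeriv l h.isOpen (h.contDiffOn i j))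

lemma contDiffOn_grad (h : IsLocalMetric T S) (hU : ContDiffOn ℝ ∞ U T) (i : Fin m) :
    ContDiffOn ℝ ∞ (localGrad S U i) T :=
  ContDiffOn.sum fun j _ => (h.contDiffOn_inv i j).mul (contDiffOn_partialDeriv j h.isOpen hU)

lemma contDiffOn_normSq (h : IsLocalMetric T S) (hU : ContDiffOn ℝ ∞ U T) :
    ContDiffOn ℝ ∞ (localNormSq S U) T :=
  ContDiffOn.sum fun i _ => (h.contDiffOn_grad hU i).mul (contDiffOn_partialDeriv i h.isOpen hU)

lemma contDiffOn_hess (h : IsLocalMetric T S) (hU : ContDiffOn ℝ ∞ U T) (s i : Fin m) :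
    ContDiffOn ℝ ∞ (localHess S U s i) T :=
  (contDiffOn_partialDeriv i h.isOpen (h.contDiffOn_grad hU s)).add <|
    ContDiffOn.sum fun n _ => (h.contDiffOn_christoffel s i n).mul (h.contDiffOn_grad hU n)

lemma contDiffOn_bochnerField (h : IsLocalMetric T S) (hU : ContDiffOn ℝ ∞ U T) (i : Fin m) :
    ContDiffOn ℝ ∞ (bochnerField S U i) T :=
  (ContDiffOn.sum fun k _ => (h.contDiffOn_hess hU i k).mul (h.contDiffOn_grad hU k)).sub <|
    (h.contDiffOn_grad hU i).mul <| ContDiffOn.sum fun k _ => h.contDiffOn_hess hU k k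

lemma christoffel_symm (h : IsLocalMetric T S) (hy : y ∈ T) (k i j : Fin m) :
    localChristoffel S k i j y = localChristoffel S k j i y := by
  have : ∀ l, partialDeriv l (fun z => S z i j) y = partialDeriv l (fun z => S z j i) y :=
    fun l => partialDeriv_congr l <| by
      filter_upwards [h.isOpen.mem_nhds hy] with z hz using h.symm hz i j
  simp only [localChristoffel, this]
  congr 1
  refine Finset.sum_congr rfl fun l _ => by ring

lemma lower_christoffel (h : IsLocalMetric T S) (hy : y ∈ T) (a i j : Fin m) :
    ∑ n, S y a n * localChristoffel S n i j y
      = 1 / 2 * (partialDeriv i (fun z => S z j a) y + partialDeriv j (fun z => S z i a) y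
      - partialDeriv a (fun z => S z i j) y) := by
  simp only [localChristoffel]
  set c : Fin m → ℝ := fun l => partialDeriv i (fun z => S z j l) y
    + partialDeriv j (fun z => S z i l) y - partialDeriv l (fun z => S z i j) y
  change ∑ n, S y a n * (1 / 2 * ∑ l, (S y)⁻¹ n l * c l) = 1 / 2 * c a
  calc ∑ n, S y a n * (1 / 2 * ∑ l, (S y)⁻¹ n l * c l)
      = ∑ l, (∑ n, S y a n * (S y)⁻¹ n l) * (1 / 2 * c l) := by
        simp only [Finset.mul_sum, Finset.sum_mul]
        rw [Finset.sum_comm]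
        exact Finset.sum_congr rfl fun _ _ => Finset.sum_congr rfl fun _ _ => by ring
    _ = 1 / 2 * c a := by simp [h.sum_mul_inv hy]

/-- The Levi-Civita connection is compatible with the metric. -/
lemma partialDeriv_metric (h : IsLocalMetric T S) (hy : y ∈ T) (k i j : Fin m) :
    partialDeriv k (fun z => S z i j) y
      = ∑ n, S y j n * localChristoffel S n k i y + ∑ n, S y i n * localChristoffel S n k j y := by
  have hs : ∀ l a b, partialDeriv l (fun z => S z a b) y = partialDeriv l (fun z => S z b a) y :=
    fun l a b => partialDeriv_congr l <| by
      filter_upwards [h.isOpen.mem_nhds hy] with z hz using h.symm hz a b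
  rw [h.lower_christoffel hy, h.lower_christoffel hy, hs k j i, hs j k i, hs i k j]
  ring

lemma contDiffOn_sqrt_det (h : IsLocalMetric T S) : ContDiffOn ℝ ∞ (fun z => √(S z).det) T :=
  (contDiffOn_det h.contDiffOn).sqrt fun _ hz => (h.det_pos hz).ne'

lemma partialDeriv_sqrt_det (h : IsLocalMetric T S) (hy : y ∈ T) (n : Fin m) :
    partialDeriv n (fun z => √(S z).det) y
      = √(S y).det * ∑ i, localChristoffel S i i n y := by
  have hd := h.det_pos hy
  have hS : ∀ i j, DifferentiableAt ℝ (fun z => S z i j) y := fun i j =>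
    differentiableAt_of_contDiffOn h.isOpen (h.contDiffOn i j) hy
  rw [partialDeriv_comp n (Real.hasDerivAt_sqrt hd.ne')
    (differentiableAt_of_contDiffOn h.isOpen (contDiffOn_det h.contDiffOn) hy),
    partialDeriv_det n hS hd.ne']
  have hs : ∀ l a b, partialDeriv l (fun z => S z a b) y = partialDeriv l (fun z => S z b a) y :=
    fun l a b => partialDeriv_congr l <| by
      filter_upwards [h.isOpen.mem_nhds hy] with z hz using h.symm hz a b
  have h1 : ∑ i, localChristoffel S i i n y
      = 1 / 2 * ∑ i, ∑ l, (S y)⁻¹ i l * partialDeriv n (fun z => S z l i) y := by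
    simp only [localChristoffel, ← Finset.mul_sum]
    congr 1
    -- the two remaining terms are antisymmetric in `i, l`
    have h2 : ∑ i, ∑ l, (S y)⁻¹ i l * partialDeriv i (fun z => S z n l) y
        = ∑ i, ∑ l, (S y)⁻¹ i l * partialDeriv l (fun z => S z i n) y := by
      rw [Finset.sum_comm]
      refine Finset.sum_congr rfl fun i _ => Finset.sum_congr rfl fun l _ => ?_
      rw [h.inv_symm hy, hs]
    simp only [mul_sub, mul_add, Finset.sum_sub_distrib, Finset.sum_add_distrib]
    rw [h2, add_sub_cancel_left]
    exact Finset.sum_congr rfl fun i _ => Finset.sum_congr rfl fun l _ => by rw [hs]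
  rw [h1]
  have : √(S y).det * √(S y).det = (S y).det := Real.mul_self_sqrt hd.le
  have hne : √(S y).det ≠ 0 := (Real.sqrt_pos.2 hd).ne'
  field_simp
  rw [sq, this]

lemma lower_grad (h : IsLocalMetric T S) (hy : y ∈ T) (k : Fin m) :
    ∑ s, S y k s * localGrad S U s y = partialDeriv k U y := by
  simp only [localGrad, Finset.mul_sum]
  rw [Finset.sum_comm]
  simp only [← mul_assoc, ← Finset.sum_mul, h.sum_mul_inv hy]
  simp

/-- `Vˢ_i` with the upper index lowered is the Hessian `∂_i ∂_k U - Γⁿ_ik ∂_n U`. -/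
lemma lower_hess (h : IsLocalMetric T S) (hU : ContDiffOn ℝ ∞ U T) (hy : y ∈ T) (k i : Fin m) :
    ∑ s, S y k s * localHess S U s i y
      = partialDeriv i (partialDeriv k U) y
        - ∑ n, (∑ s, S y s n * localGrad S U s y) * localChristoffel S n i k y := by
  have h1 : partialDeriv i (partialDeriv k U) y
      = ∑ s, (partialDeriv i (fun z => S z k s) y * localGrad S U s y
        + S y k s * partialDeriv i (localGrad S U s) y) := by
    have : partialDeriv k U =ᶠ[𝓝 y] fun z => ∑ s, S z k s * localGrad S U s z := by
      filter_upwards [h.isOpen.mem_nhds hy] with z hz using (h.lower_grad hz k).symm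
    have hd1 : ∀ s, DifferentiableAt ℝ (fun z => S z k s) y := fun s =>
      differentiableAt_of_contDiffOn h.isOpen (h.contDiffOn k s) hy
    have hd2 : ∀ s, DifferentiableAt ℝ (localGrad S U s) y := fun s =>
      differentiableAt_of_contDiffOn h.isOpen (h.contDiffOn_grad hU s) hy
    rw [partialDeriv_congr i this]
    exact partialDeriv_sum_mul (A := fun s z => S z k s) i _ hd1 hd2
  rw [h1]
  simp only [h.partialDeriv_metric hy, localHess, mul_add, add_mul, Finset.sum_add_distrib]
  have e1 : ∑ s, (∑ n, S y s n * localChristoffel S n i k y) * localGrad S U s y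
      = ∑ n, (∑ s, S y s n * localGrad S U s y) * localChristoffel S n i k y := by
    simp only [Finset.sum_mul]
    rw [Finset.sum_comm]
    exact Finset.sum_congr rfl fun _ _ => Finset.sum_congr rfl fun _ _ => by ring
  have e2 : ∑ s, (∑ n, S y k n * localChristoffel S n i s y) * localGrad S U s y
      = ∑ s, S y k s * ∑ n, localChristoffel S s i n y * localGrad S U n y := by
    simp only [Finset.sum_mul, Finset.mul_sum]
    rw [Finset.sum_comm]
    exact Finset.sum_congr rfl fun _ _ => Finset.sum_congr rfl fun _ _ => by ring
  rw [e1, e2]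
  ring

/-- The Hessian of `U` is symmetric. -/
lemma lower_hess_symm (h : IsLocalMetric T S) (hU : ContDiffOn ℝ ∞ U T) (hy : y ∈ T)
    (k i : Fin m) :
    ∑ s, S y k s * localHess S U s i y = ∑ s, S y i s * localHess S U s k y := by
  rw [h.lower_hess hU hy, h.lower_hess hU hy, partialDeriv_comm i k h.isOpen hU hy]
  simp only [h.christoffel_symm hy _ i k]

lemma halfGradNormSq_eq (h : IsLocalMetric T S) (hU : ContDiffOn ℝ ∞ U T) (hy : y ∈ T)
    (k : Fin m) :
    halfGradNormSq S U k y = ∑ i, localGrad S U i y * ∑ j, S y i j * localHess S U j k y := by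
  have hd1 : ∀ s, DifferentiableAt ℝ (partialDeriv s U) y := fun s =>
    differentiableAt_of_contDiffOn h.isOpen (contDiffOn_partialDeriv s h.isOpen hU) hy
  have hd2 : ∀ s, DifferentiableAt ℝ (localGrad S U s) y := fun s =>
    differentiableAt_of_contDiffOn h.isOpen (h.contDiffOn_grad hU s) hy
  have h1 : partialDeriv k (localNormSq S U) y
      = ∑ i, (partialDeriv k (localGrad S U i) y * partialDeriv i U y
        + localGrad S U i y * partialDeriv k (partialDeriv i U) y) :=
    partialDeriv_sum_mul k _ hd2 hd1
  have h2 : ∀ i, ∑ j, S y i j * localHess S U j k y = partialDeriv k (partialDeriv i U) y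
      - ∑ n, partialDeriv n U y * localChristoffel S n k i y := by
    intro i
    rw [h.lower_hess hU hy]
    congr 1
    refine Finset.sum_congr rfl fun n _ => ?_
    rw [← h.lower_grad hy]
    simp only [h.symm hy n]
  -- `Pⁱ ∂_k∂_i U` in terms of the derivatives of `P`, by the symmetry of the Hessian
  have h3 : ∑ i, localGrad S U i y * ∑ j, S y i j * localHess S U j k y
      = ∑ i, partialDeriv i U y * localHess S U i k y := by
    simp only [Finset.mul_sum]
    rw [Finset.sum_comm]
    refine Finset.sum_congr rfl fun i _ => ?_
    rw [← h.lower_grad hy, Finset.sum_mul]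
    exact Finset.sum_congr rfl fun j _ => by rw [h.symm hy]; ring
  have h4 : ∑ i, partialDeriv i U y * localHess S U i k y
      = ∑ i, partialDeriv k (localGrad S U i) y * partialDeriv i U y
        + ∑ i, localGrad S U i y * ∑ n, partialDeriv n U y * localChristoffel S n k i y := by
    simp only [localHess, mul_add, Finset.sum_add_distrib, Finset.mul_sum]
    congr 1
    · exact Finset.sum_congr rfl fun i _ => by ring
    · rw [Finset.sum_comm]
      exact Finset.sum_congr rfl fun _ _ => Finset.sum_congr rfl fun _ _ => by ring
  have h5 : ∑ i, localGrad S U i y * ∑ j, S y i j * localHess S U j k y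
      = ∑ i, localGrad S U i y * partialDeriv k (partialDeriv i U) y
        - ∑ i, localGrad S U i y * ∑ n, partialDeriv n U y * localChristoffel S n k i y := by
    simp only [h2, mul_sub, Finset.sum_sub_distrib]
  rw [halfGradNormSq, h1, Finset.sum_add_distrib]
  linarith

lemma halfGradNormSq_eq_hess (h : IsLocalMetric T S) (hU : ContDiffOn ℝ ∞ U T) (hy : y ∈ T)
    (k : Fin m) :
    halfGradNormSq S U k y = ∑ s, S y k s * ∑ a, localHess S U s a y * localGrad S U a y := by
  rw [h.halfGradNormSq_eq hU hy]
  simp only [h.lower_hess_symm hU hy _ k, Finset.mul_sum]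
  rw [Finset.sum_comm]
  exact Finset.sum_congr rfl fun _ _ => Finset.sum_congr rfl fun _ _ => by ring

end IsLocalMetric

variable {T : Set (EuclideanSpace ℝ (Fin m))}
  {S : EuclideanSpace ℝ (Fin m) → Matrix (Fin m) (Fin m) ℝ}
  {U : EuclideanSpace ℝ (Fin m) → ℝ} {y : EuclideanSpace ℝ (Fin m)}

/-! ### The differential inequality for the area element of a minimal graph -/

/-- The inverse `g^{ij} = σ^{ij} - Pⁱ Pʲ / v²` of the graph metric. -/
def localGraphInv (S : EuclideanSpace ℝ (Fin m) → Matrix (Fin m) (Fin m) ℝ)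
    (U : EuclideanSpace ℝ (Fin m) → ℝ) (y : EuclideanSpace ℝ (Fin m)) :
    Matrix (Fin m) (Fin m) ℝ :=
  Matrix.of fun i j => (S y)⁻¹ i j - localGrad S U i y * localGrad S U j y / localW S U y ^ 2

/-- A smooth solution `U` of the minimal surface equation `∂_i (√det σ · Pⁱ / v) = 0`, over an open
set `T` of `ℝᵐ` with a metric `S`. -/
structure IsLocalMinimalGraph (T : Set (EuclideanSpace ℝ (Fin m)))
    (S : EuclideanSpace ℝ (Fin m) → Matrix (Fin m) (Fin m) ℝ)
    (U : EuclideanSpace ℝ (Fin m) → ℝ) : Prop extends IsLocalMetric T S where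
  contDiffOn_fun : ContDiffOn ℝ ∞ U T
  minimal : ∀ y ∈ T, ∑ i, partialDeriv i
    (fun z => √(S z).det * (localGrad S U i z / localW S U z)) y = 0

namespace IsLocalMetric

/-- The coordinate divergence formula `∂_i (√det σ · Xⁱ) = √det σ · (∂_i Xⁱ + Γᵏ_ki Xⁱ)`. -/
lemma divergence_eq (h : IsLocalMetric T S) (hy : y ∈ T)
    {X : Fin m → EuclideanSpace ℝ (Fin m) → ℝ} (hX : ∀ i, DifferentiableAt ℝ (X i) y) :
    ∑ i, partialDeriv i (fun z => √(S z).det * X i z) y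
      = √(S y).det * (∑ i, partialDeriv i (X i) y
        + ∑ i, ∑ k, localChristoffel S k k i y * X i y) := by
  have hd := differentiableAt_of_contDiffOn h.isOpen h.contDiffOn_sqrt_det hy
  simp only [fun i => partialDeriv_mul i hd (hX i), h.partialDeriv_sqrt_det hy,
    Finset.sum_add_distrib, mul_add, Finset.mul_sum, Finset.sum_mul, mul_assoc]
  ring

/-- The Bochner formula `div (∇_P P - (div P) P) = tr V² - (tr V)² + Ric (P, P)`. -/
lemma divergence_bochnerField (h : IsLocalMetric T S) (hU : ContDiffOn ℝ ∞ U T) (hy : y ∈ T) :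
    ∑ i, partialDeriv i (bochnerField S U i) y
        + ∑ i, ∑ k, localChristoffel S k k i y * bochnerField S U i y
      = ∑ i, ∑ k, localHess S U i k y * localHess S U k i y - (∑ k, localHess S U k k y) ^ 2
        + ∑ i, ∑ j, localRicci S i j y * localGrad S U i y * localGrad S U j y := by
  have dP : ∀ s, DifferentiableAt ℝ (localGrad S U s) y := fun s =>
    differentiableAt_of_contDiffOn h.isOpen (h.contDiffOn_grad hU s) hy
  have dV : ∀ s i, DifferentiableAt ℝ (localHess S U s i) y := fun s i =>
    differentiableAt_of_contDiffOn h.isOpen (h.contDiffOn_hess hU s i) hy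
  have dΓ : ∀ k i j, DifferentiableAt ℝ (localChristoffel S k i j) y := fun k i j =>
    differentiableAt_of_contDiffOn h.isOpen (h.contDiffOn_christoffel k i j) hy
  have dDP : ∀ s i, DifferentiableAt ℝ (partialDeriv i (localGrad S U s)) y := fun s i =>
    differentiableAt_of_contDiffOn h.isOpen
      (contDiffOn_partialDeriv i h.isOpen (h.contDiffOn_grad hU s)) hy
  have hDV : ∀ i s k, partialDeriv i (localHess S U s k) y
      = partialDeriv i (partialDeriv k (localGrad S U s)) y
        + ∑ n, (partialDeriv i (localChristoffel S s k n) y * localGrad S U n y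
          + localChristoffel S s k n y * partialDeriv i (localGrad S U n) y) := by
    intro i s k
    rw [← partialDeriv_sum_mul i _ (fun n => dΓ s k n) dP]
    exact partialDeriv_add i (dDP s k) (DifferentiableAt.fun_sum fun n _ => (dΓ s k n).mul (dP n))
  have hB : ∀ i, partialDeriv i (bochnerField S U i) y
      = ∑ k, (partialDeriv i (localHess S U i k) y * localGrad S U k y
          + localHess S U i k y * partialDeriv i (localGrad S U k) y)
        - (partialDeriv i (localGrad S U i) y * ∑ k, localHess S U k k y
          + localGrad S U i y * ∑ k, partialDeriv i (localHess S U k k) y) := by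
    intro i
    rw [← partialDeriv_sum_mul i _ (fun k => dV i k) dP,
      ← partialDeriv_sum i _ fun k _ => dV k k, ← partialDeriv_mul i (dP i)
        (DifferentiableAt.fun_sum fun k _ => dV k k)]
    exact partialDeriv_sub i (DifferentiableAt.fun_sum fun k _ => (dV i k).mul (dP k))
      ((dP i).mul (DifferentiableAt.fun_sum fun k _ => dV k k))
  have hsymm : ∀ j s i k, partialDeriv j (localChristoffel S s i k) y
      = partialDeriv j (localChristoffel S s k i) y := fun j s i k =>
    partialDeriv_congr j <| by
      filter_upwards [h.isOpen.mem_nhds hy] with z hz using h.christoffel_symm hz s i k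
  simp only [hB]
  exact covariant_divergence_algebra (fun n => localGrad S U n y)
    (fun s i => partialDeriv i (localGrad S U s) y)
    (fun s i k => partialDeriv i (partialDeriv k (localGrad S U s)) y)
    (fun k i j => localChristoffel S k i j y)
    (fun l k i j => partialDeriv l (localChristoffel S k i j) y)
    (fun s i k => partialDeriv_comm i k h.isOpen (h.contDiffOn_grad hU s) hy)
    (fun s i k => h.christoffel_symm hy s i k) hsymm
    (fun s i => localHess S U s i y) (fun i s k => partialDeriv i (localHess S U s k) y)
    (fun s i => rfl) hDV

lemma sum_sum_inv_nonneg (h : IsLocalMetric T S) (hy : y ∈ T) (a : Fin m → ℝ) :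
    0 ≤ ∑ i, ∑ j, (S y)⁻¹ i j * a i * a j := by
  have := (h.posDef y hy).inv.posSemidef.dotProduct_mulVec_nonneg a
  refine this.trans_eq ?_
  simp only [dotProduct, Matrix.mulVec, Pi.star_apply, star_trivial, Finset.mul_sum]
  exact Finset.sum_congr rfl fun _ _ => Finset.sum_congr rfl fun _ _ => by ring

lemma normSq_eq (y : EuclideanSpace ℝ (Fin m)) :
    localNormSq S U y = ∑ i, ∑ j, (S y)⁻¹ i j * partialDeriv i U y * partialDeriv j U y := by
  simp only [localNormSq, localGrad, Finset.sum_mul]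
  exact Finset.sum_congr rfl fun _ _ => Finset.sum_congr rfl fun _ _ => by ring

lemma normSq_nonneg (h : IsLocalMetric T S) (hy : y ∈ T) : 0 ≤ localNormSq S U y := by
  rw [normSq_eq]
  exact h.sum_sum_inv_nonneg hy _

lemma W_sq (h : IsLocalMetric T S) (hy : y ∈ T) : localW S U y ^ 2 = 1 + localNormSq S U y :=
  Real.sq_sqrt (by linarith [h.normSq_nonneg (U := U) hy])

lemma one_le_W (h : IsLocalMetric T S) (hy : y ∈ T) : 1 ≤ localW S U y :=
  Real.one_le_sqrt.2 (by linarith [h.normSq_nonneg (U := U) hy])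

lemma contDiffOn_W (h : IsLocalMetric T S) (hU : ContDiffOn ℝ ∞ U T) :
    ContDiffOn ℝ ∞ (localW S U) T :=
  (contDiffOn_const.add (h.contDiffOn_normSq hU)).sqrt fun _ hz =>
    (by linarith [h.normSq_nonneg (U := U) hz] : (0 : ℝ) < _).ne'

lemma partialDeriv_W (h : IsLocalMetric T S) (hU : ContDiffOn ℝ ∞ U T) (hy : y ∈ T) (k : Fin m) :
    partialDeriv k (localW S U) y = halfGradNormSq S U k y / localW S U y := by
  have hn := h.normSq_nonneg (U := U) hy
  have hd := differentiableAt_of_contDiffOn h.isOpen (h.contDiffOn_normSq hU) hy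
  have h1 := partialDeriv_comp (F := fun z => 1 + localNormSq S U z) (y := y) k
    (Real.hasDerivAt_sqrt (by positivity : 1 + localNormSq S U y ≠ 0))
    ((differentiableAt_const _).add hd)
  have h2 : partialDeriv k (fun z => 1 + localNormSq S U z) y
      = partialDeriv k (localNormSq S U) y := by
    rw [partialDeriv_add k (differentiableAt_const _) hd, partialDeriv_const, zero_add]
  rw [h2] at h1
  refine h1.trans ?_
  rw [halfGradNormSq, localW]
  field_simp

lemma sum_grad_mul (h : IsLocalMetric T S) (hy : y ∈ T) (a : Fin m → ℝ) :
    ∑ i, localGrad S U i y * a i = ∑ i, partialDeriv i U y * ∑ j, (S y)⁻¹ i j * a j := by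
  simp only [localGrad, Finset.sum_mul, Finset.mul_sum]
  rw [Finset.sum_comm]
  exact Finset.sum_congr rfl fun i _ => Finset.sum_congr rfl fun j _ => by rw [h.inv_symm hy]; ring

/-- Cauchy–Schwarz for the metric on covectors. -/
lemma sq_sum_inv_le (h : IsLocalMetric T S) (hy : y ∈ T) (a b : Fin m → ℝ) :
    (∑ i, ∑ j, (S y)⁻¹ i j * a i * b j) ^ 2
      ≤ (∑ i, ∑ j, (S y)⁻¹ i j * a i * a j) * ∑ i, ∑ j, (S y)⁻¹ i j * b i * b j := by
  have hs : ∑ i, ∑ j, (S y)⁻¹ i j * b i * a j = ∑ i, ∑ j, (S y)⁻¹ i j * a i * b j := by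
    rw [Finset.sum_comm]
    exact Finset.sum_congr rfl fun i _ => Finset.sum_congr rfl fun j _ => by
      rw [h.inv_symm hy]; ring
  have key : ∀ t : ℝ, 0 ≤ (∑ i, ∑ j, (S y)⁻¹ i j * b i * b j) * (t * t)
      + (2 * ∑ i, ∑ j, (S y)⁻¹ i j * a i * b j) * t + ∑ i, ∑ j, (S y)⁻¹ i j * a i * a j := by
    intro t
    refine (h.sum_sum_inv_nonneg hy fun i => a i + t * b i).trans_eq ?_
    rw [two_mul]
    nth_rw 2 [← hs]
    simp only [Finset.sum_mul, ← Finset.sum_add_distrib, add_mul]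
    exact Finset.sum_congr rfl fun _ _ => Finset.sum_congr rfl fun _ _ => by ring
  have := discrim_le_zero key
  rw [discrim] at this
  linarith

/-- The inverse graph metric is positive semidefinite. -/
lemma graphInv_nonneg (h : IsLocalMetric T S) (hy : y ∈ T) (a : Fin m → ℝ) :
    0 ≤ ∑ i, ∑ j, localGraphInv S U y i j * a i * a j := by
  have hW := h.W_sq (U := U) hy
  have hn := h.normSq_nonneg (U := U) hy
  have e1 : ∑ i, ∑ j, localGraphInv S U y i j * a i * a j
      = ∑ i, ∑ j, (S y)⁻¹ i j * a i * a j
        - (∑ i, localGrad S U i y * a i) ^ 2 / localW S U y ^ 2 := by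
    rw [sq (∑ i, _), Finset.sum_mul_sum]
    simp only [localGraphInv, Matrix.of_apply, Finset.sum_div, ← Finset.sum_sub_distrib]
    exact Finset.sum_congr rfl fun _ _ => Finset.sum_congr rfl fun _ _ => by ring
  have e2 : (∑ i, localGrad S U i y * a i) ^ 2
      ≤ localNormSq S U y * ∑ i, ∑ j, (S y)⁻¹ i j * a i * a j := by
    rw [normSq_eq]
    refine le_trans (le_of_eq ?_) (h.sq_sum_inv_le hy (fun i => partialDeriv i U y) a)
    rw [h.sum_grad_mul hy]
    simp only [Finset.mul_sum]
    congr 1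
    exact Finset.sum_congr rfl fun _ _ => Finset.sum_congr rfl fun _ _ => by ring
  have h0 := h.sum_sum_inv_nonneg hy a
  rw [e1, sub_nonneg, hW, div_le_iff₀ (by positivity)]
  nlinarith

lemma graphInv_symm (h : IsLocalMetric T S) (hy : y ∈ T) (i j : Fin m) :
    localGraphInv S U y i j = localGraphInv S U y j i := by
  simp only [localGraphInv, Matrix.of_apply]
  rw [h.inv_symm hy, mul_comm (localGrad S U i y)]

end IsLocalMetric

namespace IsLocalMinimalGraph

/-- The minimal surface equation in nondivergence form, `tr V = v⁻² Pᵏ F_k`. -/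
lemma trace_hess (h : IsLocalMinimalGraph T S U) (hy : y ∈ T) :
    ∑ k, localHess S U k k y
      = (∑ k, localGrad S U k y * halfGradNormSq S U k y) / localW S U y ^ 2 := by
  have hL := h.toIsLocalMetric
  have hU := h.contDiffOn_fun
  have dP : ∀ s, DifferentiableAt ℝ (localGrad S U s) y := fun s =>
    differentiableAt_of_contDiffOn h.isOpen (hL.contDiffOn_grad hU s) hy
  have dW : DifferentiableAt ℝ (localW S U) y :=
    differentiableAt_of_contDiffOn h.isOpen (hL.contDiffOn_W hU) hy
  have hW1 := hL.one_le_W (U := U) hy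
  have hW0 : localW S U y ≠ 0 := by positivity
  have dWi : DifferentiableAt ℝ (fun z => (localW S U z)⁻¹) y := dW.inv hW0
  have hd : ∀ i, partialDeriv i (fun z => localGrad S U i z / localW S U z) y
      = partialDeriv i (localGrad S U i) y / localW S U y
        - localGrad S U i y * halfGradNormSq S U i y / localW S U y ^ 3 := by
    intro i
    have h1 := partialDeriv_comp (F := localW S U) i (hasDerivAt_inv hW0) dW
    simp only [div_eq_mul_inv]
    rw [partialDeriv_mul i (dP i) dWi, h1, hL.partialDeriv_W hU hy]
    field_simp
    ring
  have h0 := h.minimal y hy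
  have dX : ∀ i, DifferentiableAt ℝ (fun z => localGrad S U i z / localW S U z) y := by
    simp only [div_eq_mul_inv]
    exact fun i => (dP i).mul dWi
  rw [hL.divergence_eq hy dX] at h0
  have hω := (Real.sqrt_pos.2 (hL.det_pos hy)).ne'
  have h1 := (mul_eq_zero.1 h0).resolve_left hω
  simp only [hd, Finset.sum_sub_distrib] at h1
  have h2 : ∑ k, localHess S U k k y = ∑ i, partialDeriv i (localGrad S U i) y
      + ∑ i, ∑ k, localChristoffel S k k i y * localGrad S U i y := by
    simp only [localHess, Finset.sum_add_distrib]
    rw [Finset.sum_comm]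
  have h3 : ∑ i, ∑ k, localChristoffel S k k i y * (localGrad S U i y / localW S U y)
      = (∑ i, ∑ k, localChristoffel S k k i y * localGrad S U i y) / localW S U y := by
    simp only [Finset.sum_div, mul_div_assoc]
  rw [h3, ← Finset.sum_div, ← Finset.sum_div] at h1
  rw [h2]
  field_simp at h1 ⊢
  linarith

lemma raise_halfGrad (h : IsLocalMinimalGraph T S U) (hy : y ∈ T) (i : Fin m) :
    ∑ j, (S y)⁻¹ i j * halfGradNormSq S U j y = ∑ a, localHess S U i a y * localGrad S U a y := by
  simp only [h.halfGradNormSq_eq_hess h.contDiffOn_fun hy]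
  set c : Fin m → ℝ := fun s => ∑ a, localHess S U s a y * localGrad S U a y
  change ∑ j, (S y)⁻¹ i j * ∑ s, S y j s * c s = c i
  simp only [Finset.mul_sum, ← mul_assoc]
  rw [Finset.sum_comm]
  simp only [← Finset.sum_mul, h.sum_inv_mul hy]
  simp

/-- On a minimal graph the Bochner field is the graph gradient of `½ |DU|²`. -/
lemma bochnerField_eq (h : IsLocalMinimalGraph T S U) (hy : y ∈ T) (i : Fin m) :
    bochnerField S U i y = ∑ j, localGraphInv S U y i j * halfGradNormSq S U j y := by
  rw [bochnerField, ← h.raise_halfGrad hy, h.trace_hess hy]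
  simp only [localGraphInv, Matrix.of_apply, sub_mul, Finset.sum_sub_distrib, Finset.sum_div,
    Finset.mul_sum]
  congr 1
  exact Finset.sum_congr rfl fun _ _ => by ring

/-- The norm of the second fundamental form of the graph is nonnegative. It is a multiple of
`tr (gHgH)`, with `g` the inverse graph metric and `H` the Hessian of `U`; on a minimal graph this
trace is `tr V² - (tr V)² - 2 v⁻² Bⁱ F_i`. -/
lemma secondFundamentalForm_nonneg (h : IsLocalMinimalGraph T S U) (hy : y ∈ T) :
    2 * (∑ i, bochnerField S U i y * halfGradNormSq S U i y) / localW S U y ^ 2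
      ≤ ∑ i, ∑ k, localHess S U i k y * localHess S U k i y - (∑ k, localHess S U k k y) ^ 2 := by
  have hL := h.toIsLocalMetric
  have hU := h.contDiffOn_fun
  set V : Fin m → Fin m → ℝ := fun i k => localHess S U i k y with hV
  set P : Fin m → ℝ := fun i => localGrad S U i y with hP
  set F : Fin m → ℝ := fun i => halfGradNormSq S U i y with hF
  set w := localW S U y ^ 2 with hw
  have hw0 : w ≠ 0 := by
    have := hL.one_le_W (U := U) hy
    positivity
  let H : Matrix (Fin m) (Fin m) ℝ := S y * Matrix.of V
  have hH : H.transpose = H := by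
    ext i j
    simpa [H, Matrix.mul_apply] using hL.lower_hess_symm hU hy j i
  have hg : (localGraphInv S U y).PosSemidef := by
    refine Matrix.PosSemidef.of_dotProduct_mulVec_nonneg ?_ fun x => ?_
    · ext i j
      simpa using hL.graphInv_symm hy j i
    · refine (hL.graphInv_nonneg (U := U) hy x).trans_eq ?_
      simp only [dotProduct, Matrix.mulVec, Pi.star_apply, star_trivial, Finset.mul_sum]
      exact Finset.sum_congr rfl fun _ _ => Finset.sum_congr rfl fun _ _ => by ring
  have hN : ∀ i k, (localGraphInv S U y * H) i k = V i k - P i * F k / w := by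
    intro i k
    have h1 : localGraphInv S U y
        = (S y)⁻¹ - Matrix.of fun i j => P i * P j / w := by
      ext; simp [localGraphInv, hP, hw]
    have h2 : (S y)⁻¹ * H = Matrix.of V := by
      rw [← Matrix.mul_assoc, Matrix.nonsing_inv_mul _ (hL.det_pos hy).ne'.isUnit, Matrix.one_mul]
    rw [h1, Matrix.sub_mul, h2]
    simp only [Matrix.sub_apply, Matrix.of_apply]
    congr 1
    rw [Matrix.mul_apply]
    simp only [H, Matrix.mul_apply, Matrix.of_apply, hF]
    rw [hL.halfGradNormSq_eq hU hy, Finset.mul_sum, Finset.sum_div]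
    exact Finset.sum_congr rfl fun _ _ => by ring
  have htr := trace_mul_symm_sq_nonneg hg hH
  have hVP : ∀ i, ∑ k, V i k * P k = ∑ j, (S y)⁻¹ i j * F j := fun i => (h.raise_halfGrad hy i).symm
  have e1 : ((localGraphInv S U y * H) * (localGraphInv S U y * H)).trace
      = ∑ i, ∑ k, V i k * V k i - 2 * (∑ i, (∑ k, V i k * P k) * F i) / w
        + (∑ i, P i * F i) ^ 2 / w ^ 2 := by
    simp only [Matrix.trace, Matrix.diag_apply, Matrix.mul_apply (M := localGraphInv S U y * H), hN]
    have a1 : ∑ i, ∑ k, V i k * (P k * F i / w) = (∑ i, (∑ k, V i k * P k) * F i) / w := by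
      simp only [Finset.sum_mul, Finset.sum_div]
      exact Finset.sum_congr rfl fun _ _ => Finset.sum_congr rfl fun _ _ => by ring
    have a2 : ∑ i, ∑ k, (P i * F k / w) * V k i = (∑ i, (∑ k, V i k * P k) * F i) / w := by
      rw [Finset.sum_comm, ← a1]
      exact Finset.sum_congr rfl fun _ _ => Finset.sum_congr rfl fun _ _ => by ring
    have a3 : ∑ i, ∑ k, (P i * F k / w) * (P k * F i / w) = (∑ i, P i * F i) ^ 2 / w ^ 2 := by
      rw [sq, Finset.sum_mul_sum]
      simp only [Finset.sum_div]
      exact Finset.sum_congr rfl fun _ _ => Finset.sum_congr rfl fun _ _ => by ring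
    have a4 : ∀ i k, (V i k - P i * F k / w) * (V k i - P k * F i / w)
        = V i k * V k i - V i k * (P k * F i / w) - (P i * F k / w) * V k i
          + (P i * F k / w) * (P k * F i / w) := fun i k => by ring
    simp only [a4, Finset.sum_add_distrib, Finset.sum_sub_distrib, a1, a2, a3]
    ring
  have e2 : ∑ i, bochnerField S U i y * F i
      = ∑ i, (∑ k, V i k * P k) * F i - (∑ i, P i * F i) ^ 2 / w := by
    have : ∀ i, bochnerField S U i y * F i
        = (∑ k, V i k * P k) * F i - P i * F i * ((∑ i, P i * F i) / w) := by
      intro i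
      rw [bochnerField, h.trace_hess hy]
      ring
    simp only [this, Finset.sum_sub_distrib, ← Finset.sum_mul]
    ring
  have e3 : ∑ k, V k k = (∑ i, P i * F i) / w := h.trace_hess hy
  rw [e1] at htr
  rw [e2, e3]
  have : 2 * (∑ i, (∑ k, V i k * P k) * F i - (∑ i, P i * F i) ^ 2 / w) / w
      = 2 * (∑ i, (∑ k, V i k * P k) * F i) / w - 2 * ((∑ i, P i * F i) ^ 2 / w ^ 2) := by
    field_simp
  rw [this, div_pow]
  linarith

/-- The flux `√det σ · v⁻¹ B` of `log v` along the graph has divergence at least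
`√det σ · v |∇ log v|²_g`: this is the inequality `Δ_g log W ≥ |∇ log W|²_g` of a minimal graph
over a manifold of nonnegative Ricci curvature. -/
lemma le_divergence_flux (h : IsLocalMinimalGraph T S U)
    (hRic : ∀ y ∈ T, ∀ w : Fin m → ℝ, 0 ≤ ∑ i, ∑ j, localRicci S i j y * w i * w j)
    (hy : y ∈ T) :
    √(S y).det * (localW S U y)⁻¹ *
        ((∑ i, bochnerField S U i y * halfGradNormSq S U i y) / localW S U y ^ 2)
      ≤ ∑ i, partialDeriv i (fun z => √(S z).det * ((localW S U z)⁻¹ * bochnerField S U i z)) y := by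
  have hL := h.toIsLocalMetric
  have hU := h.contDiffOn_fun
  have dB : ∀ s, DifferentiableAt ℝ (bochnerField S U s) y := fun s =>
    differentiableAt_of_contDiffOn h.isOpen (hL.contDiffOn_bochnerField hU s) hy
  have dW : DifferentiableAt ℝ (localW S U) y :=
    differentiableAt_of_contDiffOn h.isOpen (hL.contDiffOn_W hU) hy
  have hW1 := hL.one_le_W (U := U) hy
  have hW0 : localW S U y ≠ 0 := by positivity
  have hWp : 0 < localW S U y := by positivity
  have dWi : DifferentiableAt ℝ (fun z => (localW S U z)⁻¹) y := dW.inv hW0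
  have dX : ∀ i, DifferentiableAt ℝ (fun z => (localW S U z)⁻¹ * bochnerField S U i z) y :=
    fun i => dWi.mul (dB i)
  have hd : ∀ i, partialDeriv i (fun z => (localW S U z)⁻¹ * bochnerField S U i z) y
      = (localW S U y)⁻¹ * partialDeriv i (bochnerField S U i) y
        - (localW S U y)⁻¹ * ((bochnerField S U i y * halfGradNormSq S U i y)
          / localW S U y ^ 2) := by
    intro i
    have h1 := partialDeriv_comp (F := localW S U) i (hasDerivAt_inv hW0) dW
    rw [partialDeriv_mul i dWi (dB i), h1, hL.partialDeriv_W hU hy]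
    field_simp
    ring
  rw [hL.divergence_eq hy dX]
  simp only [hd, Finset.sum_sub_distrib, ← Finset.mul_sum, ← Finset.sum_div]
  have h3 : ∑ i, ∑ k, localChristoffel S k k i y * ((localW S U y)⁻¹ * bochnerField S U i y)
      = (localW S U y)⁻¹ * ∑ i, ∑ k, localChristoffel S k k i y * bochnerField S U i y := by
    simp only [Finset.mul_sum]
    exact Finset.sum_congr rfl fun _ _ => Finset.sum_congr rfl fun _ _ => by ring
  rw [h3, mul_assoc]
  refine mul_le_mul_of_nonneg_left ?_ (Real.sqrt_nonneg _)
  have hdiv := hL.divergence_bochnerField hU hy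
  have hII := h.secondFundamentalForm_nonneg hy
  have hR := hRic y hy fun i => localGrad S U i y
  rw [sub_add_eq_add_sub, ← mul_add, ← mul_sub]
  refine mul_le_mul_of_nonneg_left ?_ (inv_nonneg.2 hWp.le)
  rw [mul_div_assoc] at hII
  linarith

end IsLocalMinimalGraph

/-! ### Lipschitz test functions and integration by parts -/

open scoped NNReal

variable {T : Set (EuclideanSpace ℝ (Fin m))} {y : EuclideanSpace ℝ (Fin m)}

section Lipschitz

variable {X : Type*} [PseudoMetricSpace X]

lemma locallyLipschitzOn_mul {s : Set X} {f g : X → ℝ} (hf : LocallyLipschitzOn s f)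
    (hg : LocallyLipschitzOn s g) : LocallyLipschitzOn s fun x => f x * g x := by
  rw [locallyLipschitzOn_iff_restrict] at *
  exact (contDiff_mul (n := 1) (𝕜 := ℝ) (𝔸 := ℝ)).locallyLipschitz.comp (hf.prodMk hg)

lemma locallyLipschitzOn_of_contDiffOn (hT : IsOpen T) {F : EuclideanSpace ℝ (Fin m) → ℝ}
    (hF : ContDiffOn ℝ ∞ F T) : LocallyLipschitzOn T F := by
  intro x hx
  obtain ⟨K, t, ht, hK⟩ := ((hF.contDiffAt (hT.mem_nhds hx)).of_le
    (by exact WithTop.coe_le_coe.2 le_top)).exists_lipschitzOnWith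
  exact ⟨K, t, mem_nhdsWithin_of_mem_nhds ht, hK⟩

/-- Rademacher's theorem for a locally Lipschitz function on an open set. -/
lemma ae_differentiableAt_of_locallyLipschitzOn (hT : IsOpen T)
    {F : EuclideanSpace ℝ (Fin m) → ℝ} (hF : LocallyLipschitzOn T F) :
    ∀ᵐ y, y ∈ T → DifferentiableAt ℝ F y := by
  rw [ae_iff]
  refine measure_null_of_locally_null _ fun x hx => ?_
  simp only [Classical.not_imp, mem_ofPred_eq] at hx
  obtain ⟨K, t, ht, hK⟩ := hF hx.1
  rw [nhdsWithin_eq_nhds.2 (hT.mem_nhds hx.1)] at ht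
  obtain ⟨V, hVt, hV, hxV⟩ := mem_nhds_iff.1 ht
  have hae := (hK.mono hVt).ae_differentiableWithinAt_of_mem (μ := volume)
  refine ⟨V ∩ {a | ¬(a ∈ T → DifferentiableAt ℝ F a)}, Filter.inter_mem
    (mem_nhdsWithin_of_mem_nhds (hV.mem_nhds hxV)) self_mem_nhdsWithin, ?_⟩
  · refine measure_mono_null ?_ (ae_iff.1 hae)
    rintro a ⟨haV, ha⟩ hcon
    simp only [Classical.not_imp, mem_ofPred_eq] at ha
    exact ha.2 ((hcon haV).differentiableAt (hV.mem_nhds haV))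

lemma exists_lipschitzWith_of_hasCompactSupport (hT : IsOpen T)
    {η : EuclideanSpace ℝ (Fin m) → ℝ} (hη : LocallyLipschitzOn T η) (hc : HasCompactSupport η)
    (hs : tsupport η ⊆ T) : ∃ K, LipschitzWith K η := by
  have hloc : LocallyLipschitz η := by
    intro x
    by_cases hx : x ∈ T
    · obtain ⟨K, t, ht, hK⟩ := hη hx
      rw [nhdsWithin_eq_nhds.2 (hT.mem_nhds hx)] at ht
      exact ⟨K, t, ht, hK⟩
    · refine ⟨0, (tsupport η)ᶜ, (isClosed_tsupport η).isOpen_compl.mem_nhds fun h => hx (hs h), ?_⟩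
      intro a ha b hb
      rw [image_eq_zero_of_notMem_tsupport ha, image_eq_zero_of_notMem_tsupport hb]
      simp
  obtain ⟨r, hr⟩ := hc.isCompact.isBounded.subset_closedBall 0
  obtain ⟨K, hK⟩ := (hloc.locallyLipschitzOn (s := Metric.closedBall 0 (r + 1))
    ).exists_lipschitzOnWith_of_compact (isCompact_closedBall _ _)
  obtain ⟨B, hB⟩ := hc.exists_bound_of_continuous hloc.continuous
  have key : ∀ a ∈ tsupport η, ∀ b, dist (η a) (η b) ≤ (max K B.toNNReal : ℝ≥0) * dist a b := by
    intro a ha b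
    by_cases hb : b ∈ Metric.closedBall (0 : EuclideanSpace ℝ (Fin m)) (r + 1)
    · refine (hK.dist_le_mul a (Metric.closedBall_subset_closedBall (by linarith) (hr ha))
        b hb).trans ?_
      gcongr
      exact le_max_left _ _
    · have h1 : 1 ≤ dist a b := by
        have h2 := hr ha
        simp only [Metric.mem_closedBall, not_le] at h2 hb
        have := dist_triangle b a 0
        rw [dist_comm b a] at this
        linarith
      have hb0 : η b = 0 := image_eq_zero_of_notMem_tsupport fun h => hb
        (Metric.closedBall_subset_closedBall (by linarith) (hr h))
      rw [hb0, dist_zero_right]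
      calc ‖η a‖ ≤ B := hB a
        _ ≤ (max K B.toNNReal : ℝ≥0) * 1 := by
          rw [mul_one]
          exact (Real.le_coe_toNNReal B).trans (NNReal.coe_le_coe.2 (le_max_right _ _))
        _ ≤ _ := by gcongr
  refine ⟨max K B.toNNReal, LipschitzWith.of_dist_le_mul fun a b => ?_⟩
  by_cases ha : a ∈ tsupport η
  · exact key a ha b
  by_cases hb : b ∈ tsupport η
  · rw [dist_comm, dist_comm a]
    exact key b hb a
  · rw [image_eq_zero_of_notMem_tsupport ha, image_eq_zero_of_notMem_tsupport hb, dist_self]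
    positivity

end Lipschitz

lemma partialDeriv_eq_zero_of_notMem_tsupport {η : EuclideanSpace ℝ (Fin m) → ℝ} (i : Fin m)
    (hy : y ∉ tsupport η) : partialDeriv i η y = 0 := by
  have : η =ᶠ[𝓝 y] fun _ => 0 := by
    filter_upwards [(isClosed_tsupport η).isOpen_compl.mem_nhds hy] with z hz
    exact image_eq_zero_of_notMem_tsupport hz
  rw [partialDeriv_congr i this, partialDeriv_const]

/-- The weak form, against a nonnegative Lipschitz test function `η`, of the differential
inequality `div X ≥ q`. -/
lemma integral_flux_add_le_zero (hT : IsOpen T) {X : Fin m → EuclideanSpace ℝ (Fin m) → ℝ}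
    {q η : EuclideanSpace ℝ (Fin m) → ℝ} (hX : ∀ i, ContDiffOn ℝ ∞ (X i) T)
    (hq : ContinuousOn q T) (hle : ∀ y ∈ T, q y ≤ ∑ i, partialDeriv i (X i) y) {K : ℝ≥0}
    (hη : LipschitzWith K η) (h0 : ∀ y, 0 ≤ η y) (hc : HasCompactSupport η)
    (hs : tsupport η ⊆ T) :
    Integrable (fun y => ∑ i, X i y * partialDeriv i η y + η y * q y) ∧
      ∫ y, (∑ i, X i y * partialDeriv i η y + η y * q y) ≤ 0 := by
  obtain ⟨L, hLc, hLi, hLT⟩ := exists_compact_between hc.isCompact hT hs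
  obtain ⟨b, hb1, hb0, -⟩ := exists_contMDiffMap_one_nhds_of_subset_interior (n := ⊤)
    𝓘(ℝ, EuclideanSpace ℝ (Fin m)) (isClosed_tsupport η) hLi
  have hbs : ContDiff ℝ ∞ b := b.contMDiff.contDiff
  have hb1' : ∀ z ∈ tsupport η, ∀ᶠ x in 𝓝 z, b x = 1 := fun z hz =>
    eventually_nhdsSet_iff_forall.1 hb1 z hz
  -- cutting off by `b` makes functions on `T` global without changing the integrals
  have hoff : ∀ {g : EuclideanSpace ℝ (Fin m) → ℝ} {z}, z ∉ T →
      (fun x => b x * g x) =ᶠ[𝓝 z] fun _ => 0 := by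
    intro g z hz
    filter_upwards [hLc.isClosed.isOpen_compl.mem_nhds fun h => hz (hLT h)] with x hx
    rw [hb0 x hx, zero_mul]
  have hcs : ∀ {g : EuclideanSpace ℝ (Fin m) → ℝ}, HasCompactSupport fun x => b x * g x := by
    intro g
    refine HasCompactSupport.of_support_subset_isCompact hLc fun x hx => ?_
    by_contra hcon
    exact hx (by simp [hb0 x hcon])
  have hqc : Continuous fun x => b x * q x := by
    rw [continuous_iff_continuousAt]
    intro z
    by_cases hz : z ∈ T
    · exact hbs.continuous.continuousAt.mul (hq.continuousAt (hT.mem_nhds hz))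
    · exact continuousAt_const.congr (hoff hz).symm
  have hf : ∀ i, ContDiff ℝ ∞ fun x => b x * X i x := by
    intro i
    rw [contDiff_iff_contDiffAt]
    intro z
    by_cases hz : z ∈ T
    · exact hbs.contDiffAt.mul ((hX i).contDiffAt (hT.mem_nhds hz))
    · exact contDiffAt_const.congr_of_eventuallyEq (hoff hz)
  have hXf : ∀ i y, X i y * partialDeriv i η y = b y * X i y * partialDeriv i η y := by
    intro i y
    by_cases hy : y ∈ tsupport η
    · rw [(hb1' y hy).self_of_nhds, one_mul]
    · rw [partialDeriv_eq_zero_of_notMem_tsupport i hy, mul_zero, mul_zero]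
  have hqf : ∀ y, η y * q y = η y * (b y * q y) := by
    intro y
    by_cases hy : y ∈ tsupport η
    · rw [(hb1' y hy).self_of_nhds, one_mul]
    · rw [image_eq_zero_of_notMem_tsupport hy, zero_mul, zero_mul]
  have hdf : ∀ i y, η y * partialDeriv i (fun x => b x * X i x) y
      = η y * partialDeriv i (X i) y := by
    intro i y
    by_cases hy : y ∈ tsupport η
    · rw [partialDeriv_congr i (G := X i)]
      filter_upwards [hb1' y hy] with x hx
      rw [hx, one_mul]
    · rw [image_eq_zero_of_notMem_tsupport hy, zero_mul, zero_mul]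
  have hint1 : ∀ i, Integrable fun y => b y * X i y * partialDeriv i η y := by
    intro i
    refine ((hf i).continuous.integrable_of_hasCompactSupport hcs).mul_bdd (c := K)
      (measurable_fderiv_apply_const ℝ η _).aestronglyMeasurable (ae_of_all _ fun y => ?_)
    refine ((fderiv ℝ η y).le_opNorm _).trans ?_
    simpa using norm_fderiv_le_of_lipschitz ℝ hη
  have hint2 : Integrable fun y => η y * (b y * q y) :=
    (hη.continuous.mul hqc).integrable_of_hasCompactSupport hc.mul_right
  have hint3 : ∀ i, Integrable fun y => η y * partialDeriv i (fun x => b x * X i x) y := by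
    intro i
    refine (hη.continuous.mul ?_).integrable_of_hasCompactSupport hc.mul_right
    exact continuousOn_univ.1
      (contDiffOn_partialDeriv i isOpen_univ (hf i).contDiffOn).continuousOn
  have hparts : ∀ i, ∫ y, b y * X i y * partialDeriv i η y
      = -∫ y, η y * partialDeriv i (fun x => b x * X i x) y := by
    intro i
    obtain ⟨D, hD⟩ := (hf i).lipschitzWith_of_hasCompactSupport hcs (by simp)
    have h1 := hD.integral_lineDeriv_mul_eq (μ := volume) hη hc (EuclideanSpace.single i 1)
    have h2 : ∫ y, lineDeriv ℝ (fun x => b x * X i x) y (EuclideanSpace.single i 1) * η y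
        = ∫ y, η y * partialDeriv i (fun x => b x * X i x) y := by
      refine integral_congr_ae (ae_of_all _ fun y => ?_)
      simp only
      rw [((hf i).differentiable (by simp) y).lineDeriv_eq_fderiv, mul_comm, partialDeriv]
    have h3 : ∫ y, lineDeriv ℝ η y (-EuclideanSpace.single i 1) * (b y * X i y)
        = -∫ y, b y * X i y * partialDeriv i η y := by
      rw [← integral_neg]
      refine integral_congr_ae ?_
      filter_upwards [hη.ae_differentiableAt (μ := volume)] with y hy
      rw [hy.lineDeriv_eq_fderiv, map_neg, partialDeriv]
      ring
    rw [h2, h3] at h1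
    rw [h1, neg_neg]
  simp only [hXf, hqf]
  have hsum : Integrable fun y => ∑ i, b y * X i y * partialDeriv i η y :=
    integrable_finsetSum _ fun i _ => hint1 i
  refine ⟨hsum.add hint2, ?_⟩
  rw [integral_add hsum hint2, integral_finsetSum _ fun i _ => hint1 i]
  simp only [hparts, Finset.sum_neg_distrib]
  rw [← integral_finsetSum _ fun i _ => hint3 i, neg_add_nonpos_iff]
  refine integral_mono hint2 (integrable_finsetSum _ fun i _ => hint3 i) fun y => ?_
  simp only [hdf, ← Finset.mul_sum, ← hqf]
  by_cases hy : y ∈ T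
  · exact mul_le_mul_of_nonneg_left (hle y hy) (h0 y)
  · rw [image_eq_zero_of_notMem_tsupport fun h => hy (hs h), zero_mul, zero_mul]

/-! ### Integral inequalities on a minimal graph in a coordinate patch -/

variable {T : Set (EuclideanSpace ℝ (Fin m))}
  {S : EuclideanSpace ℝ (Fin m) → Matrix (Fin m) (Fin m) ℝ}
  {U : EuclideanSpace ℝ (Fin m) → ℝ} {y : EuclideanSpace ℝ (Fin m)}

/-- The weak form of `div X ≥ q` against the test function `A φ²`, with `A` smooth and `φ` Lipschitz.
The hypothesis on `f` involves the derivatives of `φ` only where they exist. -/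
lemma integral_le_zero_of_test (hT : IsOpen T) {X : Fin m → EuclideanSpace ℝ (Fin m) → ℝ}
    {q A φ f : EuclideanSpace ℝ (Fin m) → ℝ} (hX : ∀ i, ContDiffOn ℝ ∞ (X i) T)
    (hq : ContinuousOn q T) (hle : ∀ y ∈ T, q y ≤ ∑ i, partialDeriv i (X i) y)
    (hA : ContDiffOn ℝ ∞ A T) (hA0 : ∀ y ∈ T, 0 ≤ A y) (hφ : LocallyLipschitzOn T φ)
    {K : Set (EuclideanSpace ℝ (Fin m))} (hK : IsCompact K) (hKT : K ⊆ T)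
    (hsupp : ∀ y ∈ T, y ∉ K → A y * φ y = 0) (hf : IntegrableOn f T)
    (hfle : ∀ y ∈ T, DifferentiableAt ℝ φ y →
      f y ≤ ∑ i, X i y * (φ y ^ 2 * partialDeriv i A y + 2 * A y * φ y * partialDeriv i φ y)
        + A y * φ y ^ 2 * q y) :
    ∫ y in T, f y ≤ 0 := by
  set η : EuclideanSpace ℝ (Fin m) → ℝ := T.indicator fun y => A y * φ y * φ y with hηdef
  have hsub : Function.support η ⊆ K := by
    intro y hy
    by_contra hyK
    refine hy ?_
    by_cases hyT : y ∈ T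
    · rw [hηdef, indicator_of_mem hyT, hsupp y hyT hyK, zero_mul]
    · exact indicator_of_notMem hyT _
  have hc : HasCompactSupport η := HasCompactSupport.of_support_subset_isCompact hK hsub
  have hs : tsupport η ⊆ T := (closure_minimal hsub hK.isClosed).trans hKT
  have hloc : LocallyLipschitzOn T η := by
    have h1 := locallyLipschitzOn_mul
      (locallyLipschitzOn_mul (locallyLipschitzOn_of_contDiffOn hT hA) hφ) hφ
    intro x hx
    obtain ⟨L, t, ht, hL⟩ := h1 hx
    refine ⟨L, t ∩ T, Filter.inter_mem ht self_mem_nhdsWithin, fun a ha b hb => ?_⟩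
    rw [hηdef, indicator_of_mem ha.2, indicator_of_mem hb.2]
    exact hL ha.1 hb.1
  obtain ⟨L, hL⟩ := exists_lipschitzWith_of_hasCompactSupport hT hloc hc hs
  have h0 : ∀ y, 0 ≤ η y := fun y => indicator_nonneg
    (fun z hz => by rw [mul_assoc]; exact mul_nonneg (hA0 z hz) (mul_self_nonneg _)) y
  obtain ⟨hint, hI⟩ := integral_flux_add_le_zero hT hX hq hle hL h0 hc hs
  have hae : ∀ᵐ y, y ∈ T → f y ≤ ∑ i, X i y * partialDeriv i η y + η y * q y := by
    filter_upwards [ae_differentiableAt_of_locallyLipschitzOn hT hφ] with y hy hyT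
    have hφd := hy hyT
    have hAd := differentiableAt_of_contDiffOn hT hA hyT
    refine (hfle y hyT hφd).trans_eq ?_
    have hηy : η y = A y * φ y ^ 2 := by rw [hηdef, indicator_of_mem hyT]; ring
    have hpd : ∀ i, partialDeriv i η y
        = φ y ^ 2 * partialDeriv i A y + 2 * A y * φ y * partialDeriv i φ y := by
      intro i
      have heq : η =ᶠ[𝓝 y] fun z => A z * φ z * φ z := by
        filter_upwards [hT.mem_nhds hyT] with z hz
        rw [hηdef, indicator_of_mem hz]
      have hAφ : DifferentiableAt ℝ (fun z => A z * φ z) y := hAd.mul hφd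
      rw [partialDeriv_congr i heq, partialDeriv_mul i hAφ hφd, partialDeriv_mul i hAd hφd]
      ring
    simp only [hpd, hηy]
  calc ∫ y in T, f y
      ≤ ∫ y in T, (∑ i, X i y * partialDeriv i η y + η y * q y) := by
        refine setIntegral_mono_on_ae hf hint.integrableOn hT.measurableSet hae
    _ = ∫ y, (∑ i, X i y * partialDeriv i η y + η y * q y) := by
        refine setIntegral_eq_integral_of_forall_compl_eq_zero fun y hy => ?_
        have hys : y ∉ tsupport η := fun h => hy (hs h)
        simp [partialDeriv_eq_zero_of_notMem_tsupport _ hys,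
          image_eq_zero_of_notMem_tsupport hys]
    _ ≤ 0 := hI

/-- The function `ζ = log v - C U`, whose exponential is `v e^{-C U}`. -/
def localLogZ (S : EuclideanSpace ℝ (Fin m) → Matrix (Fin m) (Fin m) ℝ)
    (U : EuclideanSpace ℝ (Fin m) → ℝ) (C : ℝ) (y : EuclideanSpace ℝ (Fin m)) : ℝ :=
  Real.log (localW S U y) - C * U y

namespace IsLocalMinimalGraph

lemma contDiffOn_logZ (h : IsLocalMinimalGraph T S U) (C : ℝ) :
    ContDiffOn ℝ ∞ (localLogZ S U C) T :=
  ((h.contDiffOn_W h.contDiffOn_fun).log fun y hy =>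
    (zero_lt_one.trans_le (h.one_le_W hy)).ne').sub (contDiffOn_const.mul h.contDiffOn_fun)

lemma partialDeriv_logZ (h : IsLocalMinimalGraph T S U) (C : ℝ) (hy : y ∈ T) (j : Fin m) :
    partialDeriv j (localLogZ S U C) y
      = halfGradNormSq S U j y / localW S U y ^ 2 - C * partialDeriv j U y := by
  have hW0 : localW S U y ≠ 0 := (zero_lt_one.trans_le (h.one_le_W hy)).ne'
  have dW := differentiableAt_of_contDiffOn h.isOpen (h.contDiffOn_W h.contDiffOn_fun) hy
  have dU := differentiableAt_of_contDiffOn h.isOpen h.contDiffOn_fun hy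
  have hlog := partialDeriv_comp j (Real.hasDerivAt_log hW0) dW
  have dlog : DifferentiableAt ℝ (fun z => Real.log (localW S U z)) y := dW.log hW0
  have := partialDeriv_sub j dlog (dU.const_mul C)
  rw [hlog, partialDeriv_const_mul j C dU, h.partialDeriv_W h.contDiffOn_fun hy] at this
  refine this.trans ?_
  field_simp

lemma graphInv_mul_deriv (h : IsLocalMinimalGraph T S U) (hy : y ∈ T) (i : Fin m) :
    ∑ j, localGraphInv S U y i j * partialDeriv j U y
      = localGrad S U i y / localW S U y ^ 2 := by
  have hW0 : localW S U y ≠ 0 := (zero_lt_one.trans_le (h.one_le_W hy)).ne'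
  have hW := h.W_sq hy (U := U)
  have h1 : ∑ j, localGraphInv S U y i j * partialDeriv j U y
      = localGrad S U i y - localGrad S U i y * localNormSq S U y / localW S U y ^ 2 := by
    simp only [localGraphInv, Matrix.of_apply, sub_mul, Finset.sum_sub_distrib]
    congr 1
    rw [localNormSq, Finset.mul_sum, Finset.sum_div]
    exact Finset.sum_congr rfl fun _ _ => by ring
  have : localNormSq S U y = localW S U y ^ 2 - 1 := by linarith
  rw [h1, this]
  field_simp
  ring

/-- The flux of `ζ = log W - C u` on a minimal graph. -/
lemma flux_logZ (h : IsLocalMinimalGraph T S U) (C : ℝ) (hy : y ∈ T) (i : Fin m) :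
    √(S y).det * ((localW S U y)⁻¹ * bochnerField S U i y)
        - C * (√(S y).det * (localGrad S U i y / localW S U y))
      = √(S y).det * localW S U y
        * ∑ j, localGraphInv S U y i j * partialDeriv j (localLogZ S U C) y := by
  have hW0 : localW S U y ≠ 0 := (zero_lt_one.trans_le (h.one_le_W hy)).ne'
  have h1 : ∑ j, localGraphInv S U y i j * partialDeriv j (localLogZ S U C) y
      = bochnerField S U i y / localW S U y ^ 2
        - C * (localGrad S U i y / localW S U y ^ 2) := by
    rw [h.bochnerField_eq hy, ← h.graphInv_mul_deriv hy, Finset.sum_div, Finset.mul_sum,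
      ← Finset.sum_sub_distrib]
    exact Finset.sum_congr rfl fun _ _ => by rw [h.partialDeriv_logZ C hy]; ring
  rw [h1]
  field_simp

lemma graphInv_le (a : Fin m → ℝ) :
    ∑ i, ∑ j, localGraphInv S U y i j * a i * a j ≤ ∑ i, ∑ j, (S y)⁻¹ i j * a i * a j := by
  have e1 : ∑ i, ∑ j, localGraphInv S U y i j * a i * a j
      = ∑ i, ∑ j, (S y)⁻¹ i j * a i * a j
        - (∑ i, localGrad S U i y * a i) ^ 2 / localW S U y ^ 2 := by
    rw [sq (∑ i, _), Finset.sum_mul_sum]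
    simp only [localGraphInv, Matrix.of_apply, Finset.sum_div, ← Finset.sum_sub_distrib]
    exact Finset.sum_congr rfl fun _ _ => Finset.sum_congr rfl fun _ _ => by ring
  rw [e1]
  have : 0 ≤ (∑ i, localGrad S U i y * a i) ^ 2 / localW S U y ^ 2 := by positivity
  linarith

/-- The Caccioppoli inequality for `z = W e^{-C u}`, localized by a cutoff `χ`. -/
theorem integral_logZ_test_le (h : IsLocalMinimalGraph T S U)
    (hRic : ∀ y ∈ T, ∀ w : Fin m → ℝ, 0 ≤ ∑ i, ∑ j, localRicci S i j y * w i * w j)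
    (C : ℝ) {lam : ℝ → ℝ} (hlam : ContDiff ℝ ∞ lam) (hmono : Monotone lam) (hlam0 : ∀ t, 0 ≤ lam t)
    {χ φ κ : EuclideanSpace ℝ (Fin m) → ℝ} (hχ : ContDiffOn ℝ ∞ χ T) (hχ0 : ∀ y ∈ T, 0 ≤ χ y)
    (hφ : LocallyLipschitzOn T φ) {K : Set (EuclideanSpace ℝ (Fin m))} (hK : IsCompact K)
    (hKT : K ⊆ T) (hsupp : ∀ y ∈ T, y ∉ K → χ y * φ y = 0)
    (hκ : ∀ y ∈ T, DifferentiableAt ℝ φ y →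
      ∑ i, ∑ j, (S y)⁻¹ i j * partialDeriv i φ y * partialDeriv j φ y ≤ κ y)
    (hint : IntegrableOn (fun y => √(S y).det * (localW S U y * (Real.exp (-2 * C * U y)
      * lam (localLogZ S U C y) * (φ y ^ 2 * ∑ i, partialDeriv i χ y
          * ∑ j, localGraphInv S U y i j * partialDeriv j (localLogZ S U C) y
        + χ y * (C ^ 2 * (1 - (localW S U y ^ 2)⁻¹) * φ y ^ 2 - κ y))))) T) :
    ∫ y in T, √(S y).det * (localW S U y * (Real.exp (-2 * C * U y)
      * lam (localLogZ S U C y) * (φ y ^ 2 * ∑ i, partialDeriv i χ y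
          * ∑ j, localGraphInv S U y i j * partialDeriv j (localLogZ S U C) y
        + χ y * (C ^ 2 * (1 - (localW S U y ^ 2)⁻¹) * φ y ^ 2 - κ y)))) ≤ 0 := by
  have hL := h.toIsLocalMetric
  have hU := h.contDiffOn_fun
  have hϖs := hL.contDiffOn_sqrt_det
  have hWs := hL.contDiffOn_W hU
  have hW0 : ∀ y ∈ T, localW S U y ≠ 0 := fun y hy => (zero_lt_one.trans_le (h.one_le_W hy)).ne'
  have hY : ∀ i, ContDiffOn ℝ ∞
      (fun z => √(S z).det * ((localW S U z)⁻¹ * bochnerField S U i z)) T := fun i =>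
    hϖs.mul ((hWs.inv hW0).mul (hL.contDiffOn_bochnerField hU i))
  have hX : ∀ i, ContDiffOn ℝ ∞
      (fun z => √(S z).det * (localGrad S U i z / localW S U z)) T := fun i =>
    hϖs.mul ((hL.contDiffOn_grad hU i).div hWs hW0)
  have hexp : ContDiffOn ℝ ∞ (fun y => Real.exp (-2 * C * U y)) T :=
    (contDiffOn_const.mul hU).exp
  have hζ := h.contDiffOn_logZ C
  have hF : ∀ k, ContDiffOn ℝ ∞ (halfGradNormSq S U k) T := fun k =>
    contDiffOn_const.mul (contDiffOn_partialDeriv k h.isOpen (hL.contDiffOn_normSq hU))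
  refine integral_le_zero_of_test h.isOpen (A := fun y => χ y * (lam (localLogZ S U C y)
      * Real.exp (-2 * C * U y))) (φ := φ)
    (X := fun i z => √(S z).det * ((localW S U z)⁻¹ * bochnerField S U i z)
      - C * (√(S z).det * (localGrad S U i z / localW S U z)))
    (q := fun z => √(S z).det * (localW S U z)⁻¹ *
        ((∑ i, bochnerField S U i z * halfGradNormSq S U i z) / localW S U z ^ 2))
    (fun i => (hY i).sub (contDiffOn_const.mul (hX i))) ?_ ?_ ?_ ?_ hφ hK hKT ?_ hint ?_
  · refine ContDiffOn.continuousOn (n := ∞) ((hϖs.mul (hWs.inv hW0)).mul (ContDiffOn.div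
      (ContDiffOn.sum fun i _ => (hL.contDiffOn_bochnerField hU i).mul (hF i)) (hWs.pow 2)
      fun y hy => pow_ne_zero 2 (hW0 y hy)))
  · intro y hy
    refine (h.le_divergence_flux hRic hy).trans_eq ?_
    have : ∀ i, partialDeriv i (fun z => √(S z).det * ((localW S U z)⁻¹ * bochnerField S U i z)
        - C * (√(S z).det * (localGrad S U i z / localW S U z))) y
        = partialDeriv i (fun z => √(S z).det * ((localW S U z)⁻¹ * bochnerField S U i z)) y
          - C * partialDeriv i (fun z => √(S z).det * (localGrad S U i z / localW S U z)) y := by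
      intro i
      have d1 := differentiableAt_of_contDiffOn h.isOpen (hY i) hy
      have d2 := differentiableAt_of_contDiffOn h.isOpen (hX i) hy
      rw [partialDeriv_sub i d1 (d2.const_mul C), partialDeriv_const_mul i C d2]
    simp only [this, Finset.sum_sub_distrib, ← Finset.mul_sum, h.minimal y hy]
    ring
  · exact hχ.mul ((hlam.comp_contDiffOn hζ).mul hexp)
  · intro y hy
    exact mul_nonneg (hχ0 y hy) (mul_nonneg (hlam0 _) (Real.exp_pos _).le)
  · intro y hy hyK
    rw [mul_right_comm, hsupp y hy hyK, zero_mul]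
  · intro y hy hφd
    have dχ := differentiableAt_of_contDiffOn h.isOpen hχ hy
    have dζ := differentiableAt_of_contDiffOn h.isOpen hζ hy
    have dU := differentiableAt_of_contDiffOn h.isOpen hU hy
    have dlamζ : DifferentiableAt ℝ (fun z => lam (localLogZ S U C z)) y :=
      ((hlam.differentiable (by simp)) _).comp y dζ
    have dexp : DifferentiableAt ℝ (fun z => Real.exp (-2 * C * U z)) y := (dU.const_mul _).exp
    set W := localW S U y
    set ϖ := √(S y).det
    set e := Real.exp (-2 * C * U y) with he
    set l := lam (localLogZ S U C y)
    set l' := deriv lam (localLogZ S U C y)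
    have hl' : 0 ≤ l' := hmono.deriv_nonneg
    have hl : 0 ≤ l := hlam0 _
    have hep : 0 < e := Real.exp_pos _
    have hWp : 0 < W := zero_lt_one.trans_le (h.one_le_W hy)
    have hϖp : 0 < ϖ := Real.sqrt_pos.2 (hL.det_pos hy)
    set dz : Fin m → ℝ := fun j => partialDeriv j (localLogZ S U C) y with hdz
    set p : Fin m → ℝ := fun j => partialDeriv j U y with hp
    set F : Fin m → ℝ := fun j => halfGradNormSq S U j y with hFdef
    set dφ : Fin m → ℝ := fun j => partialDeriv j φ y with hdφ
    set dc : Fin m → ℝ := fun j => partialDeriv j χ y with hdc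
    -- the graph metric on covectors
    set G := Matrix.toBilin' (localGraphInv S U y) with hG
    have hGa : ∀ a b : Fin m → ℝ, G a b = ∑ i, a i * ∑ j, localGraphInv S U y i j * b j := by
      intro a b
      rw [hG, Matrix.toBilin'_apply]
      simp only [Finset.mul_sum]
      exact Finset.sum_congr rfl fun _ _ => Finset.sum_congr rfl fun _ _ => by ring
    have hGs : ∀ a b : Fin m → ℝ, G a b = G b a := by
      intro a b
      rw [hG, Matrix.toBilin'_apply, Matrix.toBilin'_apply, Finset.sum_comm]
      exact Finset.sum_congr rfl fun i _ => Finset.sum_congr rfl fun j _ => by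
        rw [hL.graphInv_symm hy]; ring
    have hGq : ∀ a : Fin m → ℝ, G a a = ∑ i, ∑ j, localGraphInv S U y i j * a i * a j := by
      intro a
      rw [hG, Matrix.toBilin'_apply]
      exact Finset.sum_congr rfl fun _ _ => Finset.sum_congr rfl fun _ _ => by ring
    have hG0 : ∀ a : Fin m → ℝ, 0 ≤ G a a := fun a => by
      rw [hGq]; exact hL.graphInv_nonneg hy a
    have hdA : ∀ i, partialDeriv i (fun y => χ y * (lam (localLogZ S U C y)
        * Real.exp (-2 * C * U y))) y
        = l * e * dc i + χ y * (l' * e) * dz i - 2 * C * (χ y * l * e) * p i := by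
      intro i
      have dm : DifferentiableAt ℝ (fun z => lam (localLogZ S U C z) * Real.exp (-2 * C * U z)) y :=
        dlamζ.mul dexp
      rw [partialDeriv_mul i dχ dm, partialDeriv_mul i dlamζ dexp,
        partialDeriv_comp i ((hlam.differentiable (by simp)) _).hasDerivAt dζ,
        partialDeriv_comp i (Real.hasDerivAt_exp _) (dU.const_mul _),
        partialDeriv_const_mul i _ dU]
      ring
    have hflux : ∀ i, ϖ * (W⁻¹ * bochnerField S U i y) - C * (ϖ * (localGrad S U i y / W))
        = ϖ * W * ∑ j, localGraphInv S U y i j * dz j := fun i => h.flux_logZ C hy i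
    have hBF : ∑ i, bochnerField S U i y * F i = G F F := by
      rw [hGa]
      exact Finset.sum_congr rfl fun i _ => by rw [h.bochnerField_eq hy]; ring
    have hFz : F = fun j => W ^ 2 * (dz j + C * p j) := by
      funext j
      simp only [hdz, hp, h.partialDeriv_logZ C hy, hFdef, W]
      have := hW0 y hy
      field_simp
      ring
    have hFz' : F = W ^ 2 • (dz + C • p) := by
      rw [hFz]; rfl
    have hGpp : G p p = 1 - (W ^ 2)⁻¹ := by
      rw [hGa]
      simp only [hp, h.graphInv_mul_deriv hy]
      have h1 : ∑ i, partialDeriv i U y * (localGrad S U i y / localW S U y ^ 2)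
          = localNormSq S U y / W ^ 2 := by
        rw [localNormSq, Finset.sum_div]
        exact Finset.sum_congr rfl fun _ _ => by ring
      have h2 : localNormSq S U y = W ^ 2 - 1 := by linarith [hL.W_sq hy (U := U)]
      rw [h1, h2]
      field_simp
    have hφφ : G dφ dφ ≤ κ y := by
      rw [hGq]
      exact (graphInv_le dφ).trans (hκ y hy hφd)
    have hcs := hG0 (φ y • dz + dφ)
    have hGdc : ∑ i, dc i * ∑ j, localGraphInv S U y i j * dz j = G dc dz := (hGa dc dz).symm
    have hsum : ∑ i, (ϖ * (W⁻¹ * bochnerField S U i y) - C * (ϖ * (localGrad S U i y / W)))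
          * (φ y ^ 2 * partialDeriv i (fun y => χ y * (lam (localLogZ S U C y)
            * Real.exp (-2 * C * U y))) y + 2 * (χ y * (l * e)) * φ y * dφ i)
        = ϖ * W * G (φ y ^ 2 • ((l * e) • dc + (χ y * (l' * e)) • dz
            - (2 * C * (χ y * l * e)) • p) + (2 * (χ y * (l * e)) * φ y) • dφ) dz := by
      rw [hGa, Finset.mul_sum]
      refine Finset.sum_congr rfl fun i _ => ?_
      rw [hflux, hdA]
      simp only [Pi.add_apply, Pi.sub_apply, Pi.smul_apply, smul_eq_mul]
      ring
    change ϖ * (W * (e * l * (φ y ^ 2 * ∑ i, dc i * ∑ j, localGraphInv S U y i j * dz j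
      + χ y * (C ^ 2 * (1 - (W ^ 2)⁻¹) * φ y ^ 2 - κ y)))) ≤ _ + χ y * (l * e) * φ y ^ 2
        * (ϖ * W⁻¹ * ((∑ i, bochnerField S U i y * F i) / W ^ 2))
    rw [hsum, hGdc, hBF, hFz', ← hGpp]
    simp only [map_add, map_sub, map_smul, LinearMap.add_apply, LinearMap.sub_apply,
      LinearMap.smul_apply, smul_eq_mul] at hcs ⊢
    rw [hGs dφ dz] at hcs ⊢
    rw [hGs p dz]
    have hχy := hχ0 y hy
    have hzz := hG0 dz
    have t1 : 0 ≤ ϖ * W * (χ y * (l' * e)) * φ y ^ 2 * G dz dz := by positivity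
    have t2 : 0 ≤ ϖ * W * (χ y * (l * e)) * (φ y ^ 2 * G dz dz + 2 * (φ y * G dz dφ) + κ y) := by
      refine mul_nonneg (by positivity) ?_
      nlinarith
    have hWW : ϖ * W⁻¹ * (W ^ 2 * (W ^ 2 * (G dz dz + C * G dz p)
          + C * (W ^ 2 * (G dz p + C * G p p))) / W ^ 2)
        = ϖ * W * (G dz dz + 2 * C * G dz p + C ^ 2 * G p p) := by
      field_simp
      ring
    rw [hWW]
    linarith

/-- The Caccioppoli inequality for the minimal surface equation tested against `θ² e^{-2Cu}`,
localized by a cutoff `χ`. -/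
theorem integral_exp_test_le (h : IsLocalMinimalGraph T S U) {C : ℝ} (hC : 0 < C)
    {χ θ κ : EuclideanSpace ℝ (Fin m) → ℝ} (hχ : ContDiffOn ℝ ∞ χ T) (hχ0 : ∀ y ∈ T, 0 ≤ χ y)
    (hθ : LocallyLipschitzOn T θ) {K : Set (EuclideanSpace ℝ (Fin m))} (hK : IsCompact K)
    (hKT : K ⊆ T) (hsupp : ∀ y ∈ T, y ∉ K → χ y * θ y = 0)
    (hκ : ∀ y ∈ T, DifferentiableAt ℝ θ y →
      ∑ i, ∑ j, (S y)⁻¹ i j * partialDeriv i θ y * partialDeriv j θ y ≤ κ y)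
    (hint : IntegrableOn (fun y => √(S y).det * (Real.exp (-2 * C * U y) *
      (χ y * (C * (localW S U y - (localW S U y)⁻¹) * θ y ^ 2 - C⁻¹ * κ y * (localW S U y)⁻¹)
        - θ y ^ 2 * (localW S U y)⁻¹ * ∑ i, partialDeriv i χ y * localGrad S U i y))) T) :
    ∫ y in T, √(S y).det * (Real.exp (-2 * C * U y) *
      (χ y * (C * (localW S U y - (localW S U y)⁻¹) * θ y ^ 2 - C⁻¹ * κ y * (localW S U y)⁻¹)
        - θ y ^ 2 * (localW S U y)⁻¹ * ∑ i, partialDeriv i χ y * localGrad S U i y)) ≤ 0 := by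
  have hL := h.toIsLocalMetric
  have hU := h.contDiffOn_fun
  have hW0 : ∀ y ∈ T, localW S U y ≠ 0 := fun y hy => (zero_lt_one.trans_le (h.one_le_W hy)).ne'
  have hX : ∀ i, ContDiffOn ℝ ∞
      (fun z => √(S z).det * (localGrad S U i z / localW S U z)) T := fun i =>
    hL.contDiffOn_sqrt_det.mul ((hL.contDiffOn_grad hU i).div (hL.contDiffOn_W hU) hW0)
  refine integral_le_zero_of_test h.isOpen (A := fun y => χ y * Real.exp (-2 * C * U y)) (φ := θ)
    (X := fun i z => -1 * (√(S z).det * (localGrad S U i z / localW S U z)))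
    (q := fun _ => 0) (fun i => contDiffOn_const.mul (hX i)) continuousOn_const ?_ ?_ ?_ hθ hK hKT
    ?_ hint ?_
  · intro y hy
    have : ∀ i, partialDeriv i
        (fun z => -1 * (√(S z).det * (localGrad S U i z / localW S U z))) y
        = -1 * partialDeriv i (fun z => √(S z).det * (localGrad S U i z / localW S U z)) y :=
      fun i => partialDeriv_const_mul i _ (differentiableAt_of_contDiffOn h.isOpen (hX i) hy)
    simp only [this, ← Finset.mul_sum, h.minimal y hy]
    simp
  · exact hχ.mul (contDiffOn_const.mul hU).exp
  · exact fun y hy => mul_nonneg (hχ0 y hy) (Real.exp_pos _).le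
  · intro y hy hyK
    rw [mul_right_comm, hsupp y hy hyK, zero_mul]
  · intro y hy hθd
    have dχ := differentiableAt_of_contDiffOn h.isOpen hχ hy
    have dU := differentiableAt_of_contDiffOn h.isOpen hU hy
    have dexp : DifferentiableAt ℝ (fun z => Real.exp (-2 * C * U z)) y := (dU.const_mul _).exp
    set W := localW S U y
    set ϖ := √(S y).det
    set e := Real.exp (-2 * C * U y)
    have hep : 0 < e := Real.exp_pos _
    have hWp : 0 < W := zero_lt_one.trans_le (h.one_le_W hy)
    have hϖp : 0 < ϖ := Real.sqrt_pos.2 (hL.det_pos hy)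
    set p : Fin m → ℝ := fun j => partialDeriv j U y with hp
    set P : Fin m → ℝ := fun j => localGrad S U j y with hP
    set dθ : Fin m → ℝ := fun j => partialDeriv j θ y with hdθ
    set dc : Fin m → ℝ := fun j => partialDeriv j χ y
    have hN : ∑ i, P i * p i = W ^ 2 - 1 := by
      have := hL.W_sq hy (U := U)
      rw [this]
      simp [hP, hp, localNormSq]
    have hdA : ∀ i, partialDeriv i (fun y => χ y * Real.exp (-2 * C * U y)) y
        = e * dc i - 2 * C * (χ y * e) * p i := by
      intro i
      rw [partialDeriv_mul i dχ dexp, partialDeriv_comp i (Real.hasDerivAt_exp _) (dU.const_mul _),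
        partialDeriv_const_mul i _ dU]
      ring
    have hq := hL.sum_sum_inv_nonneg hy fun i => C * θ y * p i - dθ i
    have hsymm : ∑ i, ∑ j, (S y)⁻¹ i j * dθ i * p j = ∑ i, P i * dθ i := by
      rw [hP]
      simp only [localGrad, Finset.sum_mul]
      exact Finset.sum_congr rfl fun _ _ => Finset.sum_congr rfl fun _ _ => by ring
    have hsymm' : ∑ i, ∑ j, (S y)⁻¹ i j * p i * dθ j = ∑ i, P i * dθ i := by
      rw [← hsymm, Finset.sum_comm]
      exact Finset.sum_congr rfl fun _ _ => Finset.sum_congr rfl fun _ _ => by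
        rw [hL.inv_symm hy]; ring
    have hpp : ∑ i, ∑ j, (S y)⁻¹ i j * p i * p j = W ^ 2 - 1 := by
      rw [← hN]
      simp only [hP, localGrad, Finset.sum_mul]
      exact Finset.sum_congr rfl fun _ _ => Finset.sum_congr rfl fun _ _ => by ring
    have hexpand : ∑ i, ∑ j, (S y)⁻¹ i j * (C * θ y * p i - dθ i) * (C * θ y * p j - dθ j)
        = C ^ 2 * θ y ^ 2 * (W ^ 2 - 1) - 2 * C * θ y * (∑ i, P i * dθ i)
          + ∑ i, ∑ j, (S y)⁻¹ i j * dθ i * dθ j := by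
      have : ∀ i j, (S y)⁻¹ i j * (C * θ y * p i - dθ i) * (C * θ y * p j - dθ j)
          = C ^ 2 * θ y ^ 2 * ((S y)⁻¹ i j * p i * p j) - C * θ y * ((S y)⁻¹ i j * p i * dθ j)
            - C * θ y * ((S y)⁻¹ i j * dθ i * p j) + (S y)⁻¹ i j * dθ i * dθ j :=
        fun i j => by ring
      simp only [this, Finset.sum_add_distrib, Finset.sum_sub_distrib, ← Finset.mul_sum, hpp,
        hsymm, hsymm']
      ring
    have hκy := hκ y hy hθd
    have hmain : 0 ≤ C ^ 2 * θ y ^ 2 * (W ^ 2 - 1) - 2 * C * θ y * (∑ i, P i * dθ i) + κ y := by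
      rw [hexpand] at hq
      exact hq.trans (by linarith)
    have hsum : ∑ i, -1 * (ϖ * (P i / W)) * (θ y ^ 2 * partialDeriv i
          (fun y => χ y * Real.exp (-2 * C * U y)) y + 2 * (χ y * e) * θ y * dθ i)
        = -(ϖ / W) * (θ y ^ 2 * e * (∑ i, dc i * P i)
          - 2 * C * (χ y * e) * θ y ^ 2 * (∑ i, P i * p i)
          + 2 * (χ y * e) * θ y * ∑ i, P i * dθ i) := by
      simp only [Finset.mul_sum, ← Finset.sum_sub_distrib, ← Finset.sum_add_distrib]
      exact Finset.sum_congr rfl fun i _ => by rw [hdA]; ring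
    change ϖ * (e * (χ y * (C * (W - W⁻¹) * θ y ^ 2 - C⁻¹ * κ y * W⁻¹)
      - θ y ^ 2 * W⁻¹ * ∑ i, dc i * P i)) ≤ ∑ i, -1 * (ϖ * (P i / W)) * (θ y ^ 2 * partialDeriv i
          (fun y => χ y * Real.exp (-2 * C * U y)) y + 2 * (χ y * e) * θ y * dθ i)
        + χ y * e * θ y ^ 2 * 0
    rw [hsum, hN]
    have hχy := hχ0 y hy
    have t : 0 ≤ ϖ / W * (χ y * e) * C⁻¹ * (C ^ 2 * θ y ^ 2 * (W ^ 2 - 1)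
        - 2 * C * θ y * (∑ i, P i * dθ i) + κ y) := mul_nonneg (by positivity) hmain
    rw [← sub_nonneg]
    refine t.trans_eq ?_
    field_simp
    ring

end IsLocalMinimalGraph

/-! ### Charts of a Riemannian manifold -/

section chart

variable {M : Type*} [TopologicalSpace M] [ChartedSpace (EuclideanSpace ℝ (Fin m)) M]
  [IsManifold (𝓡 m) ∞ M] {p : M} {y : EuclideanSpace ℝ (Fin m)}

lemma mdifferentiableAt_symm (hy : y ∈ (extChartAt (𝓡 m) p).target) :
    MDifferentiableAt 𝓘(ℝ, EuclideanSpace ℝ (Fin m)) (𝓡 m) (extChartAt (𝓡 m) p).symm y := by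
  have := mdifferentiableWithinAt_extChartAt_symm (I := 𝓡 m) hy
  rwa [ModelWithCorners.range_eq_univ, mdifferentiableWithinAt_univ] at this

lemma mfderiv_chart_mfderiv_symm (hy : y ∈ (extChartAt (𝓡 m) p).target)
    (w : EuclideanSpace ℝ (Fin m)) :
    mfderiv (𝓡 m) 𝓘(ℝ, EuclideanSpace ℝ (Fin m)) (extChartAt (𝓡 m) p)
      ((extChartAt (𝓡 m) p).symm y)
      (mfderiv 𝓘(ℝ, EuclideanSpace ℝ (Fin m)) (𝓡 m) (extChartAt (𝓡 m) p).symm y w) = w := by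
  have := mfderiv_extChartAt_comp_mfderivWithin_extChartAt_symm (I := 𝓡 m) hy
  rw [ModelWithCorners.range_eq_univ, mfderivWithin_univ] at this
  exact congrArg (fun L => L w) this

lemma mfderiv_symm_mfderiv_chart (hy : y ∈ (extChartAt (𝓡 m) p).target)
    (w : TangentSpace (𝓡 m) ((extChartAt (𝓡 m) p).symm y)) :
    mfderiv 𝓘(ℝ, EuclideanSpace ℝ (Fin m)) (𝓡 m) (extChartAt (𝓡 m) p).symm y
      (mfderiv (𝓡 m) 𝓘(ℝ, EuclideanSpace ℝ (Fin m)) (extChartAt (𝓡 m) p)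
      ((extChartAt (𝓡 m) p).symm y) w) = w := by
  have := mfderivWithin_extChartAt_symm_comp_mfderiv_extChartAt (I := 𝓡 m) hy
  rw [ModelWithCorners.range_eq_univ, mfderivWithin_univ] at this
  exact congrArg (fun L => L w) this

lemma mfderiv_symm_eq_sum (p : M) (y w : EuclideanSpace ℝ (Fin m)) :
    mfderiv 𝓘(ℝ, EuclideanSpace ℝ (Fin m)) (𝓡 m) (extChartAt (𝓡 m) p).symm y w
      = ∑ i, w i • coordVector p i y := by
  have hw : w = ∑ i, w i • EuclideanSpace.single i (1 : ℝ) := by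
    simpa using ((EuclideanSpace.basisFun (Fin m) ℝ).sum_repr w).symm
  have h := map_sum (mfderiv 𝓘(ℝ, EuclideanSpace ℝ (Fin m)) (𝓡 m) (extChartAt (𝓡 m) p).symm y)
    (fun i => w i • (EuclideanSpace.single i (1 : ℝ) : EuclideanSpace ℝ (Fin m))) Finset.univ
  conv_lhs => rw [hw]
  refine h.trans (Finset.sum_congr rfl fun i _ => ?_)
  exact map_smul (mfderiv 𝓘(ℝ, EuclideanSpace ℝ (Fin m)) (𝓡 m) (extChartAt (𝓡 m) p).symm y)
    (w i) (EuclideanSpace.single i (1 : ℝ))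

lemma eq_sum_chartComponent (hy : y ∈ (extChartAt (𝓡 m) p).target)
    (w : TangentSpace (𝓡 m) ((extChartAt (𝓡 m) p).symm y)) :
    w = ∑ i, chartComponent p i w • coordVector p i y := by
  conv_lhs => rw [← mfderiv_symm_mfderiv_chart hy w]
  exact mfderiv_symm_eq_sum p y _

lemma mfderiv_coordVector {a : M → ℝ} (hy : y ∈ (extChartAt (𝓡 m) p).target)
    (ha : MDifferentiableAt (𝓡 m) 𝓘(ℝ, ℝ) a ((extChartAt (𝓡 m) p).symm y)) (i : Fin m) :
    mfderiv (𝓡 m) 𝓘(ℝ, ℝ) a ((extChartAt (𝓡 m) p).symm y) (coordVector p i y)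
      = partialDeriv i (fun z => a ((extChartAt (𝓡 m) p).symm z)) y := by
  have h := mfderiv_comp y ha (mdifferentiableAt_symm hy)
  rw [partialDeriv, ← mfderiv_eq_fderiv]
  exact (congrArg (fun L => L (EuclideanSpace.single i (1 : ℝ))) h).symm

/-- The differential of a function in terms of its partial derivatives in a chart. -/
lemma mfderiv_eq_sum_chartComponent {a : M → ℝ} (hy : y ∈ (extChartAt (𝓡 m) p).target)
    (ha : MDifferentiableAt (𝓡 m) 𝓘(ℝ, ℝ) a ((extChartAt (𝓡 m) p).symm y))
    (w : TangentSpace (𝓡 m) ((extChartAt (𝓡 m) p).symm y)) :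
    mfderiv (𝓡 m) 𝓘(ℝ, ℝ) a ((extChartAt (𝓡 m) p).symm y) w
      = ∑ i, partialDeriv i (fun z => a ((extChartAt (𝓡 m) p).symm z)) y * chartComponent p i w := by
  conv_lhs => rw [eq_sum_chartComponent hy w]
  rw [map_sum]
  refine Finset.sum_congr rfl fun i _ => ?_
  rw [map_smul, mfderiv_coordVector hy ha, mul_comm]
  rfl

lemma contDiffOn_comp_symm {a : M → ℝ} (ha : ContMDiff (𝓡 m) 𝓘(ℝ, ℝ) ∞ a) (p : M) :
    ContDiffOn ℝ ∞ (fun z => a ((extChartAt (𝓡 m) p).symm z)) (extChartAt (𝓡 m) p).target := by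
  rw [← contMDiffOn_iff_contDiffOn]
  exact ha.comp_contMDiffOn (contMDiffOn_extChartAt_symm p)

lemma contMDiffOn_coordVector (p : M) (i : Fin m) :
    ContMDiffOn 𝓘(ℝ, EuclideanSpace ℝ (Fin m)) ((𝓡 m).prod 𝓘(ℝ, EuclideanSpace ℝ (Fin m))) ∞
      (fun y => (⟨(extChartAt (𝓡 m) p).symm y, coordVector p i y⟩ :
        TotalSpace (EuclideanSpace ℝ (Fin m)) (fun x : M => TangentSpace (𝓡 m) x)))
      (extChartAt (𝓡 m) p).target := by
  have hopen := isOpen_extChartAt_target (I := 𝓡 m) p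
  have h1 := (contMDiffOn_extChartAt_symm (I := 𝓡 m) (n := ∞) p).contMDiffOn_tangentMapWithin
    (m := ∞) (by simp) hopen.uniqueMDiffOn
  have h2 : ContMDiffOn 𝓘(ℝ, EuclideanSpace ℝ (Fin m)) 𝓘(ℝ, EuclideanSpace ℝ (Fin m)).tangent ∞
      (fun x : EuclideanSpace ℝ (Fin m) => (⟨x, (EuclideanSpace.single i (1 : ℝ) :
        EuclideanSpace ℝ (Fin m))⟩ : TangentBundle 𝓘(ℝ, EuclideanSpace ℝ (Fin m))
          (EuclideanSpace ℝ (Fin m)))) (extChartAt (𝓡 m) p).target :=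
    contMDiffOn_vectorSpace_iff_contDiffOn.2 contDiffOn_const
  refine (h1.comp h2 fun z hz => hz).congr fun z hz => ?_
  simp only [Function.comp_apply, tangentMapWithin]
  rw [mfderivWithin_of_isOpen hopen hz]
  rfl

end chart

section metric

variable {M : Type*} [TopologicalSpace M] [ChartedSpace (EuclideanSpace ℝ (Fin m)) M]
  [IsManifold (𝓡 m) ∞ M] [RiemannianBundle (fun x : M => TangentSpace (𝓡 m) x)]
  {p : M} {y : EuclideanSpace ℝ (Fin m)}

lemma contDiffOn_metricCoeff [IsContMDiffRiemannianBundle (𝓡 m) ∞ (EuclideanSpace ℝ (Fin m))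
      (fun x : M => TangentSpace (𝓡 m) x)] (p : M) (i j : Fin m) :
    ContDiffOn ℝ ∞ (fun z => metricCoeff p z i j) (extChartAt (𝓡 m) p).target := by
  rw [← contMDiffOn_iff_contDiffOn]
  exact (contMDiffOn_coordVector p i).inner_bundle (contMDiffOn_coordVector p j)

lemma metricCoeff_quadratic (p : M) (y : EuclideanSpace ℝ (Fin m)) (a b : Fin m → ℝ) :
    ∑ i, ∑ j, metricCoeff p y i j * a i * b j
      = inner ℝ (∑ i, a i • coordVector p i y) (∑ i, b i • coordVector p i y) := by
  rw [sum_inner]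
  refine Finset.sum_congr rfl fun i _ => ?_
  rw [inner_sum]
  refine Finset.sum_congr rfl fun j _ => ?_
  rw [inner_smul_left, inner_smul_right]
  simp only [metricCoeff, coeffMatrix, metric, Matrix.of_apply, conj_trivial]
  ring

lemma posDef_metricCoeff (hy : y ∈ (extChartAt (𝓡 m) p).target) : (metricCoeff p y).PosDef := by
  refine Matrix.PosDef.of_dotProduct_mulVec_pos ?_ fun v hv => ?_
  · ext i j
    exact real_inner_comm (coordVector p i y) (coordVector p j y)
  · have h1 : star v ⬝ᵥ (metricCoeff p y).mulVec v
        = ∑ i, ∑ j, metricCoeff p y i j * v i * v j := by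
      simp only [dotProduct, Matrix.mulVec, Pi.star_apply, star_trivial, Finset.mul_sum]
      exact Finset.sum_congr rfl fun _ _ => Finset.sum_congr rfl fun _ _ => by ring
    rw [h1, metricCoeff_quadratic, real_inner_self_pos]
    intro h0
    have h2 := mfderiv_symm_eq_sum p y (WithLp.toLp 2 v)
    have h3 := mfderiv_chart_mfderiv_symm hy (WithLp.toLp 2 v)
    rw [h2] at h3
    have h4 : ∑ i, (WithLp.toLp 2 v : EuclideanSpace ℝ (Fin m)) i • coordVector p i y = 0 := h0
    rw [h4, map_zero] at h3
    exact hv (congrArg (WithLp.ofLp) h3).symm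

lemma inner_gradient (a : M → ℝ) (x : M) (w : TangentSpace (𝓡 m) x) :
    inner ℝ (gradient (m := m) a x) w = mfderiv (𝓡 m) 𝓘(ℝ, ℝ) a x w := by
  have : FiniteDimensional ℝ (TangentSpace (𝓡 m) x) :=
    inferInstanceAs (FiniteDimensional ℝ (EuclideanSpace ℝ (Fin m)))
  have : CompleteSpace (TangentSpace (𝓡 m) x) := FiniteDimensional.complete ℝ _
  exact InnerProductSpace.toDual_symm_apply

variable [IsContMDiffRiemannianBundle (𝓡 m) ∞ (EuclideanSpace ℝ (Fin m))
      (fun x : M => TangentSpace (𝓡 m) x)]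

lemma isLocalMetric (p : M) :
    IsLocalMetric (extChartAt (𝓡 m) p).target (metricCoeff p) where
  isOpen := isOpen_extChartAt_target p
  contDiffOn := contDiffOn_metricCoeff p
  posDef _ hy := posDef_metricCoeff hy

lemma chartComponent_gradient {a : M → ℝ} (hy : y ∈ (extChartAt (𝓡 m) p).target)
    (ha : MDifferentiableAt (𝓡 m) 𝓘(ℝ, ℝ) a ((extChartAt (𝓡 m) p).symm y)) (i : Fin m) :
    chartComponent p i (gradient a ((extChartAt (𝓡 m) p).symm y))
      = localGrad (metricCoeff p) (fun z => a ((extChartAt (𝓡 m) p).symm z)) i y := by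
  set c : Fin m → ℝ := fun i => chartComponent p i (gradient a ((extChartAt (𝓡 m) p).symm y))
  have h1 : ∀ j, ∑ k, metricCoeff p y j k * c k
      = partialDeriv j (fun z => a ((extChartAt (𝓡 m) p).symm z)) y := by
    intro j
    rw [← mfderiv_coordVector hy ha, ← inner_gradient]
    conv_rhs => rw [eq_sum_chartComponent hy (gradient a ((extChartAt (𝓡 m) p).symm y))]
    rw [sum_inner]
    refine Finset.sum_congr rfl fun k _ => ?_
    rw [inner_smul_left, conj_trivial, mul_comm, real_inner_comm]
    rfl
  change c i = _
  simp only [localGrad, ← h1, Finset.mul_sum, ← mul_assoc]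
  rw [Finset.sum_comm]
  simp only [← Finset.sum_mul, (isLocalMetric p).sum_inv_mul hy]
  simp

lemma inner_gradient_gradient {a b : M → ℝ} (hy : y ∈ (extChartAt (𝓡 m) p).target)
    (ha : MDifferentiableAt (𝓡 m) 𝓘(ℝ, ℝ) a ((extChartAt (𝓡 m) p).symm y))
    (hb : MDifferentiableAt (𝓡 m) 𝓘(ℝ, ℝ) b ((extChartAt (𝓡 m) p).symm y)) :
    inner ℝ (gradient (m := m) a ((extChartAt (𝓡 m) p).symm y))
        (gradient b ((extChartAt (𝓡 m) p).symm y))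
      = ∑ i, partialDeriv i (fun z => a ((extChartAt (𝓡 m) p).symm z)) y
        * localGrad (metricCoeff p) (fun z => b ((extChartAt (𝓡 m) p).symm z)) i y := by
  rw [inner_gradient, mfderiv_eq_sum_chartComponent hy ha]
  simp only [chartComponent_gradient hy hb]

lemma W_symm {u : M → ℝ} (hy : y ∈ (extChartAt (𝓡 m) p).target)
    (hu : MDifferentiableAt (𝓡 m) 𝓘(ℝ, ℝ) u ((extChartAt (𝓡 m) p).symm y)) :
    W (m := m) u ((extChartAt (𝓡 m) p).symm y)
      = localW (metricCoeff p) (fun z => u ((extChartAt (𝓡 m) p).symm z)) y := by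
  rw [W, localW, ← real_inner_self_eq_norm_sq, inner_gradient_gradient hy hu hu]
  simp only [localNormSq, mul_comm]

lemma isLocalMinimalGraph {u : M → ℝ} (hu : ContMDiff (𝓡 m) 𝓘(ℝ, ℝ) ∞ u)
    (hMSE : MinimalHypersurfaceEq m u) (p : M) :
    IsLocalMinimalGraph (extChartAt (𝓡 m) p).target (metricCoeff p)
      (fun z => u ((extChartAt (𝓡 m) p).symm z)) where
  toIsLocalMetric := isLocalMetric p
  contDiffOn_fun := contDiffOn_comp_symm hu p
  minimal y hy := by
    have h := hMSE p y hy
    have hd : (√(metricCoeff p y).det)⁻¹ ≠ 0 :=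
      inv_ne_zero (Real.sqrt_pos.2 ((isLocalMetric p).det_pos hy)).ne'
    rw [divergence] at h
    rw [← (mul_eq_zero.1 h).resolve_left hd]
    refine Finset.sum_congr rfl fun i _ => partialDeriv_congr i ?_
    filter_upwards [(isOpen_extChartAt_target (I := 𝓡 m) p).mem_nhds hy] with z hz
    have hdu : MDifferentiableAt (𝓡 m) 𝓘(ℝ, ℝ) u ((extChartAt (𝓡 m) p).symm z) :=
      hu.mdifferentiableAt (by simp)
    have h1 : chartComponent p i ((W (m := m) u ((extChartAt (𝓡 m) p).symm z))⁻¹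
          • gradient u ((extChartAt (𝓡 m) p).symm z))
        = (W (m := m) u ((extChartAt (𝓡 m) p).symm z))⁻¹
          * chartComponent p i (gradient u ((extChartAt (𝓡 m) p).symm z)) := by
      simp only [chartComponent, map_smul]
      rfl
    rw [h1, chartComponent_gradient hz hdu, W_symm hz hdu]
    ring

end metric

/-! ### The volume of a bilinear form in charts -/

section volume

variable {M : Type*} [TopologicalSpace M] [ChartedSpace (EuclideanSpace ℝ (Fin m)) M]
  {b : ∀ x : M, TangentSpace (𝓡 m) x → TangentSpace (𝓡 m) x → ℝ}

lemma measurableSet_target [IsManifold (𝓡 m) ∞ M] (p : M) :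
    MeasurableSet (extChartAt (𝓡 m) p).target :=
  (isOpen_extChartAt_target p).measurableSet

lemma coordVector_eq_sum [IsManifold (𝓡 m) ∞ M] {p q : M} {y : EuclideanSpace ℝ (Fin m)}
    (hy : y ∈ (extChartAt (𝓡 m) p).target)
    (hq : (extChartAt (𝓡 m) p).symm y ∈ (extChartAt (𝓡 m) q).source) (i : Fin m) :
    (coordVector p i y : EuclideanSpace ℝ (Fin m))
      = ∑ k, (fderiv ℝ (fun z => extChartAt (𝓡 m) q ((extChartAt (𝓡 m) p).symm z)) y
          (EuclideanSpace.single i 1)) k •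
        (coordVector q k (extChartAt (𝓡 m) q ((extChartAt (𝓡 m) p).symm y)) :
          EuclideanSpace ℝ (Fin m)) := by
  set x := (extChartAt (𝓡 m) p).symm y with hx
  have hy' : extChartAt (𝓡 m) q x ∈ (extChartAt (𝓡 m) q).target :=
    (extChartAt (𝓡 m) q).map_source hq
  have hinv : (extChartAt (𝓡 m) q).symm (extChartAt (𝓡 m) q x) = x :=
    (extChartAt (𝓡 m) q).left_inv hq
  have h1 := mfderiv_symm_mfderiv_chart hy' (coordVector p i y : EuclideanSpace ℝ (Fin m))
  have key : ∀ x', x' = x → ∀ w : EuclideanSpace ℝ (Fin m),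
      (mfderiv (𝓡 m) 𝓘(ℝ, EuclideanSpace ℝ (Fin m)) (extChartAt (𝓡 m) q) x' w :
        EuclideanSpace ℝ (Fin m))
      = mfderiv (𝓡 m) 𝓘(ℝ, EuclideanSpace ℝ (Fin m)) (extChartAt (𝓡 m) q) x w := by
    rintro x' rfl w; rfl
  have h3 : (mfderiv (𝓡 m) 𝓘(ℝ, EuclideanSpace ℝ (Fin m)) (extChartAt (𝓡 m) q) x
      (coordVector p i y) : EuclideanSpace ℝ (Fin m))
      = fderiv ℝ (fun z => extChartAt (𝓡 m) q ((extChartAt (𝓡 m) p).symm z)) y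
          (EuclideanSpace.single i 1) := by
    have h := mfderiv_comp y
      (mdifferentiableAt_extChartAt (I := 𝓡 m) (by rwa [← extChartAt_source (𝓡 m)] :
        x ∈ (chartAt (EuclideanSpace ℝ (Fin m)) q).source)) (mdifferentiableAt_symm hy)
    rw [← mfderiv_eq_fderiv]
    exact (congrArg (fun L => L (EuclideanSpace.single i (1 : ℝ))) h).symm
  refine h1.symm.trans (Eq.trans ?_ (mfderiv_symm_eq_sum q (extChartAt (𝓡 m) q x) _))
  exact congrArg (fun w : EuclideanSpace ℝ (Fin m) =>
    (mfderiv 𝓘(ℝ, EuclideanSpace ℝ (Fin m)) (𝓡 m) (extChartAt (𝓡 m) q).symm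
      (extChartAt (𝓡 m) q x) w : EuclideanSpace ℝ (Fin m))) ((key _ hinv _).trans h3)

/-- Under a change of coordinates the determinant of a metric is multiplied by the square of the
Jacobian determinant. -/
lemma det_coeffMatrix_eq [IsManifold (𝓡 m) ∞ M]
    (hb : ∀ x, ∃ B : LinearMap.BilinForm ℝ (TangentSpace (𝓡 m) x), ∀ v w, b x v w = B v w)
    {p q : M} {y : EuclideanSpace ℝ (Fin m)} (hy : y ∈ (extChartAt (𝓡 m) p).target)
    (hq : (extChartAt (𝓡 m) p).symm y ∈ (extChartAt (𝓡 m) q).source) :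
    (coeffMatrix b p y).det
      = (fderiv ℝ (fun z => extChartAt (𝓡 m) q ((extChartAt (𝓡 m) p).symm z)) y).det ^ 2
        * (coeffMatrix b q (extChartAt (𝓡 m) q ((extChartAt (𝓡 m) p).symm y))).det := by
  set L := fderiv ℝ (fun z => extChartAt (𝓡 m) q ((extChartAt (𝓡 m) p).symm z)) y with hL
  set x := (extChartAt (𝓡 m) p).symm y with hx
  set J : Matrix (Fin m) (Fin m) ℝ := Matrix.of fun k i => L (EuclideanSpace.single i 1) k
  have hJ : J.det = L.det := by
    rw [ContinuousLinearMap.det,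
      ← LinearMap.det_toMatrix (EuclideanSpace.basisFun (Fin m) ℝ).toBasis]
    congr 1
  have hinv : (extChartAt (𝓡 m) q).symm (extChartAt (𝓡 m) q x) = x :=
    (extChartAt (𝓡 m) q).left_inv hq
  obtain ⟨B, hB⟩ : ∃ B : LinearMap.BilinForm ℝ (EuclideanSpace ℝ (Fin m)),
      ∀ v w : EuclideanSpace ℝ (Fin m), b x v w = B v w := hb x
  have h1 : coeffMatrix b p y
      = J.transpose * coeffMatrix b q (extChartAt (𝓡 m) q x) * J := by
    have key : ∀ x', x' = x → ∀ v w : EuclideanSpace ℝ (Fin m),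
        b x' v w = B v w := by
      rintro x' rfl v w; exact hB v w
    ext i j
    have e1 : coeffMatrix b p y i j = B (coordVector p i y) (coordVector p j y) := hB _ _
    have e2 : ∀ k l, coeffMatrix b q (extChartAt (𝓡 m) q x) k l
        = B (coordVector q k (extChartAt (𝓡 m) q x) : EuclideanSpace ℝ (Fin m))
          (coordVector q l (extChartAt (𝓡 m) q x) : EuclideanSpace ℝ (Fin m)) :=
      fun k l => key _ hinv _ _
    have e3 : ∀ v w : Fin m → EuclideanSpace ℝ (Fin m), ∀ a c : Fin m → ℝ,
        B (∑ k, a k • v k) (∑ k, c k • w k) = ∑ l, (∑ k, a k * B (v k) (w l)) * c l := by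
      intro v w a c
      rw [map_sum, map_sum]
      refine Finset.sum_congr rfl fun l _ => ?_
      rw [LinearMap.sum_apply, Finset.sum_mul]
      refine Finset.sum_congr rfl fun k _ => ?_
      rw [map_smul, map_smul, LinearMap.smul_apply, smul_eq_mul, smul_eq_mul]
      ring
    have e4 := coordVector_eq_sum hy hq i
    have e5 := coordVector_eq_sum hy hq j
    rw [e1, e4, e5]
    refine (e3 _ _ _ _).trans ?_
    simp only [Matrix.mul_apply, Matrix.transpose_apply, e2]
    rfl
  rw [h1, Matrix.det_mul, Matrix.det_mul, Matrix.det_transpose, hJ]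
  ring

variable [MeasurableSpace M]

/-- The measure `√det(b_ij) dx¹⋯dxᵐ` of the chart at `p`, on `M`. -/
def chartVolume (b : ∀ x : M, TangentSpace (𝓡 m) x → TangentSpace (𝓡 m) x → ℝ) (p : M) :
    Measure M :=
  Measure.map (extChartAt (𝓡 m) p).symm
    ((volume.restrict (extChartAt (𝓡 m) p).target).withDensity
      fun y => ENNReal.ofReal √(coeffMatrix b p y).det)

variable [BorelSpace M] [IsManifold (𝓡 m) ∞ M]

lemma aemeasurable_chart_symm (p : M) (ρ : Measure (EuclideanSpace ℝ (Fin m)))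
    (hρ : ρ ≪ volume.restrict (extChartAt (𝓡 m) p).target) :
    AEMeasurable (extChartAt (𝓡 m) p).symm ρ :=
  ((continuousOn_extChartAt_symm p).aemeasurable (measurableSet_target p)).mono_ac hρ

lemma measurableSet_preimage_symm (p : M) {s : Set M} (hs : MeasurableSet s) :
    MeasurableSet ((extChartAt (𝓡 m) p).symm ⁻¹' s ∩ (extChartAt (𝓡 m) p).target) := by
  have h := ((continuousOn_extChartAt_symm (I := 𝓡 m) p).domRestrict.measurable hs)
  have h2 := (measurableSet_target (M := M) p).subtype_image h
  convert h2 using 1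
  ext z
  simp only [mem_inter_iff, mem_preimage, mem_image, Subtype.exists, domRestrict_apply]
  exact ⟨fun hz => ⟨z, hz.2, hz.1, rfl⟩, fun ⟨a, ha, h1, h2⟩ => h2 ▸ ⟨h1, ha⟩⟩

lemma chartVolume_apply (p : M) {s : Set M} (hs : MeasurableSet s) :
    chartVolume b p s = ∫⁻ y in (extChartAt (𝓡 m) p).symm ⁻¹' s ∩ (extChartAt (𝓡 m) p).target,
      ENNReal.ofReal √(coeffMatrix b p y).det := by
  rw [chartVolume, Measure.map_apply_of_aemeasurable
    (aemeasurable_chart_symm p _ (withDensity_absolutelyContinuous _ _)) hs, withDensity_apply',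
    Measure.restrict_restrict' (measurableSet_target p)]

lemma chartVolume_compl_source (p : M) : chartVolume b p (extChartAt (𝓡 m) p).sourceᶜ = 0 := by
  rw [chartVolume_apply p (isOpen_extChartAt_source p).measurableSet.compl]
  refine setLIntegral_measure_zero _ _ ?_
  convert measure_empty (μ := (volume : Measure (EuclideanSpace ℝ (Fin m))))
  ext z
  simp only [mem_inter_iff, mem_preimage, mem_compl_iff, mem_empty_iff_false, iff_false, not_and]
  exact fun h1 h2 => h1 ((extChartAt (𝓡 m) p).map_target h2)

/-- The chart measures agree on the overlap of the charts. -/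
lemma chartVolume_eq_of_subset
    (hb : ∀ x, ∃ B : LinearMap.BilinForm ℝ (TangentSpace (𝓡 m) x), ∀ v w, b x v w = B v w)
    {p q : M} {s : Set M} (hs : MeasurableSet s) (hp : s ⊆ (extChartAt (𝓡 m) p).source)
    (hq : s ⊆ (extChartAt (𝓡 m) q).source) : chartVolume b p s = chartVolume b q s := by
  rw [chartVolume_apply p hs, chartVolume_apply q hs]
  set τ := fun z => extChartAt (𝓡 m) q ((extChartAt (𝓡 m) p).symm z)
  have himage : (extChartAt (𝓡 m) q).symm ⁻¹' s ∩ (extChartAt (𝓡 m) q).target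
      = τ '' ((extChartAt (𝓡 m) p).symm ⁻¹' s ∩ (extChartAt (𝓡 m) p).target) := by
    ext z
    constructor
    · rintro ⟨h1, h2⟩
      refine ⟨extChartAt (𝓡 m) p ((extChartAt (𝓡 m) q).symm z), ⟨?_, ?_⟩, ?_⟩
      · rw [mem_preimage, (extChartAt (𝓡 m) p).left_inv (hp h1)]; exact h1
      · exact (extChartAt (𝓡 m) p).map_source (hp h1)
      · simp only [τ]
        rw [(extChartAt (𝓡 m) p).left_inv (hp h1), (extChartAt (𝓡 m) q).right_inv h2]
    · rintro ⟨z', ⟨h1, h2⟩, rfl⟩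
      refine ⟨?_, (extChartAt (𝓡 m) q).map_source (hq h1)⟩
      simp only [τ, mem_preimage]
      rw [(extChartAt (𝓡 m) q).left_inv (hq h1)]; exact h1
  have hinj : InjOn τ ((extChartAt (𝓡 m) p).symm ⁻¹' s ∩ (extChartAt (𝓡 m) p).target) := by
    rintro z ⟨h1, h2⟩ z' ⟨h1', h2'⟩ h
    exact (extChartAt (𝓡 m) p).symm.injOn h2 h2' ((extChartAt (𝓡 m) q).injOn (hq h1) (hq h1') h)
  have hdiff : ∀ z ∈ (extChartAt (𝓡 m) p).symm ⁻¹' s ∩ (extChartAt (𝓡 m) p).target,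
      HasFDerivWithinAt τ (fderiv ℝ τ z)
        ((extChartAt (𝓡 m) p).symm ⁻¹' s ∩ (extChartAt (𝓡 m) p).target) z := by
    rintro z ⟨h1, h2⟩
    have h3 := contDiffWithinAt_ext_coord_change (I := 𝓡 m) (n := ∞) q p (y := z)
      ⟨h2, hq h1⟩
    rw [ModelWithCorners.range_eq_univ, contDiffWithinAt_univ] at h3
    exact (h3.differentiableAt (by simp)).hasFDerivAt.hasFDerivWithinAt
  rw [himage, lintegral_image_eq_lintegral_abs_det_fderiv_mul volume
    (measurableSet_preimage_symm p hs) hdiff hinj]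
  refine setLIntegral_congr_fun (measurableSet_preimage_symm p hs) fun z hz => ?_
  rw [← ENNReal.ofReal_mul (abs_nonneg _), det_coeffMatrix_eq hb hz.2 (hq hz.1),
    Real.sqrt_mul (sq_nonneg _), Real.sqrt_sq_eq_abs]

/-- On a chart domain, the volume is that of the chart. -/
lemma restrict_volumeOf
    (hb : ∀ x, ∃ B : LinearMap.BilinForm ℝ (TangentSpace (𝓡 m) x), ∀ v w, b x v w = B v w)
    (p : M) : (volumeOf b).restrict (extChartAt (𝓡 m) p).source = chartVolume b p := by
  have hU : MeasurableSet (extChartAt (𝓡 m) p).source := (isOpen_extChartAt_source p).measurableSet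
  have hle : volumeOf b ≤ chartVolume b p
      + (volumeOf b).restrict (extChartAt (𝓡 m) p).sourceᶜ := by
    refine iSup_le fun q => Measure.le_iff.2 fun s hs => ?_
    change chartVolume b q s ≤ _
    have hV : MeasurableSet (extChartAt (𝓡 m) q).source :=
      (isOpen_extChartAt_source q).measurableSet
    rw [← measure_inter_add_sdiff s hU, Measure.add_apply, Measure.restrict_apply hs]
    refine add_le_add ?_ ?_
    · have h0 : chartVolume b q ((s ∩ (extChartAt (𝓡 m) p).source) \
          (extChartAt (𝓡 m) q).source) = 0 :=
        measure_mono_null (fun z hz => hz.2) (chartVolume_compl_source q)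
      rw [← measure_inter_add_sdiff _ hV, h0, add_zero, ← chartVolume_eq_of_subset hb (p := p)
        ((hs.inter hU).inter hV) (fun z hz => hz.1.2) (fun z hz => hz.2)]
      exact measure_mono fun z hz => hz.1.1
    · exact (le_iSup (fun q => chartVolume b q) q : _) _
  -- `volumeOf b` is the supremum of the measures of the charts
  refine le_antisymm ?_ ?_
  · refine Measure.le_iff.2 fun s hs => ?_
    rw [Measure.restrict_apply hs]
    refine (hle _).trans ?_
    rw [Measure.add_apply, Measure.restrict_apply (hs.inter hU), inter_assoc, inter_compl_self,
      inter_empty, measure_empty, add_zero]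
    exact measure_mono inter_subset_left
  · refine Measure.le_iff.2 fun s hs => ?_
    have h0 : chartVolume b p (s \ (extChartAt (𝓡 m) p).source) = 0 :=
      measure_mono_null (fun z hz => hz.2) (chartVolume_compl_source p)
    rw [Measure.restrict_apply hs, ← measure_inter_add_sdiff s hU, h0, add_zero]
    exact (le_iSup (fun q => chartVolume b q) p : _) _

end volume

/-! ### The Riemannian volume and the volume of a graph -/

section riemannianVolume

variable {M : Type*} [TopologicalSpace M] [ChartedSpace (EuclideanSpace ℝ (Fin m)) M]
  [IsManifold (𝓡 m) ∞ M]

lemma contMDiff_of_contDiffOn_comp_symm {a : M → ℝ}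
    (ha : ∀ p : M, ContDiffOn ℝ ∞ (fun z => a ((extChartAt (𝓡 m) p).symm z))
      (extChartAt (𝓡 m) p).target) : ContMDiff (𝓡 m) 𝓘(ℝ, ℝ) ∞ a := by
  intro p
  have hU := isOpen_extChartAt_source (I := 𝓡 m) p
  have h1 : ContMDiffOn (𝓡 m) 𝓘(ℝ, EuclideanSpace ℝ (Fin m)) ∞ (extChartAt (𝓡 m) p)
      (extChartAt (𝓡 m) p).source := by
    rw [extChartAt_source]; exact contMDiffOn_extChartAt
  have h2 : ContMDiffOn (𝓡 m) 𝓘(ℝ, ℝ) ∞ a (extChartAt (𝓡 m) p).source := by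
    refine ((contMDiffOn_iff_contDiffOn.2 (ha p)).comp h1
      fun x hx => (extChartAt (𝓡 m) p).map_source hx).congr fun x hx => ?_
    simp only [Function.comp_apply, (extChartAt (𝓡 m) p).left_inv hx]
  exact h2.contMDiffAt (hU.mem_nhds (mem_extChartAt_source p))

variable [RiemannianBundle (fun x : M => TangentSpace (𝓡 m) x)]

lemma exists_bilinForm_metric (x : M) : ∃ B : LinearMap.BilinForm ℝ (TangentSpace (𝓡 m) x),
    ∀ v w, metric x v w = B v w :=
  ⟨innerₗ _, fun _ _ => rfl⟩

lemma exists_bilinForm_graphMetric (u : M → ℝ) (x : M) :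
    ∃ B : LinearMap.BilinForm ℝ (TangentSpace (𝓡 m) x), ∀ v w, graphMetric u x v w = B v w :=
  ⟨innerₗ _ + LinearMap.BilinForm.linMulLin
    (mfderiv (𝓡 m) 𝓘(ℝ, ℝ) u x : TangentSpace (𝓡 m) x →L[ℝ] ℝ).toLinearMap
    (mfderiv (𝓡 m) 𝓘(ℝ, ℝ) u x : TangentSpace (𝓡 m) x →L[ℝ] ℝ).toLinearMap, fun _ _ => rfl⟩

variable [IsContMDiffRiemannianBundle (𝓡 m) ∞ (EuclideanSpace ℝ (Fin m))
      (fun x : M => TangentSpace (𝓡 m) x)]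

lemma contMDiff_W {u : M → ℝ} (hu : ContMDiff (𝓡 m) 𝓘(ℝ, ℝ) ∞ u) : ContMDiff (𝓡 m) 𝓘(ℝ, ℝ) ∞ (W (m := m) u) :=
  contMDiff_of_contDiffOn_comp_symm fun p =>
    ((isLocalMetric p).contDiffOn_W (contDiffOn_comp_symm hu p)).congr fun _ hz =>
      W_symm hz (hu.mdifferentiableAt (by simp))

/-- `det (σ_ij + ∂_i u ∂_j u) = W² det σ_ij`. -/
lemma det_coeffMatrix_graphMetric {u : M → ℝ} (hu : ContMDiff (𝓡 m) 𝓘(ℝ, ℝ) ∞ u) {p : M}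
    {y : EuclideanSpace ℝ (Fin m)} (hy : y ∈ (extChartAt (𝓡 m) p).target) :
    (coeffMatrix (graphMetric (m := m) u) p y).det
      = (metricCoeff p y).det * W (m := m) u ((extChartAt (𝓡 m) p).symm y) ^ 2 := by
  have hdu : MDifferentiableAt (𝓡 m) 𝓘(ℝ, ℝ) u ((extChartAt (𝓡 m) p).symm y) :=
    hu.mdifferentiableAt (by simp)
  set d : Fin m → ℝ := fun i => partialDeriv i (fun z => u ((extChartAt (𝓡 m) p).symm z)) y
  have h1 : coeffMatrix (graphMetric (m := m) u) p y = metricCoeff p y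
      + Matrix.replicateCol Unit d * Matrix.replicateRow Unit d := by
    ext i j
    simp only [coeffMatrix, graphMetric, Matrix.of_apply, differential, Matrix.add_apply,
      metricCoeff, Matrix.mul_apply, Matrix.replicateCol_apply, Matrix.replicateRow_apply,
      Finset.univ_unique, Finset.sum_singleton, d]
    congr 1
    exact congrArg₂ (· * ·) (mfderiv_coordVector hy hdu i) (mfderiv_coordVector hy hdu j)
  have h0 : 0 ≤ localNormSq (metricCoeff p) (fun z => u ((extChartAt (𝓡 m) p).symm z)) y :=
    (isLocalMetric p).normSq_nonneg hy
  rw [h1, Matrix.det_add_replicateCol_mul_replicateRow ((isLocalMetric p).det_pos hy).ne'.isUnit,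
    Matrix.det_unique (n := Unit), W_symm hy hdu, localW, Real.sq_sqrt (by linarith)]
  simp only [Matrix.add_apply, Matrix.one_apply_eq, Matrix.mul_apply, Matrix.replicateRow_apply,
    Matrix.replicateCol_apply, localNormSq, localGrad, Finset.sum_mul, d]
  congr 2
  rw [Finset.sum_comm]
  exact Finset.sum_congr rfl fun _ _ => Finset.sum_congr rfl fun _ _ => by ring

variable [MeasurableSpace M] [BorelSpace M]

lemma restrict_vol (p : M) : (vol m M).restrict (extChartAt (𝓡 m) p).source
    = Measure.map (extChartAt (𝓡 m) p).symm
    ((volume.restrict (extChartAt (𝓡 m) p).target).withDensity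
      fun y => ENNReal.ofReal √(metricCoeff p y).det) :=
  restrict_volumeOf exists_bilinForm_metric p

lemma aemeasurable_sqrt_det (p : M) :
    AEMeasurable (fun y => ENNReal.ofReal √(metricCoeff p y).det)
      (volume.restrict (extChartAt (𝓡 m) p).target) :=
  ((isLocalMetric p).contDiffOn_sqrt_det.continuousOn.aemeasurable
    (measurableSet_target p)).ennreal_ofReal

lemma setLIntegral_vol_source (p : M) {F : M → ℝ≥0∞} (hF : Measurable F) :
    ∫⁻ x in (extChartAt (𝓡 m) p).source, F x ∂(vol m M)
      = ∫⁻ y in (extChartAt (𝓡 m) p).target,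
        ENNReal.ofReal √(metricCoeff p y).det * F ((extChartAt (𝓡 m) p).symm y) := by
  have hs := aemeasurable_chart_symm (m := m) p
  rw [restrict_vol, lintegral_map' hF.aemeasurable (hs _ (withDensity_absolutelyContinuous _ _)),
    lintegral_withDensity_eq_lintegral_mul₀ (g := fun y => F ((extChartAt (𝓡 m) p).symm y))
      (aemeasurable_sqrt_det p) (hF.comp_aemeasurable (hs _ Measure.AbsolutelyContinuous.rfl))]
  rfl

/-- The integral over a chart domain, in coordinates. -/
lemma integral_vol_eq (p : M) {F : M → ℝ} (hF : Measurable F)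
    (h0 : ∀ x, x ∉ (extChartAt (𝓡 m) p).source → F x = 0) :
    ∫ x, F x ∂(vol m M) = ∫ y in (extChartAt (𝓡 m) p).target,
        √(metricCoeff p y).det * F ((extChartAt (𝓡 m) p).symm y) := by
  have hs := aemeasurable_chart_symm (m := m) p
  rw [← setIntegral_eq_integral_of_forall_compl_eq_zero h0, restrict_vol,
    integral_map (hs _ (withDensity_absolutelyContinuous _ _)) hF.aestronglyMeasurable,
    integral_withDensity_eq_integral_toReal_smul₀ (aemeasurable_sqrt_det p)
      (ae_of_all _ fun _ => ENNReal.ofReal_lt_top)]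
  simp only [ENNReal.toReal_ofReal (Real.sqrt_nonneg _), smul_eq_mul]

lemma integrableOn_target (p : M) {F : M → ℝ} (hF : Integrable F (vol m M)) :
    IntegrableOn (fun y => √(metricCoeff p y).det * F ((extChartAt (𝓡 m) p).symm y))
      (extChartAt (𝓡 m) p).target := by
  have hs := aemeasurable_chart_symm (m := m) p
  have h1 := hF.restrict (s := (extChartAt (𝓡 m) p).source)
  rw [restrict_vol, integrable_map_measure h1.aestronglyMeasurable
    (hs _ (withDensity_absolutelyContinuous _ _)),
    integrable_withDensity_iff_integrable_smul₀' (aemeasurable_sqrt_det p)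
      (ae_of_all _ fun _ => ENNReal.ofReal_lt_top)] at h1
  simpa only [ENNReal.toReal_ofReal (Real.sqrt_nonneg _), smul_eq_mul, Function.comp_apply, IntegrableOn] using h1

/-- The volume of the graph has density `W` with respect to the volume of the base. -/
lemma volGraph_eq [SecondCountableTopology M] {u : M → ℝ}
    (hu : ContMDiff (𝓡 m) 𝓘(ℝ, ℝ) ∞ u) :
    volGraph m u = (vol m M).withDensity fun x => ENNReal.ofReal (W (m := m) u x) := by
  obtain ⟨S, hS, hcover⟩ := TopologicalSpace.countable_cover_nhds
    (f := fun p : M => (extChartAt (𝓡 m) p).source) fun p => extChartAt_source_mem_nhds p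
  have : Countable S := hS
  have hc : ⋃ p : S, (extChartAt (𝓡 m) (p : M)).source = univ := by
    rw [← hcover, iUnion_subtype]
  refine (Measure.ext_iff_of_iUnion_eq_univ hc).2 fun ⟨p, _⟩ => ?_
  have hU : MeasurableSet (extChartAt (𝓡 m) p).source := (isOpen_extChartAt_source p).measurableSet
  have hWm : Measurable fun x => ENNReal.ofReal (W (m := m) u x) :=
    (contMDiff_W hu).continuous.measurable.ennreal_ofReal
  rw [volGraph, restrict_volumeOf (exists_bilinForm_graphMetric u)]
  ext s hs
  rw [chartVolume_apply p hs, restrict_withDensity hU, withDensity_apply _ hs,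
    ← lintegral_indicator hs, setLIntegral_vol_source p (hWm.indicator hs),
    ← lintegral_indicator (measurableSet_preimage_symm p hs),
    ← lintegral_indicator (measurableSet_target p)]
  refine lintegral_congr fun y => ?_
  by_cases hy : y ∈ (extChartAt (𝓡 m) p).target
  · by_cases hys : (extChartAt (𝓡 m) p).symm y ∈ s
    · rw [indicator_of_mem hy, indicator_of_mem hys, indicator_of_mem (show y ∈ _ ∩ _ from ⟨hys, hy⟩),
        det_coeffMatrix_graphMetric hu hy, ← ENNReal.ofReal_mul (Real.sqrt_nonneg _),
        Real.sqrt_mul ((isLocalMetric p).det_pos hy).le, Real.sqrt_sq (show 0 ≤ W u _ from Real.sqrt_nonneg _)]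
    · rw [indicator_of_mem hy, indicator_of_notMem hys, indicator_of_notMem fun h => hys h.1,
        mul_zero]
  · rw [indicator_of_notMem hy, indicator_of_notMem fun h => hy h.2]

lemma vol_pos_of_isOpen {U : Set M} (hU : IsOpen U) (hne : U.Nonempty) : 0 < vol m M U := by
  obtain ⟨p, hp⟩ := hne
  have hS := isOpen_extChartAt_source (I := 𝓡 m) p
  have hsub : vol m M U ≥ (vol m M).restrict (extChartAt (𝓡 m) p).source U :=
    Measure.restrict_apply_le _ _
  refine lt_of_lt_of_le ?_ hsub
  rw [vol, restrict_volumeOf exists_bilinForm_metric, chartVolume_apply p hU.measurableSet]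
  have hms := measurableSet_preimage_symm (m := m) p hU.measurableSet
  have hopen : IsOpen ((extChartAt (𝓡 m) p).symm ⁻¹' U ∩ (extChartAt (𝓡 m) p).target) := by
    rw [inter_comm]
    exact (continuousOn_extChartAt_symm p).isOpen_inter_preimage (isOpen_extChartAt_target p) hU
  refine pos_iff_ne_zero.2 fun h0 => ?_
  change ∫⁻ y in _, ENNReal.ofReal √(metricCoeff p y).det = 0 at h0
  rw [lintegral_eq_zero_iff' ((aemeasurable_sqrt_det p).mono_measure
    (Measure.restrict_mono inter_subset_right le_rfl))] at h0
  have h1 := (ae_restrict_iff' hms).1 h0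
  refine (hopen.measure_pos volume ⟨extChartAt (𝓡 m) p p, ?_, mem_extChartAt_target p⟩).ne'
    (measure_mono_null (fun y hy => ?_) h1)
  · rwa [mem_preimage, extChartAt_to_inv]
  · exact fun h2 => (ENNReal.ofReal_pos.2
      (Real.sqrt_pos.2 ((isLocalMetric p).det_pos hy.2))).ne' (h2 hy)

instance : IsLocallyFiniteMeasure (vol m M) := by
  refine ⟨fun p => ?_⟩
  have hT := isOpen_extChartAt_target (I := 𝓡 m) p
  obtain ⟨ε, hε, hball⟩ := Metric.nhds_basis_closedBall.mem_iff.1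
    (hT.mem_nhds (mem_extChartAt_target (I := 𝓡 m) p))
  refine ⟨(extChartAt (𝓡 m) p).source ∩ extChartAt (𝓡 m) p ⁻¹'
    Metric.ball (extChartAt (𝓡 m) p p) ε, ?_, ?_⟩
  · exact Filter.inter_mem (extChartAt_source_mem_nhds p)
      ((continuousAt_extChartAt p).preimage_mem_nhds (Metric.ball_mem_nhds _ hε))
  have hO : IsOpen ((extChartAt (𝓡 m) p).source ∩ extChartAt (𝓡 m) p ⁻¹'
      Metric.ball (extChartAt (𝓡 m) p p) ε) :=
    (continuousOn_extChartAt p).isOpen_inter_preimage (isOpen_extChartAt_source p)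
      Metric.isOpen_ball
  rw [← inter_self ((extChartAt (𝓡 m) p).source), inter_assoc, inter_comm,
    ← Measure.restrict_apply hO.measurableSet, vol, restrict_volumeOf exists_bilinForm_metric,
    chartVolume_apply p hO.measurableSet]
  have hcont : ContinuousOn (fun y => √(metricCoeff p y).det)
      (Metric.closedBall (extChartAt (𝓡 m) p p) ε) :=
    (isLocalMetric p).contDiffOn_sqrt_det.continuousOn.mono hball
  refine lt_of_le_of_lt (lintegral_mono_set (t := Metric.closedBall (extChartAt (𝓡 m) p p) ε)
    fun y hy => ?_) ?_
  · have h1 := hy.1.2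
    rw [mem_preimage, (extChartAt (𝓡 m) p).right_inv hy.2] at h1
    exact Metric.ball_subset_closedBall h1
  · exact (hcont.integrableOn_compact (isCompact_closedBall _ _)).lintegral_lt_top

end riemannianVolume

/-! ### The Hopf–Rinow theorem -/

section hopfRinow

variable {X : Type*} [MetricSpace X]

/-- A complete locally compact metric space in which almost-geodesics exist is proper: the
supremum of the radii of compact balls about a point cannot be finite. -/
lemma properSpace_of_approx_intermediate [CompleteSpace X] [LocallyCompactSpace X]
    (h : ∀ x y : X, ∀ s, 0 ≤ s → s ≤ dist x y → ∀ δ > 0, ∃ z, dist x z ≤ s ∧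
      dist z y ≤ dist x y - s + δ) : ProperSpace X := by
  have key : ∀ o : X, ∀ r, IsCompact (Metric.closedBall o r) := by
    intro o
    by_contra! hcon
    obtain ⟨r₁, hr₁⟩ := hcon
    set S : Set ℝ := {r | IsCompact (Metric.closedBall o r)} with hS
    have hmono : ∀ r ∈ S, ∀ r' ≤ r, r' ∈ S := fun r hr r' hr' =>
      hr.of_isClosed_subset Metric.isClosed_closedBall (Metric.closedBall_subset_closedBall hr')
    have hbdd : ∀ r ∈ S, r ≤ r₁ := fun r hr => not_lt.1 fun hlt => hr₁ (hmono r hr r₁ hlt.le)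
    have h0 : (0 : ℝ) ∈ S := by simp [hS]
    have hBdd : BddAbove S := ⟨r₁, hbdd⟩
    set ρ := sSup S
    have hρ0 : 0 ≤ ρ := le_csSup hBdd h0
    have hlt : ∀ r < ρ, r ∈ S := fun r hr => by
      obtain ⟨r', hr', h1⟩ := exists_lt_of_lt_csSup ⟨0, h0⟩ hr
      exact hmono r' hr' r h1.le
    have hρ : IsCompact (Metric.closedBall o ρ) := by
      refine isCompact_iff_totallyBounded_isComplete.2
        ⟨?_, Metric.isClosed_closedBall.isComplete⟩
      refine Metric.totallyBounded_iff.2 fun ε hε => ?_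
      obtain ⟨t, ht, hcov⟩ := Metric.totallyBounded_iff.1
        (hlt (ρ - ε / 4) (by linarith)).totallyBounded (ε / 4) (by linarith)
      by_cases hρε : ρ < ε
      · refine ⟨{o}, finite_singleton o, fun x hx => ?_⟩
        simp only [mem_singleton_iff, iUnion_iUnion_eq_left, Metric.mem_ball]
        exact lt_of_le_of_lt hx hρε
      refine ⟨t, ht, fun x hx => ?_⟩
      have hx' : dist o x ≤ ρ := by rw [dist_comm]; exact hx
      have hz : ∃ z, dist o z ≤ ρ - ε / 4 ∧ dist z x ≤ ε / 2 := by
        by_cases hd : dist o x ≤ ρ - ε / 4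
        · exact ⟨x, hd, by rw [dist_self]; linarith⟩
        · obtain ⟨z, h1, h2⟩ := h o x (ρ - ε / 4) (by linarith) (by linarith) (ε / 4) (by linarith)
          exact ⟨z, h1, by linarith⟩
      obtain ⟨z, hz1, hz2⟩ := hz
      have hzc := hcov (show z ∈ Metric.closedBall o (ρ - ε / 4) by
        rw [Metric.mem_closedBall, dist_comm]; exact hz1)
      simp only [mem_iUnion, Metric.mem_ball, exists_prop] at hzc ⊢
      obtain ⟨w, hw, hw2⟩ := hzc
      refine ⟨w, hw, ?_⟩
      have := dist_triangle x z w
      rw [dist_comm x z] at this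
      linarith
    obtain ⟨δ, hδ, hcomp⟩ := hρ.exists_isCompact_cthickening
    have hmem : ρ + δ / 2 ∈ S := by
      refine hcomp.of_isClosed_subset Metric.isClosed_closedBall fun x hx => ?_
      have hx' : dist o x ≤ ρ + δ / 2 := by rw [dist_comm]; exact hx
      by_cases hd : dist o x ≤ ρ
      · exact Metric.self_subset_cthickening _ (by rw [Metric.mem_closedBall, dist_comm]; exact hd)
      · obtain ⟨z, h1, h2⟩ := h o x ρ hρ0 (by linarith) (δ / 2) (by linarith)
        refine Metric.mem_cthickening_of_dist_le x z δ _ ?_ ?_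
        · rw [Metric.mem_closedBall, dist_comm]; exact h1
        · rw [dist_comm]; linarith
    have := le_csSup hBdd hmem
    linarith
  exact ⟨fun x r => key x r⟩

end hopfRinow

/-! ### The Riemannian distance in charts -/

section distance

variable {M : Type*} [MetricSpace M] [ChartedSpace (EuclideanSpace ℝ (Fin m)) M]
  [IsManifold (𝓡 m) ∞ M] [RiemannianBundle (fun x : M => TangentSpace (𝓡 m) x)]
  [IsContMDiffRiemannianBundle (𝓡 m) ∞ (EuclideanSpace ℝ (Fin m))
      (fun x : M => TangentSpace (𝓡 m) x)]
  [IsRiemannianManifold (𝓡 m) M]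

/-- A point at distance `s` from `x` on a nearly length-minimizing curve from `x` to `y`. -/
lemma exists_dist_le_of_isRiemannianManifold {M : Type*} (m : ℕ) [MetricSpace M]
    [ChartedSpace (EuclideanSpace ℝ (Fin m)) M] [IsManifold (𝓡 m) ∞ M]
    [RiemannianBundle (fun x : M => TangentSpace (𝓡 m) x)]
    [IsContMDiffRiemannianBundle (𝓡 m) ∞ (EuclideanSpace ℝ (Fin m))
      (fun x : M => TangentSpace (𝓡 m) x)]
    [IsRiemannianManifold (𝓡 m) M] (x y : M) (s : ℝ) (hs0 : 0 ≤ s) (hs : s ≤ dist x y)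
    (δ : ℝ) (hδ : 0 < δ) : ∃ z, dist x z ≤ s ∧ dist z y ≤ dist x y - s + δ := by
  have hd : riemannianEDist (𝓡 m) x y < ENNReal.ofReal (dist x y + δ) := by
    rw [← IsRiemannianManifold.out (I := 𝓡 m) x y, edist_dist]
    exact (ENNReal.ofReal_lt_ofReal_iff (by linarith)).2 (by linarith)
  obtain ⟨γ, h0, h1, hγ, hlen⟩ := exists_lt_of_riemannianEDist_lt hd
  have hcont : ContinuousOn (fun t => dist x (γ t)) (Icc 0 1) :=
    (continuous_const.dist continuous_id).comp_continuousOn hγ.continuousOn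
  obtain ⟨t, ht, hts⟩ := intermediate_value_Icc zero_le_one hcont
    (show s ∈ Icc (dist x (γ 0)) (dist x (γ 1)) by rw [h0, h1, dist_self]; exact ⟨hs0, hs⟩)
  refine ⟨γ t, hts.le, ?_⟩
  have e1 : edist x (γ t) ≤ pathELength (𝓡 m) γ 0 t := by
    rw [IsRiemannianManifold.out (I := 𝓡 m) x (γ t)]
    exact riemannianEDist_le_pathELength (hγ.mono (Icc_subset_Icc_right ht.2)) h0 rfl ht.1
  have e2 : edist (γ t) y ≤ pathELength (𝓡 m) γ t 1 := by
    rw [IsRiemannianManifold.out (I := 𝓡 m) (γ t) y]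
    exact riemannianEDist_le_pathELength (hγ.mono (Icc_subset_Icc_left ht.1)) rfl h1 ht.2
  have e3 : edist x (γ t) + edist (γ t) y < ENNReal.ofReal (dist x y + δ) := by
    refine (add_le_add e1 e2).trans_lt ?_
    rwa [pathELength_add ht.1 ht.2]
  rw [edist_dist, edist_dist, ← ENNReal.ofReal_add dist_nonneg dist_nonneg,
    ENNReal.ofReal_lt_ofReal_iff (by linarith [dist_nonneg (x := x) (y := y)])] at e3
  change dist x (γ t) = s at hts
  linarith

/-- The Hopf–Rinow theorem: closed balls of a complete Riemannian manifold are compact. -/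
lemma properSpace_of_complete (m : ℕ) (M : Type*) [MetricSpace M] [CompleteSpace M]
    [ChartedSpace (EuclideanSpace ℝ (Fin m)) M] [IsManifold (𝓡 m) ∞ M]
    [RiemannianBundle (fun x : M => TangentSpace (𝓡 m) x)]
    [IsContMDiffRiemannianBundle (𝓡 m) ∞ (EuclideanSpace ℝ (Fin m))
      (fun x : M => TangentSpace (𝓡 m) x)] [IsRiemannianManifold (𝓡 m) M] : ProperSpace M := by
  have : LocallyCompactSpace M := ChartedSpace.locallyCompactSpace (EuclideanSpace ℝ (Fin m)) M
  exact properSpace_of_approx_intermediate (exists_dist_le_of_isRiemannianManifold m)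

/-- The image of a coordinate segment is at least as long as the distance of its end points. -/
lemma dist_symm_add_le {p : M} {y w : EuclideanSpace ℝ (Fin m)} {c : ℝ} (hc : 0 ≤ c)
    (hT : ∀ t ∈ Icc (0 : ℝ) 1, y + t • w ∈ (extChartAt (𝓡 m) p).target)
    (hq : ∀ t ∈ Icc (0 : ℝ) 1,
      ∑ i, ∑ j, metricCoeff p (y + t • w) i j * w i * w j ≤ c ^ 2) :
    dist ((extChartAt (𝓡 m) p).symm y) ((extChartAt (𝓡 m) p).symm (y + w)) ≤ c := by
  set η : ℝ → EuclideanSpace ℝ (Fin m) := fun t => y + t • w with hη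
  have hη1 : ContDiff ℝ 1 η := by fun_prop
  have hηd : ∀ t, HasDerivAt η w t := fun t => by
    have h := ((hasDerivAt_id t).smul_const w).const_add y
    rwa [one_smul] at h
  have hsm : ContMDiffOn 𝓘(ℝ, EuclideanSpace ℝ (Fin m)) (𝓡 m) 1 (extChartAt (𝓡 m) p).symm
      (extChartAt (𝓡 m) p).target :=
    (contMDiffOn_extChartAt_symm (n := ∞) p).of_le (by simp)
  have hγ : ContMDiffOn 𝓘(ℝ, ℝ) (𝓡 m) 1 ((extChartAt (𝓡 m) p).symm ∘ η) (Icc 0 1) :=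
    hsm.comp (contMDiffOn_iff_contDiffOn.2 hη1.contDiffOn) hT
  have h1 := riemannianEDist_le_pathELength hγ (x := (extChartAt (𝓡 m) p).symm y)
    (y := (extChartAt (𝓡 m) p).symm (y + w)) (by simp [hη]) (by simp [hη]) zero_le_one
  rw [← IsRiemannianManifold.out (I := 𝓡 m), pathELength_eq_lintegral_mfderiv_Icc] at h1
  have h2 : ∫⁻ t in Icc (0 : ℝ) 1,
      ‖mfderiv 𝓘(ℝ, ℝ) (𝓡 m) ((extChartAt (𝓡 m) p).symm ∘ η) t 1‖ₑ
      ≤ ∫⁻ _ in Icc (0 : ℝ) 1, ENNReal.ofReal c := by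
    refine setLIntegral_mono' measurableSet_Icc fun t ht => ?_
    have e1 : mfderiv 𝓘(ℝ, ℝ) (𝓡 m) ((extChartAt (𝓡 m) p).symm ∘ η) t (1 : ℝ)
        = mfderiv 𝓘(ℝ, EuclideanSpace ℝ (Fin m)) (𝓡 m) (extChartAt (𝓡 m) p).symm (η t) w := by
      have h := mfderiv_comp t (mdifferentiableAt_symm (hT t ht))
        (hηd t).differentiableAt.mdifferentiableAt
      have h3 : (mfderiv 𝓘(ℝ, ℝ) 𝓘(ℝ, EuclideanSpace ℝ (Fin m)) η t (1 : ℝ) :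
          EuclideanSpace ℝ (Fin m)) = w := by
        rw [mfderiv_eq_fderiv]
        exact (fderiv_apply_one_eq_deriv).trans (hηd t).deriv
      refine (congrArg (fun L => L (1 : ℝ)) h).trans ?_
      exact congrArg (fun v : EuclideanSpace ℝ (Fin m) =>
        mfderiv 𝓘(ℝ, EuclideanSpace ℝ (Fin m)) (𝓡 m) (extChartAt (𝓡 m) p).symm (η t) v) h3
    have e2 : ‖mfderiv 𝓘(ℝ, EuclideanSpace ℝ (Fin m)) (𝓡 m)
        (extChartAt (𝓡 m) p).symm (η t) w‖ ≤ c := by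
      have e3 := hq t ht
      rw [metricCoeff_quadratic p (y + t • w) w w, real_inner_self_eq_norm_sq] at e3
      rw [mfderiv_symm_eq_sum]
      exact (sq_le_sq₀ (norm_nonneg _) hc).1 e3
    refine (congrArg _ e1).trans_le ?_
    rw [← ofReal_norm]
    exact ENNReal.ofReal_le_ofReal e2
  have h3 := h1.trans h2
  simp only [lintegral_const, Measure.restrict_apply, MeasurableSet.univ, univ_inter,
    Real.volume_Icc, sub_zero, ENNReal.ofReal_one, mul_one] at h3
  rw [edist_dist] at h3
  exact (ENNReal.ofReal_le_ofReal_iff hc).1 h3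

/-- A Lipschitz function on `M` is locally Lipschitz in every chart. -/
lemma locallyLipschitzOn_comp_symm {a : M → ℝ} (ha : LipschitzWith 1 a) (p : M) :
    LocallyLipschitzOn (extChartAt (𝓡 m) p).target
      (fun z => a ((extChartAt (𝓡 m) p).symm z)) := by
  intro y₀ hy₀
  have hT := isOpen_extChartAt_target (I := 𝓡 m) p
  set q : EuclideanSpace ℝ (Fin m) → ℝ := fun z => ∑ i, ∑ j, |metricCoeff p z i j|
  have hq : ContinuousOn q (extChartAt (𝓡 m) p).target :=
    continuousOn_finsetSum _ fun i _ => continuousOn_finsetSum _ fun j _ =>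
      (contDiffOn_metricCoeff p i j).continuousOn.abs
  have hq0 : 0 ≤ q y₀ := Finset.sum_nonneg fun _ _ => Finset.sum_nonneg fun _ _ => abs_nonneg _
  have hev : ∀ᶠ z in 𝓝 y₀, z ∈ (extChartAt (𝓡 m) p).target ∧ q z < q y₀ + 1 :=
    (hT.eventually_mem hy₀).and ((hq.continuousAt (hT.mem_nhds hy₀)).eventually_lt
      continuousAt_const (by linarith))
  obtain ⟨r, hr, hball⟩ := Metric.eventually_nhds_iff_ball.1 hev
  refine ⟨⟨√(q y₀ + 1), Real.sqrt_nonneg _⟩, Metric.ball y₀ r,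
    mem_nhdsWithin_of_mem_nhds (Metric.ball_mem_nhds _ hr), ?_⟩
  refine LipschitzOnWith.of_dist_le_mul fun z hz z' hz' => ?_
  have hseg : ∀ t ∈ Icc (0 : ℝ) 1, z + t • (z' - z) ∈ Metric.ball y₀ r := fun t ht =>
    (convex_ball y₀ r).add_smul_sub_mem hz hz' ht
  have h1 := dist_symm_add_le (p := p) (y := z) (w := z' - z) (c := √(q y₀ + 1) * dist z z')
    (by positivity) (fun t ht => (hball _ (hseg t ht)).1) fun t ht => by
      have hb := (hball _ (hseg t ht)).2.le
      have hc : ∀ i, |(z' - z) i| ≤ dist z z' := fun i => by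
        rw [dist_comm, dist_eq_norm]; exact PiLp.norm_apply_le (z' - z) i
      calc ∑ i, ∑ j, metricCoeff p (z + t • (z' - z)) i j * (z' - z) i * (z' - z) j
          ≤ ∑ i, ∑ j, |metricCoeff p (z + t • (z' - z)) i j| * (dist z z') ^ 2 := by
            refine Finset.sum_le_sum fun i _ => Finset.sum_le_sum fun j _ => ?_
            refine (le_abs_self _).trans ?_
            rw [abs_mul, abs_mul, mul_assoc, sq]
            gcongr
            · exact hc i
            · exact hc j
        _ = q (z + t • (z' - z)) * (dist z z') ^ 2 := by
            simp only [q, Finset.sum_mul]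
        _ ≤ (√(q y₀ + 1) * dist z z') ^ 2 := by
            rw [mul_pow, Real.sq_sqrt (by linarith)]
            gcongr
  rw [add_sub_cancel] at h1
  exact (ha.dist_le_mul _ _).trans (by rw [NNReal.coe_one, one_mul]; exact h1)

/-- Where it exists, the differential of a function has norm at most the pointwise Lipschitz
constant of the function. -/
lemma sum_inv_mul_partialDeriv_le {a : M → ℝ} {p : M} {y : EuclideanSpace ℝ (Fin m)}
    (hy : y ∈ (extChartAt (𝓡 m) p).target) {L : ℝ} (hL0 : 0 ≤ L)
    (ha : ∀ ε > 0, ∀ᶠ x in 𝓝 ((extChartAt (𝓡 m) p).symm y),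
      |a x - a ((extChartAt (𝓡 m) p).symm y)| ≤ (L + ε) * dist ((extChartAt (𝓡 m) p).symm y) x)
    (hd : DifferentiableAt ℝ (fun z => a ((extChartAt (𝓡 m) p).symm z)) y) :
    ∑ i, ∑ j, (metricCoeff p y)⁻¹ i j
      * partialDeriv i (fun z => a ((extChartAt (𝓡 m) p).symm z)) y
      * partialDeriv j (fun z => a ((extChartAt (𝓡 m) p).symm z)) y ≤ L ^ 2 := by
  set φ := fun z => a ((extChartAt (𝓡 m) p).symm z) with hφ
  have hT := isOpen_extChartAt_target (I := 𝓡 m) p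
  have hL := isLocalMetric (m := m) p
  -- the differential is bounded by the norm of the metric on each vector
  have key : ∀ w : EuclideanSpace ℝ (Fin m), ∀ c : ℝ, 0 ≤ c →
      ∑ i, ∑ j, metricCoeff p y i j * w i * w j < c ^ 2 → fderiv ℝ φ y w ≤ L * c := by
    intro w c hc hlt
    suffices h : ∀ ε > 0, fderiv ℝ φ y w ≤ (L + ε) * c by
      refine le_of_forall_pos_le_add fun ε hε => (h (ε / (c + 1)) (by positivity)).trans ?_
      have : ε / (c + 1) * c ≤ ε := by
        rw [div_mul_eq_mul_div, div_le_iff₀ (by positivity)]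
        nlinarith
      linarith
    intro ε hε
    have hcont : ContinuousOn (fun z => ∑ i, ∑ j, metricCoeff p z i j * w i * w j)
        (extChartAt (𝓡 m) p).target :=
      continuousOn_finsetSum _ fun i _ => continuousOn_finsetSum _ fun j _ =>
        ((contDiffOn_metricCoeff p i j).continuousOn.mul continuousOn_const).mul continuousOn_const
    have hev : ∀ᶠ z in 𝓝 y, z ∈ (extChartAt (𝓡 m) p).target ∧
        ∑ i, ∑ j, metricCoeff p z i j * w i * w j < c ^ 2 :=
      (hT.eventually_mem hy).and ((hcont.continuousAt (hT.mem_nhds hy)).eventually_lt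
        continuousAt_const hlt)
    obtain ⟨r, hr, hball⟩ := Metric.eventually_nhds_iff_ball.1 hev
    have hlim : Tendsto (fun t : ℝ => t⁻¹ • (φ (y + t • w) - φ y)) (𝓝[>] 0)
        (𝓝 (fderiv ℝ φ y w)) :=
      (hd.hasFDerivAt.hasLineDerivAt w).tendsto_slope_zero_right
    refine le_of_tendsto hlim ?_
    have hsmall : ∀ᶠ t : ℝ in 𝓝[>] 0, t * ‖w‖ < r := by
      have : Tendsto (fun t : ℝ => t * ‖w‖) (𝓝[>] 0) (𝓝 (0 * ‖w‖)) :=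
        (tendsto_id.mono_left nhdsWithin_le_nhds).mul_const _
      rw [zero_mul] at this
      exact this.eventually_lt_const hr
    have hnear : ∀ᶠ t : ℝ in 𝓝[>] 0, |φ (y + t • w) - φ y| ≤ (L + ε)
        * dist ((extChartAt (𝓡 m) p).symm y) ((extChartAt (𝓡 m) p).symm (y + t • w)) := by
      have h1 : ContinuousAt (fun t : ℝ => (extChartAt (𝓡 m) p).symm (y + t • w)) 0 := by
        refine ContinuousAt.comp (g := (extChartAt (𝓡 m) p).symm) ?_ (by fun_prop)
        simpa using (continuousOn_extChartAt_symm p).continuousAt (hT.mem_nhds hy)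
      have h2 := h1.tendsto
      rw [zero_smul, add_zero] at h2
      exact (h2.eventually (ha ε hε)).filter_mono nhdsWithin_le_nhds
    filter_upwards [hsmall, hnear, self_mem_nhdsWithin] with t ht htn ht0
    have ht0' : 0 < t := ht0
    have hseg : ∀ s ∈ Icc (0 : ℝ) 1, y + s • t • w ∈ Metric.ball y r := fun s hs => by
      rw [Metric.mem_ball, dist_self_add_left, norm_smul, norm_smul, Real.norm_of_nonneg hs.1,
        Real.norm_of_nonneg ht0'.le]
      refine lt_of_le_of_lt ?_ ht
      exact mul_le_of_le_one_left (by positivity) hs.2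
    have h1 := dist_symm_add_le (p := p) (y := y) (w := t • w) (c := t * c)
      (by positivity) (fun s hs => (hball _ (hseg s hs)).1) fun s hs => by
        have hb := (hball _ (hseg s hs)).2.le
        have he : ∑ i, ∑ j, metricCoeff p (y + s • t • w) i j * (t • w) i * (t • w) j
            = t ^ 2 * ∑ i, ∑ j, metricCoeff p (y + s • t • w) i j * w i * w j := by
          simp only [Finset.mul_sum, PiLp.smul_apply, smul_eq_mul]
          exact Finset.sum_congr rfl fun _ _ => Finset.sum_congr rfl fun _ _ => by ring
        rw [he, mul_pow]
        gcongr
    have h2 : φ (y + t • w) - φ y ≤ t * ((L + ε) * c) :=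
      (le_abs_self _).trans (htn.trans
        ((mul_le_mul_of_nonneg_left h1 (by linarith)).trans_eq (by ring)))
    rw [smul_eq_mul, inv_mul_le_iff₀ ht0']
    exact h2
  set N := ∑ i, ∑ j, (metricCoeff p y)⁻¹ i j * partialDeriv i φ y * partialDeriv j φ y with hN
  set w : EuclideanSpace ℝ (Fin m) :=
    WithLp.toLp 2 fun i => ∑ j, (metricCoeff p y)⁻¹ i j * partialDeriv j φ y with hw
  have e1 : fderiv ℝ φ y w = N := by
    rw [fderiv_apply_eq_sum, hN]
    refine Finset.sum_congr rfl fun i _ => ?_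
    simp only [hw, Finset.sum_mul]
    exact Finset.sum_congr rfl fun _ _ => by ring
  have e2 : ∑ i, ∑ j, metricCoeff p y i j * w i * w j = N := by
    have e3 : ∀ i, ∑ j, metricCoeff p y i j * w j = partialDeriv i φ y := fun i =>
      hL.lower_grad hy i
    have e4 : ∀ i, ∑ j, metricCoeff p y i j * w i * w j = w i * partialDeriv i φ y := fun i => by
      rw [← e3, Finset.mul_sum]
      exact Finset.sum_congr rfl fun _ _ => by ring
    simp only [e4]
    rw [← e1, fderiv_apply_eq_sum]
  by_contra! hcon
  have hN0 : 0 < N := lt_of_le_of_lt (sq_nonneg L) hcon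
  have h1 : ∀ t > N, N ^ 2 ≤ L ^ 2 * t := fun t ht => by
    have ht0 : 0 ≤ t := hN0.le.trans ht.le
    have h2 := key w √t (Real.sqrt_nonneg _) (by rw [e2, Real.sq_sqrt ht0]; exact ht)
    rw [e1] at h2
    have h3 := pow_le_pow_left₀ hN0.le h2 2
    rwa [mul_pow, Real.sq_sqrt ht0] at h3
  have h2 : N ^ 2 ≤ L ^ 2 * N := by
    refine le_of_forall_pos_le_add fun ε hε =>
      (h1 (N + ε / (L ^ 2 + 1)) (by linarith [show 0 < ε / (L ^ 2 + 1) by positivity])).trans ?_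
    have : L ^ 2 * (ε / (L ^ 2 + 1)) ≤ ε := by
      rw [mul_div_assoc', div_le_iff₀ (by positivity)]
      nlinarith
    linarith
  nlinarith

end distance

/-! ### From charts to the manifold -/

section globalization

variable {M : Type*} [MetricSpace M] [ChartedSpace (EuclideanSpace ℝ (Fin m)) M]
  [IsManifold (𝓡 m) ∞ M]

/-- A finite smooth partition of unity near a compact set, subordinate to chart domains. -/
lemma exists_finset_partition [ProperSpace M] {K : Set M} (hK : IsCompact K) :
    ∃ (I : Finset M) (χ : M → M → ℝ), (∀ p, ContMDiff (𝓡 m) 𝓘(ℝ, ℝ) ∞ (χ p)) ∧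
      (∀ p x, 0 ≤ χ p x) ∧ (∀ p, tsupport (χ p) ⊆ (extChartAt (𝓡 m) p).source) ∧
      ∀ x ∈ K, ∀ᶠ z in 𝓝 x, ∑ p ∈ I, χ p z = 1 := by
  obtain ⟨f, hf⟩ := SmoothPartitionOfUnity.exists_isSubordinate_chartAt_source (𝓡 m) M
  obtain ⟨K', hK', hKK'⟩ := exists_compact_superset hK
  have hfin := f.locallyFinite.finite_nonempty_inter_compact hK'
  refine ⟨hfin.toFinset, fun p => f p, fun p => (f p).contMDiff, fun p x => f.nonneg p x,
    fun p => by rw [extChartAt_source]; exact hf p, fun x hx => ?_⟩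
  filter_upwards [mem_interior_iff_mem_nhds.1 (hKK' hx)] with z hz
  rw [← f.sum_eq_one (mem_univ z)]
  refine (finsum_eq_sum_of_support_subset _ fun p hp => ?_).symm
  rw [Finite.coe_toFinset]
  exact ⟨z, hp, hz⟩

variable [RiemannianBundle (fun x : M => TangentSpace (𝓡 m) x)]

variable (m) in
/-- The inner product `σ(Da, Db)` of the gradients of two functions. -/
def gradInner (a b : M → ℝ) (x : M) : ℝ :=
  inner ℝ (gradient (m := m) a x) (gradient (m := m) b x)

lemma gradInner_eq (a b : M → ℝ) (x : M) :
    gradInner m a b x = mfderiv (𝓡 m) 𝓘(ℝ, ℝ) a x (gradient b x) :=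
  inner_gradient a x _

lemma gradInner_eq_zero_of_notMem_tsupport {a b : M → ℝ} {x : M} (hx : x ∉ tsupport a) :
    gradInner m a b x = 0 := by
  have h : a =ᶠ[𝓝 x] fun _ => (0 : ℝ) := notMem_tsupport_iff_eventuallyEq.1 hx
  rw [gradInner_eq, h.mfderiv_eq, mfderiv_const]
  rfl

variable [IsContMDiffRiemannianBundle (𝓡 m) ∞ (EuclideanSpace ℝ (Fin m))
      (fun x : M => TangentSpace (𝓡 m) x)]

lemma gradInner_symm {a b : M → ℝ} (ha : ContMDiff (𝓡 m) 𝓘(ℝ, ℝ) ∞ a)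
    (hb : ContMDiff (𝓡 m) 𝓘(ℝ, ℝ) ∞ b) {p : M} {y : EuclideanSpace ℝ (Fin m)}
    (hy : y ∈ (extChartAt (𝓡 m) p).target) :
    gradInner m a b ((extChartAt (𝓡 m) p).symm y)
      = ∑ i, partialDeriv i (fun z => a ((extChartAt (𝓡 m) p).symm z)) y
        * localGrad (metricCoeff p) (fun z => b ((extChartAt (𝓡 m) p).symm z)) i y :=
  inner_gradient_gradient hy (ha.mdifferentiableAt (by simp)) (hb.mdifferentiableAt (by simp))

/-- The differentials of functions with constant sum add up to zero. -/
lemma sum_gradInner_eq_zero {I : Finset M} {χ : M → M → ℝ} {x : M} {b : M → ℝ}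
    (hχ : ∀ p, ContMDiff (𝓡 m) 𝓘(ℝ, ℝ) ∞ (χ p)) (hb : ContMDiff (𝓡 m) 𝓘(ℝ, ℝ) ∞ b)
    (h1 : ∀ᶠ z in 𝓝 x, ∑ p ∈ I, χ p z = 1) : ∑ p ∈ I, gradInner m (χ p) b x = 0 := by
  set y := extChartAt (𝓡 m) x x
  have hy : y ∈ (extChartAt (𝓡 m) x).target := mem_extChartAt_target x
  have hT := isOpen_extChartAt_target (I := 𝓡 m) x
  have hxy : (extChartAt (𝓡 m) x).symm y = x := extChartAt_to_inv x
  have h2 := fun p => gradInner_symm (hχ p) hb hy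
  rw [hxy] at h2
  simp only [h2]
  rw [Finset.sum_comm]
  refine Finset.sum_eq_zero fun i _ => ?_
  rw [← Finset.sum_mul, ← partialDeriv_sum i I fun p _ =>
    differentiableAt_of_contDiffOn hT (contDiffOn_comp_symm (hχ p) x) hy]
  have h3 : ∀ᶠ z in 𝓝 y, ∑ p ∈ I, χ p ((extChartAt (𝓡 m) x).symm z) = 1 := by
    have hc := (continuousOn_extChartAt_symm (I := 𝓡 m) x).continuousAt (hT.mem_nhds hy)
    rw [ContinuousAt, hxy] at hc
    exact hc.eventually h1
  rw [partialDeriv_congr i h3, partialDeriv_const, zero_mul]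

lemma contMDiff_gradInner {a b : M → ℝ} (ha : ContMDiff (𝓡 m) 𝓘(ℝ, ℝ) ∞ a)
    (hb : ContMDiff (𝓡 m) 𝓘(ℝ, ℝ) ∞ b) : ContMDiff (𝓡 m) 𝓘(ℝ, ℝ) ∞ (gradInner m a b) :=
  contMDiff_of_contDiffOn_comp_symm fun p =>
    (ContDiffOn.sum fun i _ => (contDiffOn_partialDeriv i (isOpen_extChartAt_target p)
      (contDiffOn_comp_symm ha p)).mul
        ((isLocalMetric p).contDiffOn_grad (contDiffOn_comp_symm hb p) i)).congr
      fun _ hz => gradInner_symm ha hb hz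

variable [MeasurableSpace M] [BorelSpace M]

lemma integrable_of_continuous_of_eq_zero {K : Set M} (hK : IsCompact K) {F : M → ℝ}
    (hF : Continuous F) (h0 : ∀ x, x ∉ K → F x = 0) : Integrable F (vol m M) :=
  (integrableOn_iff_integrable_of_support_subset fun x hx => by
    by_contra h; exact hx (h0 x h)).1 (hF.continuousOn.integrableOn_compact hK)

lemma integrable_mul_of_eq_zero {K : Set M} (hK : IsCompact K) {F A : M → ℝ}
    (hF : Continuous F) (hA : Integrable A (vol m M)) (h0 : ∀ x, x ∉ K → A x = 0) :
    Integrable (fun x => F x * A x) (vol m M) :=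
  (integrableOn_iff_integrable_of_support_subset (s := K) fun x hx => by
    by_contra h; exact hx (by simp [h0 x h])).1
    (hA.integrableOn.continuousOn_mul hF.continuousOn hK)

/-- An integral inequality localized by cutoff functions of chart domains, up to terms linear in
the differential of the cutoff function, holds without cutoff function. -/
lemma integral_nonpos_of_forall_chart [ProperSpace M] {K : Set M} (hK : IsCompact K)
    {A a₁ a₂ b₁ b₂ : M → ℝ} (hA : Integrable A (vol m M))
    (hA0 : ∀ x, x ∉ K → A x = 0) (ha₁ : Continuous a₁) (ha₁0 : ∀ x, x ∉ K → a₁ x = 0)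
    (ha₂ : Continuous a₂) (ha₂0 : ∀ x, x ∉ K → a₂ x = 0)
    (hb₁ : ContMDiff (𝓡 m) 𝓘(ℝ, ℝ) ∞ b₁) (hb₂ : ContMDiff (𝓡 m) 𝓘(ℝ, ℝ) ∞ b₂)
    (h : ∀ (p : M) (χ : M → ℝ), ContMDiff (𝓡 m) 𝓘(ℝ, ℝ) ∞ χ → (∀ x, 0 ≤ χ x) →
      tsupport χ ⊆ (extChartAt (𝓡 m) p).source →
      Integrable (fun x => χ x * A x + gradInner m χ b₁ x * a₁ x + gradInner m χ b₂ x * a₂ x)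
        (vol m M) →
      ∫ x, (χ x * A x + gradInner m χ b₁ x * a₁ x + gradInner m χ b₂ x * a₂ x) ∂(vol m M) ≤ 0) :
    ∫ x, A x ∂(vol m M) ≤ 0 := by
  obtain ⟨I, χ, hχ, hχ0, hsupp, hsum⟩ := exists_finset_partition (m := m) hK
  have hint : ∀ p, Integrable (fun x => χ p x * A x + gradInner m (χ p) b₁ x * a₁ x
      + gradInner m (χ p) b₂ x * a₂ x) (vol m M) := fun p =>
    ((integrable_mul_of_eq_zero hK (hχ p).continuous hA hA0).add
      (integrable_of_continuous_of_eq_zero hK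
        ((contMDiff_gradInner (hχ p) hb₁).continuous.mul ha₁) fun x hx => by simp [ha₁0 x hx])).add
      (integrable_of_continuous_of_eq_zero hK
        ((contMDiff_gradInner (hχ p) hb₂).continuous.mul ha₂) fun x hx => by simp [ha₂0 x hx])
  have hpt : ∀ x, A x = ∑ p ∈ I, (χ p x * A x + gradInner m (χ p) b₁ x * a₁ x
      + gradInner m (χ p) b₂ x * a₂ x) := fun x => by
    by_cases hx : x ∈ K
    · rw [Finset.sum_add_distrib, Finset.sum_add_distrib, ← Finset.sum_mul, ← Finset.sum_mul,
        ← Finset.sum_mul, (hsum x hx).self_of_nhds, sum_gradInner_eq_zero hχ hb₁ (hsum x hx),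
        sum_gradInner_eq_zero hχ hb₂ (hsum x hx)]
      ring
    · simp [hA0 x hx, ha₁0 x hx, ha₂0 x hx]
  rw [integral_congr_ae (ae_of_all _ hpt), integral_finsetSum I fun p _ => hint p]
  exact Finset.sum_nonpos fun p _ => h p (χ p) (hχ p) (hχ0 p) (hsupp p) (hint p)

/-- The function `ζ = log W - C u`, whose exponential is `W e^{-C u}`. -/
def logZ (m : ℕ) {M : Type*} [TopologicalSpace M] [ChartedSpace (EuclideanSpace ℝ (Fin m)) M]
    [RiemannianBundle (fun x : M => TangentSpace (𝓡 m) x)] (u : M → ℝ) (C : ℝ) (x : M) : ℝ :=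
  Real.log (W (m := m) u x) - C * u x

lemma one_le_W (u : M → ℝ) (x : M) : 1 ≤ W (m := m) u x := by
  rw [W, Real.one_le_sqrt]
  linarith [sq_nonneg ‖gradient (m := m) u x‖]

lemma contMDiff_logZ {u : M → ℝ} (hu : ContMDiff (𝓡 m) 𝓘(ℝ, ℝ) ∞ u) (C : ℝ) :
    ContMDiff (𝓡 m) 𝓘(ℝ, ℝ) ∞ (logZ m u C) := by
  intro x
  have h1 : ContMDiffAt 𝓘(ℝ, ℝ) 𝓘(ℝ, ℝ) ∞ Real.log (W (m := m) u x) :=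
    (Real.contDiffAt_log.2 (zero_lt_one.trans_le (one_le_W u x)).ne').contMDiffAt
  exact (h1.comp x (contMDiff_W hu x)).sub (contMDiffAt_const.mul (hu x))

lemma logZ_symm {u : M → ℝ} (hu : ContMDiff (𝓡 m) 𝓘(ℝ, ℝ) ∞ u) (C : ℝ) {p : M}
    {y : EuclideanSpace ℝ (Fin m)} (hy : y ∈ (extChartAt (𝓡 m) p).target) :
    logZ m u C ((extChartAt (𝓡 m) p).symm y)
      = localLogZ (metricCoeff p) (fun z => u ((extChartAt (𝓡 m) p).symm z)) C y := by
  rw [logZ, localLogZ, W_symm hy (hu.mdifferentiableAt (by simp))]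

lemma sum_mul_sum_graphInv (S : EuclideanSpace ℝ (Fin m) → Matrix (Fin m) (Fin m) ℝ)
    (U : EuclideanSpace ℝ (Fin m) → ℝ) (y : EuclideanSpace ℝ (Fin m)) (c d : Fin m → ℝ) :
    ∑ i, c i * ∑ j, localGraphInv S U y i j * d j
      = ∑ i, c i * ∑ j, (S y)⁻¹ i j * d j
        - (∑ i, c i * localGrad S U i y) * ((∑ j, d j * localGrad S U j y)
          * (localW S U y ^ 2)⁻¹) := by
  rw [Finset.sum_mul, ← Finset.sum_sub_distrib]
  refine Finset.sum_congr rfl fun i _ => ?_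
  rw [mul_assoc, ← mul_sub, Finset.sum_mul, Finset.mul_sum (a := localGrad S U i y),
    ← Finset.sum_sub_distrib]
  congr 1
  refine Finset.sum_congr rfl fun j _ => ?_
  simp only [localGraphInv, Matrix.of_apply]
  ring

lemma isCompact_image_chart {p : M} {s K : Set M} (hK : IsCompact K) (hs : IsClosed s)
    (hsp : s ⊆ (extChartAt (𝓡 m) p).source) :
    IsCompact (extChartAt (𝓡 m) p '' (s ∩ K)) :=
  (hK.inter_left hs).image_of_continuousOn
    ((continuousOn_extChartAt p).mono (inter_subset_left.trans hsp))

lemma mul_symm_eq_zero {p : M} {χ φ : M → ℝ} {K : Set M} (hφ0 : ∀ x, x ∉ K → φ x = 0)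
    {y : EuclideanSpace ℝ (Fin m)} (hy : y ∈ (extChartAt (𝓡 m) p).target)
    (hyK : y ∉ extChartAt (𝓡 m) p '' (tsupport χ ∩ K)) :
    χ ((extChartAt (𝓡 m) p).symm y) * φ ((extChartAt (𝓡 m) p).symm y) = 0 := by
  by_contra hne
  refine hyK ⟨(extChartAt (𝓡 m) p).symm y, ⟨subset_tsupport _ (left_ne_zero_of_mul hne), ?_⟩,
    (extChartAt (𝓡 m) p).right_inv hy⟩
  by_contra hx
  exact right_ne_zero_of_mul hne (hφ0 _ hx)

/-- The inequality `Δ_g ζ ≥ |∇ log W|²_g` tested against `λ(ζ) e^{-2Cu} φ²`, where `κ` bounds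
`|dφ|²` wherever `φ` is differentiable. -/
theorem integral_logZ_le [ProperSpace M] (hRic : RicciNonneg m M) {u : M → ℝ}
    (hu : ContMDiff (𝓡 m) 𝓘(ℝ, ℝ) ∞ u) (hMSE : MinimalHypersurfaceEq m u) (C : ℝ) {lam : ℝ → ℝ}
    (hlam : ContDiff ℝ ∞ lam) (hmono : Monotone lam) (hlam0 : ∀ t, 0 ≤ lam t)
    {K : Set M} (hK : IsCompact K) {φ κ : M → ℝ} (hφ : Continuous φ)
    (hφL : ∀ p : M, LocallyLipschitzOn (extChartAt (𝓡 m) p).target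
      (fun z => φ ((extChartAt (𝓡 m) p).symm z)))
    (hφ0 : ∀ x, x ∉ K → φ x = 0) (hκm : Measurable κ) (hκi : Integrable κ (vol m M))
    (hκ0 : ∀ x, x ∉ K → κ x = 0)
    (hκ : ∀ p : M, ∀ y ∈ (extChartAt (𝓡 m) p).target,
      DifferentiableAt ℝ (fun z => φ ((extChartAt (𝓡 m) p).symm z)) y →
      ∑ i, ∑ j, (metricCoeff p y)⁻¹ i j
        * partialDeriv i (fun z => φ ((extChartAt (𝓡 m) p).symm z)) y
        * partialDeriv j (fun z => φ ((extChartAt (𝓡 m) p).symm z)) y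
        ≤ κ ((extChartAt (𝓡 m) p).symm y)) :
    ∫ x, W (m := m) u x * (Real.exp (-2 * C * u x) * lam (logZ m u C x)
      * (C ^ 2 * (1 - (W (m := m) u x ^ 2)⁻¹) * φ x ^ 2 - κ x)) ∂(vol m M) ≤ 0 := by
  have hWs := contMDiff_W (m := m) hu
  have hWc := hWs.continuous
  have hW0 : ∀ x, W (m := m) u x ≠ 0 := fun x => (zero_lt_one.trans_le (one_le_W u x)).ne'
  have hζ := contMDiff_logZ (m := m) hu C
  set a : M → ℝ := fun x => W (m := m) u x * (Real.exp (-2 * C * u x) * lam (logZ m u C x))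
  have ha : Continuous a := hWc.mul ((Real.continuous_exp.comp
    (continuous_const.mul hu.continuous)).mul (hlam.continuous.comp hζ.continuous))
  have hb : Continuous fun x => C ^ 2 * (1 - (W (m := m) u x ^ 2)⁻¹) * φ x ^ 2 :=
    (continuous_const.mul (continuous_const.sub ((hWc.pow 2).inv₀ fun x => pow_ne_zero 2 (hW0 x)))).mul
      (hφ.pow 2)
  have hbi : Integrable (fun x => C ^ 2 * (1 - (W (m := m) u x ^ 2)⁻¹) * φ x ^ 2 - κ x)
      (vol m M) :=
    (integrable_of_continuous_of_eq_zero hK hb fun x hx => by simp [hφ0 x hx]).sub hκi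
  have hb0 : ∀ x, x ∉ K → C ^ 2 * (1 - (W (m := m) u x ^ 2)⁻¹) * φ x ^ 2 - κ x = 0 :=
    fun x hx => by simp [hφ0 x hx, hκ0 x hx]
  have hgu := (contMDiff_gradInner (m := m) hζ hu).continuous
  refine integral_nonpos_of_forall_chart hK (b₁ := logZ m u C) (b₂ := u)
    (a₁ := fun x => a x * φ x ^ 2)
    (a₂ := fun x => -(a x * φ x ^ 2 * (gradInner m (logZ m u C) u x * (W (m := m) u x ^ 2)⁻¹)))
    ?_ ?_ ?_ ?_ ?_ ?_ hζ hu ?_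
  · have := integrable_mul_of_eq_zero hK ha hbi hb0
    simpa only [a, mul_assoc] using this
  · intro x hx
    rw [hb0 x hx]; simp
  · exact ha.mul (hφ.pow 2)
  · intro x hx; simp [hφ0 x hx]
  · exact ((ha.mul (hφ.pow 2)).mul (hgu.mul ((hWc.pow 2).inv₀ fun x => pow_ne_zero 2 (hW0 x)))).neg
  · intro x hx; simp [hφ0 x hx]
  intro p χ hχ hχ0 hsupp hint
  set T := (extChartAt (𝓡 m) p).target
  have hT : IsOpen T := isOpen_extChartAt_target p
  have hc1 := (contMDiff_gradInner (m := m) hχ hζ).continuous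
  have hc2 := (contMDiff_gradInner (m := m) hχ hu).continuous
  have hm : Measurable fun x => χ x * (W (m := m) u x * (Real.exp (-2 * C * u x)
      * lam (logZ m u C x) * (C ^ 2 * (1 - (W (m := m) u x ^ 2)⁻¹) * φ x ^ 2 - κ x)))
      + gradInner m χ (logZ m u C) x * (a x * φ x ^ 2)
      + gradInner m χ u x * -(a x * φ x ^ 2 * (gradInner m (logZ m u C) u x
        * (W (m := m) u x ^ 2)⁻¹)) := by
    have e1 : Measurable fun x => W (m := m) u x * (Real.exp (-2 * C * u x)
        * lam (logZ m u C x) * (C ^ 2 * (1 - (W (m := m) u x ^ 2)⁻¹) * φ x ^ 2 - κ x)) := by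
      convert ha.measurable.mul (hb.measurable.sub hκm) using 1
      funext x
      simp only [a, Pi.mul_apply, Pi.sub_apply, mul_assoc]
    exact ((hχ.continuous.measurable.mul e1).add (hc1.mul (ha.mul (hφ.pow 2))).measurable).add
      (hc2.mul ((ha.mul (hφ.pow 2)).mul
        (hgu.mul ((hWc.pow 2).inv₀ fun x => pow_ne_zero 2 (hW0 x)))).neg).measurable
  rw [integral_vol_eq p hm fun x hx => by
    have hx' : x ∉ tsupport χ := fun h => hx (hsupp h)
    simp only [image_eq_zero_of_notMem_tsupport hx', gradInner_eq_zero_of_notMem_tsupport hx']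
    ring]
  have hint' := integrableOn_target p hint
  have heq : ∀ y ∈ T, √(metricCoeff p y).det * (χ ((extChartAt (𝓡 m) p).symm y)
      * (W (m := m) u ((extChartAt (𝓡 m) p).symm y)
        * (Real.exp (-2 * C * u ((extChartAt (𝓡 m) p).symm y))
      * lam (logZ m u C ((extChartAt (𝓡 m) p).symm y))
      * (C ^ 2 * (1 - (W (m := m) u ((extChartAt (𝓡 m) p).symm y) ^ 2)⁻¹)
        * φ ((extChartAt (𝓡 m) p).symm y) ^ 2 - κ ((extChartAt (𝓡 m) p).symm y))))
      + gradInner m χ (logZ m u C) ((extChartAt (𝓡 m) p).symm y)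
        * (a ((extChartAt (𝓡 m) p).symm y) * φ ((extChartAt (𝓡 m) p).symm y) ^ 2)
      + gradInner m χ u ((extChartAt (𝓡 m) p).symm y) * -(a ((extChartAt (𝓡 m) p).symm y)
        * φ ((extChartAt (𝓡 m) p).symm y) ^ 2
        * (gradInner m (logZ m u C) u ((extChartAt (𝓡 m) p).symm y)
        * (W (m := m) u ((extChartAt (𝓡 m) p).symm y) ^ 2)⁻¹)))
      = √(metricCoeff p y).det * (localW (metricCoeff p)
          (fun z => u ((extChartAt (𝓡 m) p).symm z)) y
        * (Real.exp (-2 * C * u ((extChartAt (𝓡 m) p).symm y))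
        * lam (localLogZ (metricCoeff p) (fun z => u ((extChartAt (𝓡 m) p).symm z)) C y)
        * (φ ((extChartAt (𝓡 m) p).symm y) ^ 2
          * ∑ i, partialDeriv i (fun z => χ ((extChartAt (𝓡 m) p).symm z)) y
          * ∑ j, localGraphInv (metricCoeff p) (fun z => u ((extChartAt (𝓡 m) p).symm z)) y i j
            * partialDeriv j (localLogZ (metricCoeff p)
              (fun z => u ((extChartAt (𝓡 m) p).symm z)) C) y
        + χ ((extChartAt (𝓡 m) p).symm y) * (C ^ 2 * (1 - (localW (metricCoeff p)
          (fun z => u ((extChartAt (𝓡 m) p).symm z)) y ^ 2)⁻¹)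
          * φ ((extChartAt (𝓡 m) p).symm y) ^ 2 - κ ((extChartAt (𝓡 m) p).symm y))))) := by
    intro y hy
    have hdz : ∀ j, partialDeriv j (fun z => logZ m u C ((extChartAt (𝓡 m) p).symm z)) y
        = partialDeriv j (localLogZ (metricCoeff p)
          (fun z => u ((extChartAt (𝓡 m) p).symm z)) C) y := fun j =>
      partialDeriv_congr j (by filter_upwards [hT.mem_nhds hy] with z hz using logZ_symm hu C hz)
    rw [sum_mul_sum_graphInv, gradInner_symm hχ hζ hy, gradInner_symm hχ hu hy,
      gradInner_symm hζ hu hy]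
    simp only [a, W_symm hy (hu.mdifferentiableAt (by simp)), logZ_symm hu C hy, localGrad, hdz]
    ring
  rw [setIntegral_congr_fun hT.measurableSet heq]
  refine (isLocalMinimalGraph hu hMSE p).integral_logZ_test_le (κ := fun y =>
      κ ((extChartAt (𝓡 m) p).symm y)) (fun y hy w => hRic p y hy w) C hlam hmono hlam0
    (contDiffOn_comp_symm hχ p) (fun y _ => hχ0 _) (hφL p)
    (isCompact_image_chart hK (isClosed_tsupport χ) hsupp) ?_
    (fun y hy hyK => mul_symm_eq_zero hφ0 hy hyK) (hκ p)
    (hint'.congr_fun heq hT.measurableSet)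
  rintro _ ⟨x, hx, rfl⟩
  exact (extChartAt (𝓡 m) p).map_source (hsupp hx.1)

/-- The minimal surface equation tested against `e^{-2Cu} θ²`, where `κ` bounds `|dθ|²` wherever
`θ` is differentiable. -/
theorem integral_exp_le [ProperSpace M] {u : M → ℝ}
    (hu : ContMDiff (𝓡 m) 𝓘(ℝ, ℝ) ∞ u) (hMSE : MinimalHypersurfaceEq m u) {C : ℝ} (hC : 0 < C)
    {K : Set M} (hK : IsCompact K) {θ κ : M → ℝ} (hθ : Continuous θ)
    (hθL : ∀ p : M, LocallyLipschitzOn (extChartAt (𝓡 m) p).target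
      (fun z => θ ((extChartAt (𝓡 m) p).symm z)))
    (hθ0 : ∀ x, x ∉ K → θ x = 0) (hκm : Measurable κ) (hκi : Integrable κ (vol m M))
    (hκ0 : ∀ x, x ∉ K → κ x = 0)
    (hκ : ∀ p : M, ∀ y ∈ (extChartAt (𝓡 m) p).target,
      DifferentiableAt ℝ (fun z => θ ((extChartAt (𝓡 m) p).symm z)) y →
      ∑ i, ∑ j, (metricCoeff p y)⁻¹ i j
        * partialDeriv i (fun z => θ ((extChartAt (𝓡 m) p).symm z)) y
        * partialDeriv j (fun z => θ ((extChartAt (𝓡 m) p).symm z)) y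
        ≤ κ ((extChartAt (𝓡 m) p).symm y)) :
    ∫ x, Real.exp (-2 * C * u x) * (C * (W (m := m) u x - (W (m := m) u x)⁻¹) * θ x ^ 2
      - C⁻¹ * κ x * (W (m := m) u x)⁻¹) ∂(vol m M) ≤ 0 := by
  have hWs := contMDiff_W (m := m) hu
  have hWc := hWs.continuous
  have hW0 : ∀ x, W (m := m) u x ≠ 0 := fun x => (zero_lt_one.trans_le (one_le_W u x)).ne'
  have hWi : Continuous fun x => (W (m := m) u x)⁻¹ := hWc.inv₀ hW0
  set a : M → ℝ := fun x => Real.exp (-2 * C * u x)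
  have ha : Continuous a := Real.continuous_exp.comp (continuous_const.mul hu.continuous)
  have hb : Continuous fun x => a x * (C * (W (m := m) u x - (W (m := m) u x)⁻¹) * θ x ^ 2) :=
    ha.mul ((continuous_const.mul (hWc.sub hWi)).mul (hθ.pow 2))
  have hd : Continuous fun x => a x * C⁻¹ * (W (m := m) u x)⁻¹ :=
    (ha.mul continuous_const).mul hWi
  have hsplit : ∀ x, Real.exp (-2 * C * u x) * (C * (W (m := m) u x - (W (m := m) u x)⁻¹)
      * θ x ^ 2 - C⁻¹ * κ x * (W (m := m) u x)⁻¹)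
      = a x * (C * (W (m := m) u x - (W (m := m) u x)⁻¹) * θ x ^ 2)
        - a x * C⁻¹ * (W (m := m) u x)⁻¹ * κ x := fun x => by simp only [a]; ring
  have ha2 : Continuous fun x => -(a x * θ x ^ 2 * (W (m := m) u x)⁻¹) :=
    ((ha.mul (hθ.pow 2)).mul hWi).neg
  refine integral_nonpos_of_forall_chart hK (b₁ := u) (b₂ := u) (a₁ := fun _ => 0)
    (a₂ := fun x => -(a x * θ x ^ 2 * (W (m := m) u x)⁻¹))
    ?_ ?_ continuous_const (fun _ _ => rfl) ha2 ?_ hu hu ?_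
  · simp only [hsplit]
    exact (integrable_of_continuous_of_eq_zero hK hb fun x hx => by simp [hθ0 x hx]).sub
      (integrable_mul_of_eq_zero hK hd hκi hκ0)
  · intro x hx
    simp [hθ0 x hx, hκ0 x hx]
  · intro x hx; simp [hθ0 x hx]
  intro p χ hχ hχ0 hsupp hint
  simp only [mul_zero, add_zero] at hint ⊢
  set T := (extChartAt (𝓡 m) p).target
  have hT : IsOpen T := isOpen_extChartAt_target p
  have hc2 := (contMDiff_gradInner (m := m) hχ hu).continuous
  have hm : Measurable fun x => χ x * (Real.exp (-2 * C * u x) * (C * (W (m := m) u x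
      - (W (m := m) u x)⁻¹) * θ x ^ 2 - C⁻¹ * κ x * (W (m := m) u x)⁻¹))
      + gradInner m χ u x * -(a x * θ x ^ 2 * (W (m := m) u x)⁻¹) := by
    simp only [hsplit]
    exact (hχ.continuous.measurable.mul (hb.measurable.sub (hd.measurable.mul hκm))).add
      (hc2.mul ha2).measurable
  rw [integral_vol_eq p hm fun x hx => by
    have hx' : x ∉ tsupport χ := fun h => hx (hsupp h)
    simp only [image_eq_zero_of_notMem_tsupport hx', gradInner_eq_zero_of_notMem_tsupport hx']
    ring]
  have hint' := integrableOn_target p hint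
  have heq : ∀ y ∈ T, √(metricCoeff p y).det * (χ ((extChartAt (𝓡 m) p).symm y)
      * (Real.exp (-2 * C * u ((extChartAt (𝓡 m) p).symm y))
        * (C * (W (m := m) u ((extChartAt (𝓡 m) p).symm y)
          - (W (m := m) u ((extChartAt (𝓡 m) p).symm y))⁻¹) * θ ((extChartAt (𝓡 m) p).symm y) ^ 2
          - C⁻¹ * κ ((extChartAt (𝓡 m) p).symm y)
            * (W (m := m) u ((extChartAt (𝓡 m) p).symm y))⁻¹))
      + gradInner m χ u ((extChartAt (𝓡 m) p).symm y) * -(a ((extChartAt (𝓡 m) p).symm y)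
        * θ ((extChartAt (𝓡 m) p).symm y) ^ 2 * (W (m := m) u ((extChartAt (𝓡 m) p).symm y))⁻¹))
      = √(metricCoeff p y).det * (Real.exp (-2 * C * u ((extChartAt (𝓡 m) p).symm y)) *
      (χ ((extChartAt (𝓡 m) p).symm y) * (C * (localW (metricCoeff p)
          (fun z => u ((extChartAt (𝓡 m) p).symm z)) y - (localW (metricCoeff p)
          (fun z => u ((extChartAt (𝓡 m) p).symm z)) y)⁻¹) * θ ((extChartAt (𝓡 m) p).symm y) ^ 2
          - C⁻¹ * κ ((extChartAt (𝓡 m) p).symm y) * (localW (metricCoeff p)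
          (fun z => u ((extChartAt (𝓡 m) p).symm z)) y)⁻¹)
        - θ ((extChartAt (𝓡 m) p).symm y) ^ 2 * (localW (metricCoeff p)
          (fun z => u ((extChartAt (𝓡 m) p).symm z)) y)⁻¹
          * ∑ i, partialDeriv i (fun z => χ ((extChartAt (𝓡 m) p).symm z)) y
          * localGrad (metricCoeff p) (fun z => u ((extChartAt (𝓡 m) p).symm z)) i y)) := by
    intro y hy
    rw [gradInner_symm hχ hu hy]
    simp only [a, W_symm hy (hu.mdifferentiableAt (by simp))]
    ring
  rw [setIntegral_congr_fun hT.measurableSet heq]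
  refine (isLocalMinimalGraph hu hMSE p).integral_exp_test_le (κ := fun y =>
      κ ((extChartAt (𝓡 m) p).symm y)) hC
    (contDiffOn_comp_symm hχ p) (fun y _ => hχ0 _) (hθL p)
    (isCompact_image_chart hK (isClosed_tsupport χ) hsupp) ?_
    (fun y hy hyK => mul_symm_eq_zero hθ0 hy hyK) (hκ p)
    (hint'.congr_fun heq hT.measurableSet)
  rintro _ ⟨x, hx, rfl⟩
  exact (extChartAt (𝓡 m) p).map_source (hsupp hx.1)

end globalization

/-! ### Radial cutoff functions -/

section cutoff

variable {X : Type*} [MetricSpace X]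

/-- The cutoff function `min (R - r) (R / 2)`, truncated below at `0`, where `r` is the distance
from `o`. -/
def radialCutoff (o : X) (R : ℝ) (x : X) : ℝ := max 0 (min (R - dist x o) (R / 2))

lemma lipschitzWith_radialCutoff (o : X) (R : ℝ) : LipschitzWith 1 (radialCutoff o R) :=
  (((LipschitzWith.const R).sub (LipschitzWith.dist_left o)).weaken (by simp)).min_const (R / 2)
    |>.const_max 0

lemma radialCutoff_nonneg (o : X) (R : ℝ) (x : X) : 0 ≤ radialCutoff o R x := le_max_left _ _

lemma radialCutoff_le {R : ℝ} (hR : 0 < R) (o : X) (x : X) : radialCutoff o R x ≤ R / 2 :=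
  max_le (by linarith) (min_le_right _ _)

lemma radialCutoff_eq_zero {o : X} {R : ℝ} {x : X} (hx : R ≤ dist x o) :
    radialCutoff o R x = 0 :=
  max_eq_left ((min_le_left _ _).trans (by linarith))

lemma radialCutoff_eq_half {o : X} {R : ℝ} (hR : 0 < R) {x : X} (hx : dist x o ≤ R / 2) :
    radialCutoff o R x = R / 2 := by
  rw [radialCutoff, min_eq_right (by linarith), max_eq_right (by linarith)]

/-- At `x`, the pointwise Lipschitz constant of `Φ ∘ a` is at most `Φ' (a x)`. -/
lemma eventually_abs_sub_le_of_hasDerivAt {a : X → ℝ} (ha : LipschitzWith 1 a) {Φ : ℝ → ℝ} {x : X}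
    {d : ℝ} (hd : 0 ≤ d) (hΦ : HasDerivAt Φ d (a x)) {ε : ℝ} (hε : 0 < ε) :
    ∀ᶠ z in 𝓝 x, |Φ (a z) - Φ (a x)| ≤ (d + ε) * dist x z := by
  have h1 := (hasDerivAt_iff_isLittleO.1 hΦ).bound hε
  filter_upwards [ha.continuous.continuousAt.eventually h1] with z hz
  simp only [Real.norm_eq_abs, smul_eq_mul] at hz
  have h2 : |a z - a x| ≤ dist x z := by
    have := ha.dist_le_mul z x
    rwa [NNReal.coe_one, one_mul, Real.dist_eq, dist_comm] at this
  have h3 : |Φ (a z) - Φ (a x)| ≤ |Φ (a z) - Φ (a x) - (a z - a x) * d| + |(a z - a x) * d| := by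
    have := abs_add_le (Φ (a z) - Φ (a x) - (a z - a x) * d) ((a z - a x) * d)
    rwa [sub_add_cancel] at this
  rw [abs_mul, abs_of_nonneg hd] at h3
  nlinarith

lemma eventually_abs_sub_le_of_eventuallyEq {b : X → ℝ} {x : X} (h : ∀ᶠ z in 𝓝 x, b z = b x)
    {ε : ℝ} (hε : 0 < ε) : ∀ᶠ z in 𝓝 x, |b z - b x| ≤ (0 + ε) * dist x z := by
  filter_upwards [h] with z hz
  rw [hz, sub_self, abs_zero]
  positivity

end cutoff

/-! ### The weighted area estimate -/

section estimate

variable {M : Type*} [MetricSpace M] [ChartedSpace (EuclideanSpace ℝ (Fin m)) M]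
  [IsManifold (𝓡 m) ∞ M] [RiemannianBundle (fun x : M => TangentSpace (𝓡 m) x)]
  [IsContMDiffRiemannianBundle (𝓡 m) ∞ (EuclideanSpace ℝ (Fin m))
      (fun x : M => TangentSpace (𝓡 m) x)] [IsRiemannianManifold (𝓡 m) M]

lemma locallyLipschitzOn_comp_comp_symm {a : M → ℝ} (ha : LipschitzWith 1 a) {Φ : ℝ → ℝ}
    (hΦ : ContDiff ℝ 1 Φ) (p : M) : LocallyLipschitzOn (extChartAt (𝓡 m) p).target
      (fun z => Φ (a ((extChartAt (𝓡 m) p).symm z))) := by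
  have h := locallyLipschitzOn_comp_symm (m := m) ha p
  rw [locallyLipschitzOn_iff_restrict] at *
  exact hΦ.locallyLipschitz.comp h

variable [MeasurableSpace M] [BorelSpace M]

/-- `integral_logZ_le` for the cutoff function `φ = cosh (c ϱ) - 1`, which is constant on the ball
of radius `R / 2`. -/
lemma integral_logZ_cutoff_le [ProperSpace M] (hRic : RicciNonneg m M) {u : M → ℝ}
    (hu : ContMDiff (𝓡 m) 𝓘(ℝ, ℝ) ∞ u) (hMSE : MinimalHypersurfaceEq m u) (C : ℝ) {lam : ℝ → ℝ}
    (hlam : ContDiff ℝ ∞ lam) (hmono : Monotone lam) (hlam0 : ∀ t, 0 ≤ lam t)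
    (o : M) {R c : ℝ} (hR : 0 < R) (hc : 0 < c) :
    ∫ x, W (m := m) u x * (Real.exp (-2 * C * u x) * lam (logZ m u C x)
      * (C ^ 2 * (1 - (W (m := m) u x ^ 2)⁻¹) * (Real.cosh (c * radialCutoff o R x) - 1) ^ 2
        - (Metric.ball o (R / 2))ᶜ.indicator
          (fun x => (c * Real.sinh (c * radialCutoff o R x)) ^ 2) x)) ∂(vol m M) ≤ 0 := by
  have hϱ := lipschitzWith_radialCutoff o R
  have hK := isCompact_closedBall o R
  have hD : MeasurableSet (Metric.ball o (R / 2))ᶜ := Metric.isOpen_ball.measurableSet.compl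
  have hκc : Continuous fun x => (c * Real.sinh (c * radialCutoff o R x)) ^ 2 :=
    (continuous_const.mul (Real.continuous_sinh.comp (continuous_const.mul hϱ.continuous))).pow 2
  have hz : ∀ x, x ∉ Metric.closedBall o R → radialCutoff o R x = 0 := fun x hx =>
    radialCutoff_eq_zero (by rw [Metric.mem_closedBall, not_le] at hx; exact hx.le)
  refine integral_logZ_le hRic hu hMSE C hlam hmono hlam0 hK
    ((Real.continuous_cosh.comp (continuous_const.mul hϱ.continuous)).sub continuous_const)
    (fun p => locallyLipschitzOn_comp_comp_symm hϱ (Φ := fun s => Real.cosh (c * s) - 1)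
      (by fun_prop) p) (fun x hx => by simp [hz x hx]) (hκc.measurable.indicator hD)
    ((integrable_of_continuous_of_eq_zero hK hκc fun x hx => by simp [hz x hx]).indicator hD)
    (fun x hx => by simp [hz x hx, indicator]) fun p y hy hd => ?_
  set x := (extChartAt (𝓡 m) p).symm y
  by_cases hx : x ∈ Metric.ball o (R / 2)
  · rw [indicator_of_notMem (by simpa using hx)]
    refine (sum_inv_mul_partialDeriv_le (a := fun x => Real.cosh (c * radialCutoff o R x) - 1)
      hy le_rfl (fun ε hε => eventually_abs_sub_le_of_eventuallyEq ?_ hε) hd).trans_eq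
      (zero_pow two_ne_zero)
    filter_upwards [Metric.isOpen_ball.mem_nhds hx] with z hz'
    rw [radialCutoff_eq_half hR (Metric.mem_ball.1 hx).le,
      radialCutoff_eq_half hR (Metric.mem_ball.1 hz').le]
  · rw [indicator_of_mem (by exact hx)]
    have hs : 0 ≤ c * Real.sinh (c * radialCutoff o R x) :=
      mul_nonneg hc.le (Real.sinh_nonneg_iff.2 (mul_nonneg hc.le (radialCutoff_nonneg _ _ _)))
    refine sum_inv_mul_partialDeriv_le (a := fun x => Real.cosh (c * radialCutoff o R x) - 1) hy hs (fun ε hε =>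
      eventually_abs_sub_le_of_hasDerivAt hϱ (Φ := fun s => Real.cosh (c * s) - 1) hs ?_ hε) hd
    have h := (((hasDerivAt_id (radialCutoff o R x)).const_mul c).cosh).sub_const 1
    exact h.congr_deriv (by simp only [id, mul_one]; ring)

/-- `integral_exp_le` for the cutoff function `θ = 2 sinh (c ϱ / 2)`. -/
lemma integral_exp_cutoff_le [ProperSpace M] {u : M → ℝ}
    (hu : ContMDiff (𝓡 m) 𝓘(ℝ, ℝ) ∞ u) (hMSE : MinimalHypersurfaceEq m u) {C : ℝ} (hC : 0 < C)
    (o : M) {R c : ℝ} (hc : 0 < c) :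
    ∫ x, Real.exp (-2 * C * u x) * (C * (W (m := m) u x - (W (m := m) u x)⁻¹)
        * (2 * Real.sinh (c / 2 * radialCutoff o R x)) ^ 2
      - C⁻¹ * (Metric.closedBall o R).indicator
          (fun x => (c * Real.cosh (c / 2 * radialCutoff o R x)) ^ 2) x
        * (W (m := m) u x)⁻¹) ∂(vol m M) ≤ 0 := by
  have hϱ := lipschitzWith_radialCutoff o R
  have hK := isCompact_closedBall o R
  have hD : MeasurableSet (Metric.closedBall o R) := Metric.isClosed_closedBall.measurableSet
  have hκc : Continuous fun x => (c * Real.cosh (c / 2 * radialCutoff o R x)) ^ 2 :=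
    (continuous_const.mul (Real.continuous_cosh.comp (continuous_const.mul hϱ.continuous))).pow 2
  have hz : ∀ x, x ∉ Metric.closedBall o R → radialCutoff o R x = 0 := fun x hx =>
    radialCutoff_eq_zero (by rw [Metric.mem_closedBall, not_le] at hx; exact hx.le)
  refine integral_exp_le hu hMSE hC hK
    (continuous_const.mul (Real.continuous_sinh.comp (continuous_const.mul hϱ.continuous)))
    (fun p => locallyLipschitzOn_comp_comp_symm hϱ (Φ := fun s => 2 * Real.sinh (c / 2 * s))
      (by fun_prop) p) (fun x hx => by simp [hz x hx]) (hκc.measurable.indicator hD)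
    ((integrable_indicator_iff hD).2 (hκc.continuousOn.integrableOn_compact hK))
    (fun x hx => indicator_of_notMem hx _) fun p y hy hd => ?_
  set x := (extChartAt (𝓡 m) p).symm y
  by_cases hx : x ∈ Metric.closedBall o R
  · rw [indicator_of_mem hx]
    have hs : 0 ≤ c * Real.cosh (c / 2 * radialCutoff o R x) :=
      mul_nonneg hc.le (Real.cosh_pos _).le
    refine sum_inv_mul_partialDeriv_le (a := fun x => 2 * Real.sinh (c / 2 * radialCutoff o R x)) hy hs (fun ε hε =>
      eventually_abs_sub_le_of_hasDerivAt hϱ (Φ := fun s => 2 * Real.sinh (c / 2 * s)) hs ?_ hε) hd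
    have h := (((hasDerivAt_id (radialCutoff o R x)).const_mul (c / 2)).sinh).const_mul 2
    exact h.congr_deriv (by simp only [id, mul_one]; ring)
  · rw [indicator_of_notMem hx]
    refine (sum_inv_mul_partialDeriv_le
      (a := fun x => 2 * Real.sinh (c / 2 * radialCutoff o R x)) hy le_rfl
      (fun ε hε => eventually_abs_sub_le_of_eventuallyEq ?_ hε) hd).trans_eq (zero_pow two_ne_zero)
    filter_upwards [Metric.isClosed_closedBall.isOpen_compl.mem_nhds hx] with z hz'
    rw [hz z hz', hz x hx]

/-- The weighted area estimate, for a smooth cutoff `λ(log W - C u)` that is supported where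
`W ≥ s₀`. -/
theorem sinh_sq_mul_setIntegral_le [ProperSpace M] (hRic : RicciNonneg m M) {u : M → ℝ}
    (hu : ContMDiff (𝓡 m) 𝓘(ℝ, ℝ) ∞ u) (hMSE : MinimalHypersurfaceEq m u) {C : ℝ} (hC : 0 < C)
    {lam : ℝ → ℝ} (hlam : ContDiff ℝ ∞ lam) (hmono : Monotone lam) (hlam0 : ∀ t, 0 ≤ lam t)
    (hlam1 : ∀ t, lam t ≤ 1) (o : M) {R c s₀ F : ℝ} (hR : 0 < R) (hc : 0 < c) (hs₀ : 1 < s₀)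
    (hCc : C ^ 2 * (1 - (s₀ ^ 2)⁻¹) = c ^ 2) (hF : ∀ x ∈ Metric.closedBall o R, -F ≤ u x)
    (hlamW : ∀ x ∈ Metric.closedBall o R, lam (logZ m u C x) ≠ 0 → s₀ ≤ W (m := m) u x) :
    4 * Real.sinh (c * R / 4) ^ 2 * ∫ x in Metric.ball o (R / 2),
        W (m := m) u x * (Real.exp (-2 * C * u x) * lam (logZ m u C x)) ∂(vol m M)
      ≤ Real.exp (2 * C * F) * (vol m M).real (Metric.closedBall o R) := by
  have hWc := (contMDiff_W (m := m) hu).continuous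
  have hW0 : ∀ x, W (m := m) u x ≠ 0 := fun x => (zero_lt_one.trans_le (one_le_W u x)).ne'
  have hW1 := one_le_W (m := m) u
  have hϱ := (lipschitzWith_radialCutoff o R).continuous
  have hK := isCompact_closedBall o R
  have hKm : MeasurableSet (Metric.closedBall o R) := Metric.isClosed_closedBall.measurableSet
  have hBm : MeasurableSet (Metric.ball o (R / 2)) := Metric.isOpen_ball.measurableSet
  have hBK : Metric.ball o (R / 2) ⊆ Metric.closedBall o R :=
    Metric.ball_subset_closedBall.trans (Metric.closedBall_subset_closedBall (by linarith))
  have hz : ∀ x, x ∉ Metric.closedBall o R → radialCutoff o R x = 0 := fun x hx =>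
    radialCutoff_eq_zero (by rw [Metric.mem_closedBall, not_le] at hx; exact hx.le)
  set e : M → ℝ := fun x => Real.exp (-2 * C * u x) with he
  set g : M → ℝ := fun x => W (m := m) u x * (Real.exp (-2 * C * u x) * lam (logZ m u C x)) with hg
  set θ : M → ℝ := fun x => 2 * Real.sinh (c / 2 * radialCutoff o R x) with hθ
  set q : ℝ := 1 - (s₀ ^ 2)⁻¹ with hq
  set S : ℝ := Real.sinh (c * R / 4) with hS
  set Ch : ℝ := Real.cosh (c * R / 4) with hCh
  set B := Metric.ball o (R / 2) with hB
  have hq0 : 0 < q := by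
    have : (s₀ ^ 2)⁻¹ < 1 := inv_lt_one_of_one_lt₀ (by nlinarith)
    linarith
  have hCh0 : 0 < Ch := Real.cosh_pos _
  have hee : Continuous e := Real.continuous_exp.comp (continuous_const.mul hu.continuous)
  have hgc : Continuous g := hWc.mul (hee.mul
    (hlam.continuous.comp (contMDiff_logZ (m := m) hu C).continuous))
  have hg0 : ∀ x, 0 ≤ g x := fun x => mul_nonneg (zero_le_one.trans (hW1 x))
    (mul_nonneg (Real.exp_pos _).le (hlam0 _))
  have hθc : Continuous θ :=
    continuous_const.mul (Real.continuous_sinh.comp (continuous_const.mul hϱ))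
  have hθ0 : ∀ x, x ∉ Metric.closedBall o R → θ x = 0 := fun x hx => by simp [hθ, hz x hx]
  have hgθi : Integrable (fun x => g x * θ x ^ 2) (vol m M) :=
    integrable_of_continuous_of_eq_zero hK (hgc.mul (hθc.pow 2)) fun x hx => by simp [hθ0 x hx]
  have hgB : Integrable (B.indicator g) (vol m M) :=
    (integrable_indicator_iff hBm).2
      ((hgc.continuousOn.integrableOn_compact hK).mono_set hBK)
  -- on the support of `λ(ζ)`, the function `1 - W⁻²` is at least `1 - s₀⁻²`
  have hWq : ∀ x ∈ Metric.closedBall o R, lam (logZ m u C x) ≠ 0 →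
      q ≤ 1 - (W (m := m) u x ^ 2)⁻¹ := fun x hx hl => by
    have h1 : s₀ ^ 2 ≤ W (m := m) u x ^ 2 := pow_le_pow_left₀ (by linarith) (hlamW x hx hl) 2
    have h2 : (W (m := m) u x ^ 2)⁻¹ ≤ (s₀ ^ 2)⁻¹ := inv_anti₀ (by positivity) h1
    linarith
  have hinner : 4 * S ^ 2 * Ch ^ 2 * ∫ x in B, g x ∂(vol m M)
      ≤ ∫ x, g x * θ x ^ 2 ∂(vol m M) := by
    have h1 := integral_logZ_cutoff_le hRic hu hMSE C hlam hmono hlam0 o hR hc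
    set φ : M → ℝ := fun x => Real.cosh (c * radialCutoff o R x) - 1 with hφ
    set κ : M → ℝ := Bᶜ.indicator (fun x => (c * Real.sinh (c * radialCutoff o R x)) ^ 2) with hκ
    have hφc : Continuous φ :=
      (Real.continuous_cosh.comp (continuous_const.mul hϱ)).sub continuous_const
    have hκc : Continuous fun x => (c * Real.sinh (c * radialCutoff o R x)) ^ 2 :=
      (continuous_const.mul (Real.continuous_sinh.comp (continuous_const.mul hϱ))).pow 2
    have hbi : Integrable (fun x => C ^ 2 * (1 - (W (m := m) u x ^ 2)⁻¹) * φ x ^ 2 - κ x)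
        (vol m M) :=
      (integrable_of_continuous_of_eq_zero hK ((continuous_const.mul (continuous_const.sub
        ((hWc.pow 2).inv₀ fun x => pow_ne_zero 2 (hW0 x)))).mul (hφc.pow 2))
        fun x hx => by simp [hφ, hz x hx]).sub
      ((integrable_of_continuous_of_eq_zero hK hκc fun x hx => by
        simp [hz x hx]).indicator hBm.compl)
    have hint := integrable_mul_of_eq_zero hK hgc hbi fun x hx => by
      simp [hφ, hκ, hz x hx, indicator]
    -- `(cosh Y - 1)² = 4 sinh² (Y/2) cosh² (Y/2) - 4 sinh² (Y/2)` on the inner ball, and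
    -- `(cosh t - 1)² - sinh² t = - 4 sinh² (t/2)` outside
    have hid : ∀ x, c ^ 2 * φ x ^ 2 - κ x
        = c ^ 2 * (B.indicator (fun _ => 4 * S ^ 2 * Ch ^ 2) x - θ x ^ 2) := fun x => by
      have hd : Real.cosh (c * radialCutoff o R x)
          = 1 + 2 * Real.sinh (c / 2 * radialCutoff o R x) ^ 2 := by
        rw [show c * radialCutoff o R x = 2 * (c / 2 * radialCutoff o R x) by ring,
          Real.cosh_two_mul, Real.cosh_sq]
        ring
      by_cases hx : x ∈ B
      · have hh : c / 2 * radialCutoff o R x = c * R / 4 := by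
          rw [radialCutoff_eq_half hR (Metric.mem_ball.1 hx).le]; ring
        rw [hh, ← hS] at hd
        simp only [hφ, hκ, hθ, hd, hh, indicator_of_mem hx,
          indicator_of_notMem (show x ∉ Bᶜ from fun h => h hx), ← hS]
        rw [show Ch ^ 2 = S ^ 2 + 1 from Real.cosh_sq _]
        ring
      · have hs : Real.sinh (c * radialCutoff o R x) ^ 2
            = Real.cosh (c * radialCutoff o R x) ^ 2 - 1 := by rw [Real.cosh_sq]; ring
        simp only [hφ, hκ, hθ, indicator_of_notMem hx, indicator_of_mem (show x ∈ Bᶜ from hx),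
          mul_pow, hs, hd]
        ring
    have hle : ∀ x, g x * (c ^ 2 * (B.indicator (fun _ => 4 * S ^ 2 * Ch ^ 2) x - θ x ^ 2))
        ≤ g x * (C ^ 2 * (1 - (W (m := m) u x ^ 2)⁻¹) * φ x ^ 2 - κ x) := fun x => by
      rw [← hid]
      by_cases hl : lam (logZ m u C x) = 0
      · simp [hg, hl]
      by_cases hx : x ∈ Metric.closedBall o R
      · refine mul_le_mul_of_nonneg_left ?_ (hg0 x)
        rw [← hCc]
        have := mul_le_mul_of_nonneg_left (hWq x hx hl) (mul_nonneg (sq_nonneg C) (sq_nonneg (φ x)))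
        linarith
      · simp [hφ, hz x hx]
    have hlow : ∀ x, g x * (c ^ 2 * (B.indicator (fun _ => 4 * S ^ 2 * Ch ^ 2) x - θ x ^ 2))
        = c ^ 2 * (4 * S ^ 2 * Ch ^ 2 * B.indicator g x - g x * θ x ^ 2) := fun x => by
      by_cases hx : x ∈ B
      · simp only [indicator_of_mem hx]; ring
      · simp only [indicator_of_notMem hx]; ring
    simp only [hlow] at hle
    have hmono := integral_mono (((hgB.const_mul _).sub hgθi).const_mul (c ^ 2)) hint hle
    have h2 : ∫ x, g x * (C ^ 2 * (1 - (W (m := m) u x ^ 2)⁻¹) * φ x ^ 2 - κ x) ∂(vol m M) ≤ 0 := by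
      refine (integral_congr_ae (ae_of_all _ fun x => ?_)).trans_le h1
      simp only [hg]
      ring
    have h3 := hmono.trans h2
    simp only [Pi.sub_apply] at h3
    rw [integral_const_mul, integral_sub (hgB.const_mul _) hgθi, integral_const_mul,
      integral_indicator hBm] at h3
    nlinarith [sq_pos_of_pos hc]
  have houter : ∫ x, g x * θ x ^ 2 ∂(vol m M)
      ≤ Ch ^ 2 * (Real.exp (2 * C * F) * (vol m M).real (Metric.closedBall o R)) := by
    have h1 := integral_exp_cutoff_le hu hMSE hC o (R := R) hc
    set κ : M → ℝ := (Metric.closedBall o R).indicator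
      (fun x => (c * Real.cosh (c / 2 * radialCutoff o R x)) ^ 2) with hκ
    have hWi : Continuous fun x => (W (m := m) u x)⁻¹ := hWc.inv₀ hW0
    have hκc : Continuous fun x => (c * Real.cosh (c / 2 * radialCutoff o R x)) ^ 2 :=
      (continuous_const.mul (Real.continuous_cosh.comp (continuous_const.mul hϱ))).pow 2
    have hκi : Integrable κ (vol m M) :=
      (integrable_indicator_iff hKm).2 (hκc.continuousOn.integrableOn_compact hK)
    have hi1 : Integrable (fun x => e x * (C * (W (m := m) u x - (W (m := m) u x)⁻¹) * θ x ^ 2))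
        (vol m M) := integrable_of_continuous_of_eq_zero hK
      (hee.mul ((continuous_const.mul (hWc.sub hWi)).mul (hθc.pow 2))) fun x hx => by
        simp [hθ0 x hx]
    have hi2 := integrable_mul_of_eq_zero hK
      ((hee.mul (continuous_const (y := C⁻¹))).mul hWi) hκi
      fun x hx => indicator_of_notMem hx _
    have hi3 : Integrable ((Metric.closedBall o R).indicator
        fun _ => C * q * (Ch ^ 2 * Real.exp (2 * C * F))) (vol m M) :=
      (integrable_indicator_iff hKm).2 (continuousOn_const.integrableOn_compact hK)
    have hle : ∀ x, C * q * (g x * θ x ^ 2) - (Metric.closedBall o R).indicator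
        (fun _ => C * q * (Ch ^ 2 * Real.exp (2 * C * F))) x
        ≤ e x * (C * (W (m := m) u x - (W (m := m) u x)⁻¹) * θ x ^ 2)
          - e x * C⁻¹ * (W (m := m) u x)⁻¹ * κ x := fun x => by
      by_cases hx : x ∈ Metric.closedBall o R
      · rw [indicator_of_mem hx, hκ, indicator_of_mem hx]
        refine sub_le_sub ?_ ?_
        · have hWpos : 0 < W (m := m) u x := zero_lt_one.trans_le (hW1 x)
          have hWW : W (m := m) u x - (W (m := m) u x)⁻¹
              = W (m := m) u x * (1 - (W (m := m) u x ^ 2)⁻¹) := by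
            field_simp
          have hfac : 0 ≤ 1 - (W (m := m) u x ^ 2)⁻¹ := by
            have : (W (m := m) u x ^ 2)⁻¹ ≤ 1 := inv_le_one_of_one_le₀ (one_le_pow₀ (hW1 x))
            linarith
          have hlq : q * lam (logZ m u C x) ≤ 1 - (W (m := m) u x ^ 2)⁻¹ := by
            by_cases hl : lam (logZ m u C x) = 0
            · rw [hl, mul_zero]; exact hfac
            · exact (mul_le_of_le_one_right hq0.le (hlam1 _)).trans (hWq x hx hl)
          have h2 := mul_le_mul_of_nonneg_left hlq (show 0 ≤ C * e x * W (m := m) u x * θ x ^ 2 by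
            have := (Real.exp_pos (-2 * C * u x)).le
            positivity)
          calc C * q * (g x * θ x ^ 2)
              = C * e x * W (m := m) u x * θ x ^ 2 * (q * lam (logZ m u C x)) := by
                simp only [hg, he]; ring
            _ ≤ _ := h2
            _ = _ := by rw [hWW]; ring
        · have hcosh : Real.cosh (c / 2 * radialCutoff o R x) ≤ Ch := by
            rw [hCh, Real.cosh_le_cosh, abs_of_nonneg (mul_nonneg (by linarith)
              (radialCutoff_nonneg _ _ _)), abs_of_nonneg (by positivity)]
            have := mul_le_mul_of_nonneg_left (radialCutoff_le hR o x) (by linarith : 0 ≤ c / 2)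
            linarith
          have hexp : e x ≤ Real.exp (2 * C * F) := Real.exp_le_exp.2 (by
            have := mul_le_mul_of_nonneg_left (hF x hx) hC.le
            linarith)
          have hWinv : (W (m := m) u x)⁻¹ ≤ 1 := inv_le_one_of_one_le₀ (hW1 x)
          have hWinv0 : 0 ≤ (W (m := m) u x)⁻¹ := inv_nonneg.2 (zero_le_one.trans (hW1 x))
          calc e x * C⁻¹ * (W (m := m) u x)⁻¹ * (c * Real.cosh (c / 2 * radialCutoff o R x)) ^ 2
              ≤ Real.exp (2 * C * F) * C⁻¹ * 1 * (c * Ch) ^ 2 := by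
                have := Real.cosh_pos (c / 2 * radialCutoff o R x)
                gcongr
            _ = C * q * (Ch ^ 2 * Real.exp (2 * C * F)) := by
                rw [mul_pow, ← hCc]
                field_simp
      · rw [indicator_of_notMem hx, hκ, indicator_of_notMem hx]
        simp [hθ0 x hx]
    have hmono := integral_mono ((hgθi.const_mul (C * q)).sub hi3) (hi1.sub hi2) hle
    have h2 : ∫ x, (e x * (C * (W (m := m) u x - (W (m := m) u x)⁻¹) * θ x ^ 2)
          - e x * C⁻¹ * (W (m := m) u x)⁻¹ * κ x) ∂(vol m M) ≤ 0 := by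
      refine (integral_congr_ae (ae_of_all _ fun x => ?_)).trans_le h1
      simp only [he, hθ]
      ring
    have h3 := hmono.trans h2
    simp only [Pi.sub_apply] at h3
    rw [integral_sub (hgθi.const_mul _) hi3, integral_const_mul, integral_indicator hKm,
      setIntegral_const, smul_eq_mul] at h3
    refine le_of_mul_le_mul_left ?_ (mul_pos hC hq0)
    linarith
  have h4 := hinner.trans houter
  refine le_of_mul_le_mul_left ?_ (pow_pos hCh0 2)
  linarith

end estimate

/-! ### The parameters -/

section parameters

variable {h f : ℝ → ℝ} {s₀ μ A R : ℝ}

lemma one_sub_inv_sq_pos (hs₀ : 1 < s₀) : 0 < 1 - (s₀ ^ 2)⁻¹ := by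
  have : (s₀ ^ 2)⁻¹ < 1 := inv_lt_one_of_one_lt₀ (by nlinarith)
  linarith

lemma Lam_pos (hs₀ : 1 < s₀) : 0 < Lam s₀ μ :=
  div_pos (Real.exp_pos _) (Real.sqrt_pos.2 (one_sub_inv_sq_pos hs₀))

lemma CR_sq_mul (hs₀ : 1 < s₀) :
    CR h s₀ μ R ^ 2 * (1 - (s₀ ^ 2)⁻¹) = (Real.exp μ * h R) ^ 2 := by
  have hq := one_sub_inv_sq_pos hs₀
  have hsq : √(1 - (s₀ ^ 2)⁻¹) ^ 2 = 1 - (s₀ ^ 2)⁻¹ := Real.sq_sqrt hq.le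
  rw [CR, Lam, mul_pow, div_pow, hsq, mul_pow, div_mul_eq_mul_div, div_mul_cancel₀ _ hq.ne']

lemma exp_le_mul_sinh_sq (hμ : 0 < μ) {τ : ℝ} (hτ : 1 ≤ τ) :
    Real.exp (2 * (μ * τ)) ≤ 4 * Real.sinh (Real.exp μ * τ / 2) ^ 2 := by
  set a := Real.exp μ with ha
  have ha0 : 0 < a := Real.exp_pos μ
  -- `2 sinh (x + d) ≥ 2 e^d sinh x`, with `x = a/2` and `d = (a/2) (τ - 1)`
  have h1 : Real.exp (a / 2 * (τ - 1)) * (2 * Real.sinh (a / 2)) ≤ 2 * Real.sinh (a * τ / 2) := by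
    rw [Real.sinh_eq, Real.sinh_eq]
    have e1 : Real.exp (a / 2 * (τ - 1)) * Real.exp (a / 2) = Real.exp (a * τ / 2) := by
      rw [← Real.exp_add]; congr 1; ring
    have e2 : Real.exp (-(a * τ / 2)) ≤ Real.exp (a / 2 * (τ - 1)) * Real.exp (-(a / 2)) := by
      rw [← Real.exp_add, Real.exp_le_exp]
      nlinarith
    linarith
  have h2 : a ≤ 2 * Real.sinh (a / 2) := by
    have := Real.self_le_sinh_iff.2 (by positivity : 0 ≤ a / 2)
    linarith
  -- `e^μ ≥ e μ`
  have h3 : μ ≤ a / 2 := by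
    have e1 := Real.add_one_le_exp (μ - 1)
    have e2 : a = Real.exp 1 * Real.exp (μ - 1) := by rw [← Real.exp_add, ha]; congr 1; ring
    have e3 := Real.exp_one_gt_d9
    nlinarith [Real.exp_pos (μ - 1)]
  have h4 : Real.exp (μ * τ) ≤ 2 * Real.sinh (a * τ / 2) := by
    refine le_trans ?_ h1
    have e1 : Real.exp (μ * τ) = Real.exp (μ * (τ - 1)) * a := by
      rw [ha, ← Real.exp_add]; congr 1; ring
    rw [e1]
    have e2 : Real.exp (μ * (τ - 1)) ≤ Real.exp (a / 2 * (τ - 1)) :=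
      Real.exp_le_exp.2 (mul_le_mul_of_nonneg_right h3 (by linarith))
    exact mul_le_mul e2 h2 ha0.le (Real.exp_pos _).le
  have h5 := pow_le_pow_left₀ (Real.exp_pos _).le h4 2
  rw [← Real.exp_nat_mul] at h5
  push_cast at h5
  linarith

lemma exp_le_limitConst (hs₀ : 1 < s₀) {t₀ : ℝ} (hh : ∀ t, t₀ < t → 2 < t * h t) :
    Real.exp (2 * Lam s₀ μ * A) ≤ limitConst h s₀ μ A := by
  have hℓ : 0 < ell h := by
    refine lt_of_lt_of_le (by norm_num : (0 : EReal) < ((2 : ℝ) : EReal))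
      (le_liminf_of_le (by isBoundedDefault) ?_)
    filter_upwards [eventually_gt_atTop t₀] with t ht
    exact EReal.coe_le_coe_iff.2 (hh t ht).le
  have hneg : ((-(4 * Lam s₀ μ) : ℝ) : EReal) * ell h < 0 := by
    refine EReal.mul_neg_iff.2 (Or.inr ⟨?_, hℓ⟩)
    have := Lam_pos (μ := μ) hs₀
    exact EReal.coe_neg'.2 (by linarith)
  have h1 : (EReal.exp (((-(4 * Lam s₀ μ) : ℝ) : EReal) * ell h)).toReal < 1 := by
    have := EReal.exp_lt_one_iff.2 hneg
    rw [← ENNReal.toReal_one]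
    exact (ENNReal.toReal_lt_toReal this.ne_top ENNReal.one_ne_top).2 this
  have h0 : 0 ≤ (EReal.exp (((-(4 * Lam s₀ μ) : ℝ) : EReal) * ell h)).toReal :=
    ENNReal.toReal_nonneg
  rw [limitConst]
  exact le_div_self (Real.exp_pos _).le (by linarith) (by linarith)

end parameters

/-! ### Superlevel sets and boundedness of `W` -/

section conclusion

variable {M : Type*} [MetricSpace M] [ChartedSpace (EuclideanSpace ℝ (Fin m)) M]
  [IsManifold (𝓡 m) ∞ M] [RiemannianBundle (fun x : M => TangentSpace (𝓡 m) x)]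
  [IsContMDiffRiemannianBundle (𝓡 m) ∞ (EuclideanSpace ℝ (Fin m))
      (fun x : M => TangentSpace (𝓡 m) x)]
  [MeasurableSpace M] [BorelSpace M] {u : M → ℝ}

lemma isOpen_superlevel (hu : ContMDiff (𝓡 m) 𝓘(ℝ, ℝ) ∞ u) (o : M) (f h : ℝ → ℝ) (s₀ μ R : ℝ) :
    IsOpen (superlevel m o u f h s₀ μ R) :=
  Metric.isOpen_ball.inter (isOpen_lt continuous_const ((contMDiff_W hu).continuous.mul
    (Real.continuous_exp.comp (continuous_const.mul hu.continuous))))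

lemma setIntegral_volGraph [SecondCountableTopology M] (hu : ContMDiff (𝓡 m) 𝓘(ℝ, ℝ) ∞ u)
    {s : Set M} (hs : MeasurableSet s) (F : M → ℝ) :
    ∫ x in s, F x ∂(volGraph m u) = ∫ x in s, W (m := m) u x * F x ∂(vol m M) := by
  rw [volGraph_eq hu, setIntegral_withDensity_eq_setIntegral_toReal_smul
    (contMDiff_W hu).continuous.measurable.ennreal_ofReal
    (ae_of_all _ fun _ => ENNReal.ofReal_lt_top) F hs]
  simp only [ENNReal.toReal_ofReal (zero_le_one.trans (one_le_W u _)), smul_eq_mul]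

lemma integrableOn_volGraph [SecondCountableTopology M] (hu : ContMDiff (𝓡 m) 𝓘(ℝ, ℝ) ∞ u)
    {s K : Set M} (hs : MeasurableSet s) (hK : IsCompact K) (hsK : s ⊆ K) {F : M → ℝ}
    (hF : Continuous F) : IntegrableOn F s (volGraph m u) := by
  rw [IntegrableOn, volGraph_eq hu, restrict_withDensity hs,
    integrable_withDensity_iff_integrable_smul₀'
      (contMDiff_W hu).continuous.measurable.ennreal_ofReal.aemeasurable
      (ae_of_all _ fun _ => ENNReal.ofReal_lt_top)]
  simp only [ENNReal.toReal_ofReal (zero_le_one.trans (one_le_W u _)), smul_eq_mul]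
  exact ((((contMDiff_W (m := m) hu).continuous.mul hF).continuousOn).integrableOn_compact
    hK).mono_set hsK

/-- `E_R` is a superlevel set of `ζ`. -/
lemma lt_logZ_iff {s C : ℝ} (hs : 0 < s) (x : M) :
    Real.log s < logZ m u C x ↔ s < W (m := m) u x * Real.exp (-C * u x) := by
  have hW : 0 < W (m := m) u x := zero_lt_one.trans_le (one_le_W u x)
  rw [logZ, ← Real.log_lt_log_iff hs (mul_pos hW (Real.exp_pos _)),
    Real.log_mul hW.ne' (Real.exp_pos _).ne', Real.log_exp]
  ring_nf

/-- The weighted area estimate on the superlevel set, where `u ≥ -f(R)` ensures that `W ≥ s₀`. -/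
theorem setIntegral_superlevel_le [ProperSpace M] [IsRiemannianManifold (𝓡 m) M]
    (hRic : RicciNonneg m M) (hu : ContMDiff (𝓡 m) 𝓘(ℝ, ℝ) ∞ u) (hMSE : MinimalHypersurfaceEq m u)
    (o : M) {f h : ℝ → ℝ} {s₀ μ R : ℝ} (hf : MonotoneOn f (Ici 0))
    (huf : ∀ x, -f (dist o x) ≤ u x) (hs₀ : 1 < s₀) (hR : 0 < R) (hh : 0 < h R) :
    4 * Real.sinh (Real.exp μ * h R * R / 4) ^ 2 *
      ∫ x in superlevel m o u f h s₀ μ R ∩ Metric.ball o (R / 2),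
        Real.exp (-2 * CR h s₀ μ R * u x) ∂(volGraph m u)
      ≤ Real.exp (2 * CR h s₀ μ R * f R) * (vol m M).real (Metric.closedBall o R) := by
  set C := CR h s₀ μ R with hC
  have hC0 : 0 < C := mul_pos (Lam_pos hs₀) hh
  set s := s₁ f h s₀ μ R with hs
  have hs_pos : 0 < s := mul_pos (by linarith) (Real.exp_pos _)
  set B := Metric.ball o (R / 2) with hB
  have hBm : MeasurableSet B := Metric.isOpen_ball.measurableSet
  have hF : ∀ x ∈ Metric.closedBall o R, -f R ≤ u x := fun x hx => by
    rw [Metric.mem_closedBall'] at hx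
    exact (neg_le_neg (hf dist_nonneg (mem_Ici.2 hR.le) hx)).trans (huf x)
  have hW : ∀ x ∈ Metric.closedBall o R, Real.log s < logZ m u C x → s₀ ≤ W (m := m) u x := by
    intro x hx hlt
    have hWpos : 0 < W (m := m) u x := zero_lt_one.trans_le (one_le_W u x)
    rw [logZ, hs, s₁, Real.log_mul (by linarith) (Real.exp_pos _).ne', Real.log_exp] at hlt
    have h1 := mul_le_mul_of_nonneg_left (hF x hx) hC0.le
    have h2 : C * f R = Lam s₀ μ * f R * h R := by rw [hC, CR]; ring
    exact ((Real.log_lt_log_iff (by linarith) hWpos).1 (by linarith)).le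
  -- smooth monotone approximations of the indicator function of `(log s, ∞)`
  set lam : ℕ → ℝ → ℝ := fun n t => Real.smoothTransition (n * (t - Real.log s)) with hlam
  have hlam_zero : ∀ n t, t ≤ Real.log s → lam n t = 0 := fun n t ht =>
    Real.smoothTransition.zero_of_nonpos (mul_nonpos_of_nonneg_of_nonpos n.cast_nonneg
      (by linarith))
  have hest : ∀ n : ℕ, 4 * Real.sinh (Real.exp μ * h R * R / 4) ^ 2 * ∫ x in B,
      W (m := m) u x * (Real.exp (-2 * C * u x) * lam n (logZ m u C x)) ∂(vol m M)
      ≤ Real.exp (2 * C * f R) * (vol m M).real (Metric.closedBall o R) := fun n =>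
    sinh_sq_mul_setIntegral_le hRic hu hMSE hC0
      (Real.smoothTransition.contDiff.comp (contDiff_const.mul (contDiff_id.sub contDiff_const)))
      (fun t t' ht => Real.smoothTransition.monotone
        (mul_le_mul_of_nonneg_left (sub_le_sub_right (show id t ≤ id t' from ht) _)
          n.cast_nonneg))
      (fun t => Real.smoothTransition.nonneg _) (fun t => Real.smoothTransition.le_one _) o hR
      (mul_pos (Real.exp_pos _) hh) hs₀ (CR_sq_mul hs₀) hF fun x hx hne => hW x hx
        (not_le.1 fun hle => hne (hlam_zero n _ hle))
  set G : M → ℝ := fun x => W (m := m) u x * Real.exp (-2 * C * u x) with hG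
  have hGc : Continuous G := (contMDiff_W (m := m) hu).continuous.mul
    (Real.continuous_exp.comp (continuous_const.mul hu.continuous))
  have hG0 : ∀ x, 0 ≤ G x := fun x => mul_nonneg (zero_le_one.trans (one_le_W u x))
    (Real.exp_pos _).le
  have hGi : IntegrableOn G B (vol m M) :=
    (hGc.continuousOn.integrableOn_compact (isCompact_closedBall o (R / 2))).mono_set
      Metric.ball_subset_closedBall
  set Z := {x : M | Real.log s < logZ m u C x} with hZ
  have hζ := (contMDiff_logZ (m := m) hu C).continuous
  have hZm : MeasurableSet Z := (isOpen_lt continuous_const hζ).measurableSet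
  have hlim : Tendsto (fun n : ℕ => ∫ x in B,
      W (m := m) u x * (Real.exp (-2 * C * u x) * lam n (logZ m u C x)) ∂(vol m M)) atTop
      (𝓝 (∫ x in B, Z.indicator G x ∂(vol m M))) := by
    refine tendsto_integral_of_dominated_convergence G (fun n => ?_) hGi
      (fun n => ae_of_all _ fun x => ?_) (ae_of_all _ fun x => ?_)
    · have hl : Continuous (lam n) := (Real.smoothTransition.contDiff (n := 0)).continuous.comp
        (continuous_const.mul (continuous_id.sub continuous_const))
      exact ((contMDiff_W (m := m) hu).continuous.mul ((Real.continuous_exp.comp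
        (continuous_const.mul hu.continuous)).mul (hl.comp hζ))).aestronglyMeasurable
    · rw [← mul_assoc, Real.norm_of_nonneg (mul_nonneg (hG0 x) (Real.smoothTransition.nonneg _))]
      exact mul_le_of_le_one_right (hG0 x) (Real.smoothTransition.le_one _)
    · simp only [← mul_assoc]
      by_cases hx : x ∈ Z
      · rw [indicator_of_mem hx]
        refine tendsto_const_nhds.congr' ?_
        have hpos : 0 < logZ m u C x - Real.log s := sub_pos.2 hx
        filter_upwards [eventually_ge_atTop ⌈(logZ m u C x - Real.log s)⁻¹⌉₊] with n hn
        have h1 : (logZ m u C x - Real.log s)⁻¹ ≤ n := (Nat.le_ceil _).trans (Nat.cast_le.2 hn)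
        have h2 : lam n (logZ m u C x) = 1 :=
          Real.smoothTransition.one_of_one_le ((inv_le_iff_one_le_mul₀ hpos).1 h1)
        rw [h2, mul_one]
      · rw [indicator_of_notMem hx]
        refine tendsto_const_nhds.congr fun n => ?_
        rw [hlam_zero n _ (not_lt.1 hx), mul_zero]
  have hset : superlevel m o u f h s₀ μ R ∩ B = B ∩ Z := by
    ext x
    simp only [superlevel, mem_inter_iff, mem_ofPred_eq, hZ, lt_logZ_iff hs_pos]
    refine ⟨fun hx => ⟨hx.2, hx.1.2⟩, fun hx => ⟨⟨?_, hx.2⟩, hx.1⟩⟩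
    exact Metric.ball_subset_ball (by linarith) hx.1
  rw [setIntegral_volGraph hu ((isOpen_superlevel hu o f h s₀ μ R).measurableSet.inter hBm), hset,
    ← setIntegral_indicator hZm]
  exact le_of_tendsto (hlim.const_mul _) (Eventually.of_forall hest)

/-- The area estimate with the volume of the ball of radius `2R`. -/
lemma setIntegral_superlevel_le_exp [ProperSpace M] [IsRiemannianManifold (𝓡 m) M]
    (hRic : RicciNonneg m M) (hu : ContMDiff (𝓡 m) 𝓘(ℝ, ℝ) ∞ u) (hMSE : MinimalHypersurfaceEq m u)
    (o : M) {f h : ℝ → ℝ} {s₀ μ R : ℝ} (hf : MonotoneOn f (Ici 0))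
    (huf : ∀ x, -f (dist o x) ≤ u x) (hs₀ : 1 < s₀) (hμ : 0 < μ) (hR : 0 < R) (hh : 2 < R * h R) :
    ∫ x in superlevel m o u f h s₀ μ R ∩ Metric.ball o (R / 2),
        Real.exp (-2 * CR h s₀ μ R * u x) ∂(volGraph m u)
      ≤ Real.exp (-μ * R * h R) * (vol m M).real (Metric.ball o (2 * R))
        * Real.exp (2 * Lam s₀ μ * (f R * h R)) := by
  have hh0 : 0 < h R := (mul_pos_iff_of_pos_left hR).1 (by linarith)
  have h1 := setIntegral_superlevel_le hRic hu hMSE o (μ := μ) hf huf hs₀ hR hh0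
  set J := ∫ x in superlevel m o u f h s₀ μ R ∩ Metric.ball o (R / 2),
    Real.exp (-2 * CR h s₀ μ R * u x) ∂(volGraph m u)
  have hJ : 0 ≤ J := integral_nonneg fun _ => (Real.exp_pos _).le
  have h2 := exp_le_mul_sinh_sq hμ (τ := R * h R / 2) (by linarith)
  rw [show Real.exp μ * (R * h R / 2) / 2 = Real.exp μ * h R * R / 4 by ring,
    show 2 * (μ * (R * h R / 2)) = μ * R * h R by ring] at h2
  have h3 : (vol m M).real (Metric.closedBall o R) ≤ (vol m M).real (Metric.ball o (2 * R)) :=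
    measureReal_mono (Metric.closedBall_subset_ball (by linarith))
      ((measure_mono Metric.ball_subset_closedBall).trans_lt
        (isCompact_closedBall o (2 * R)).measure_lt_top).ne
  have h4 : Real.exp (μ * R * h R) * J ≤ Real.exp (2 * Lam s₀ μ * (f R * h R))
      * (vol m M).real (Metric.ball o (2 * R)) := by
    refine (mul_le_mul_of_nonneg_right h2 hJ).trans (h1.trans ?_)
    rw [show 2 * CR h s₀ μ R * f R = 2 * Lam s₀ μ * (f R * h R) by rw [CR]; ring]
    exact mul_le_mul_of_nonneg_left h3 (Real.exp_pos _).le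
  have h5 := mul_le_mul_of_nonneg_left h4 (Real.exp_pos (-μ * R * h R)).le
  rw [← mul_assoc, ← Real.exp_add, show -μ * R * h R + μ * R * h R = 0 by ring, Real.exp_zero,
    one_mul] at h5
  linarith

/-- If the weighted areas of the superlevel sets tend to zero, then `W` is bounded. -/
lemma W_le_of_tendsto_zero [ProperSpace M] (hu : ContMDiff (𝓡 m) 𝓘(ℝ, ℝ) ∞ u)
    (o : M) {f h : ℝ → ℝ} {s₀ μ A : ℝ} (hh_lim : Tendsto h atTop (𝓝 0))
    (hfh_lim : Tendsto (fun t => f t * h t) atTop (𝓝 A)) {b : ℝ → ℝ}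
    (hb : Tendsto b atTop (𝓝 0)) (hs₀ : 1 < s₀) (hh_pos : ∀ t, 0 < t → 0 < h t)
    (hle : ∀ᶠ R in atTop, ∫ x in superlevel m o u f h s₀ μ R ∩ Metric.ball o (R / 2),
        Real.exp (-2 * CR h s₀ μ R * u x) ∂(volGraph m u) ≤ b R) (x₀ : M) :
    W (m := m) u x₀ ≤ s₀ * Real.exp (A * Lam s₀ μ) := by
  by_contra! hcon
  obtain ⟨c, hc1, hc2⟩ := exists_between hcon
  have hWc := (contMDiff_W (m := m) hu).continuous
  set U := |u x₀| + 1 with hU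
  -- a neighbourhood of `x₀` that lies in all superlevel sets of large radius
  set N : Set M := Metric.ball x₀ 1 ∩ ({x | c < W (m := m) u x} ∩ {x | |u x| < U}) with hN
  have hNo : IsOpen N := Metric.isOpen_ball.inter ((isOpen_lt continuous_const hWc).inter
    (isOpen_lt hu.continuous.abs continuous_const))
  have hx₀ : x₀ ∈ N := ⟨Metric.mem_ball_self one_pos, hc2, by
    change |u x₀| < |u x₀| + 1
    linarith⟩
  have hNK : N ⊆ Metric.closedBall x₀ 1 := fun x hx => Metric.ball_subset_closedBall hx.1
  have hNfin : vol m M N < ⊤ := (measure_mono hNK).trans_lt (isCompact_closedBall x₀ 1).measure_lt_top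
  have hNpos : 0 < (vol m M).real N :=
    ENNReal.toReal_pos (vol_pos_of_isOpen hNo ⟨x₀, hx₀⟩).ne' hNfin.ne
  have hC : Tendsto (fun R => CR h s₀ μ R) atTop (𝓝 0) := by
    simpa [CR] using hh_lim.const_mul (Lam s₀ μ)
  have hs1 : Tendsto (fun R => s₁ f h s₀ μ R) atTop (𝓝 (s₀ * Real.exp (A * Lam s₀ μ))) := by
    have h1 := (Real.continuous_exp.tendsto _).comp (hfh_lim.const_mul (Lam s₀ μ))
    have h2 := h1.const_mul s₀
    rw [mul_comm (Lam s₀ μ) A] at h2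
    refine h2.congr fun R => ?_
    simp only [s₁, Function.comp_apply, mul_assoc]
  have hlim1 : Tendsto (fun R => c * Real.exp (-(CR h s₀ μ R * U))) atTop (𝓝 c) := by
    have h1 := ((Real.continuous_exp.tendsto _).comp (hC.mul_const U).neg).const_mul c
    simpa using h1
  have hlim2 : Tendsto (fun R => Real.exp (-2 * (CR h s₀ μ R * U))) atTop (𝓝 1) := by
    have h1 := (Real.continuous_exp.tendsto _).comp ((hC.mul_const U).const_mul (-2))
    simpa [Function.comp_def] using h1
  have hfinal : ∀ᶠ R in atTop, 1 / 2 * (vol m M).real N ≤ b R := by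
    filter_upwards [hle, hs1.eventually_lt hlim1 hc1,
      hlim2.eventually_const_lt (by norm_num : (1 / 2 : ℝ) < 1),
      eventually_gt_atTop (2 * (dist x₀ o + 1)), eventually_gt_atTop 0] with R h1 h2 h3 h4 hR
    have hC0 : 0 < CR h s₀ μ R := mul_pos (Lam_pos hs₀) (hh_pos R hR)
    refine le_trans ?_ h1
    have hball : N ⊆ Metric.ball o (R / 2) := fun x hx => by
      have e1 := Metric.mem_ball.1 hx.1
      have e2 := dist_triangle x x₀ o
      rw [Metric.mem_ball]
      linarith
    have habs : ∀ x ∈ N, CR h s₀ μ R * u x ≤ CR h s₀ μ R * U := fun x hx =>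
      mul_le_mul_of_nonneg_left ((le_abs_self _).trans (le_of_lt hx.2.2)) hC0.le
    have hNs : N ⊆ superlevel m o u f h s₀ μ R ∩ Metric.ball o (R / 2) := fun x hx => by
      refine ⟨⟨Metric.ball_subset_ball (by linarith) (hball hx), h2.trans_le ?_⟩, hball hx⟩
      refine mul_le_mul hx.2.1.le (Real.exp_le_exp.2 ?_) (Real.exp_pos _).le
        (zero_le_one.trans (one_le_W u x))
      linarith [habs x hx]
    have hSm : MeasurableSet (superlevel m o u f h s₀ μ R ∩ Metric.ball o (R / 2)) :=
      (isOpen_superlevel hu o f h s₀ μ R).measurableSet.inter Metric.isOpen_ball.measurableSet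
    have hGc : Continuous fun x => W (m := m) u x * Real.exp (-2 * CR h s₀ μ R * u x) :=
      hWc.mul (Real.continuous_exp.comp (continuous_const.mul hu.continuous))
    have hG0 : ∀ x, 0 ≤ W (m := m) u x * Real.exp (-2 * CR h s₀ μ R * u x) := fun x =>
      mul_nonneg (zero_le_one.trans (one_le_W u x)) (Real.exp_pos _).le
    rw [setIntegral_volGraph hu hSm]
    refine le_trans ?_ (setIntegral_mono_set ((hGc.continuousOn.integrableOn_compact
      (isCompact_closedBall o (R / 2))).mono_set (inter_subset_right.trans
        Metric.ball_subset_closedBall)) (ae_of_all _ hG0) hNs.eventuallyLE)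
    have hconst : ∫ _ in N, (1 / 2 : ℝ) ∂(vol m M) = 1 / 2 * (vol m M).real N := by
      rw [setIntegral_const, smul_eq_mul, mul_comm]
    rw [← hconst]
    refine setIntegral_mono_on (integrableOn_const hNfin.ne)
      ((hGc.continuousOn.integrableOn_compact (isCompact_closedBall x₀ 1)).mono_set hNK)
      hNo.measurableSet fun x hx => ?_
    have e1 : Real.exp (-2 * (CR h s₀ μ R * U)) ≤ Real.exp (-2 * CR h s₀ μ R * u x) :=
      Real.exp_le_exp.2 (by linarith [habs x hx])
    have e2 := le_mul_of_one_le_left (Real.exp_pos (-2 * CR h s₀ μ R * u x)).le (one_le_W (m := m) u x)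
    linarith
  have := ge_of_tendsto hb hfinal
  linarith

end conclusion

end MinimalGraph

end

theorem lemma3p1 {m : ℕ} (hm : 2 ≤ m) {M : Type*} [MetricSpace M] [ConnectedSpace M]
    [CompleteSpace M] [MeasurableSpace M] [BorelSpace M]
    [ChartedSpace (EuclideanSpace ℝ (Fin m)) M] [IsManifold (𝓡 m) ∞ M]
    [RiemannianBundle (fun x : M => TangentSpace (𝓡 m) x)]
    [IsContMDiffRiemannianBundle (𝓡 m) ∞ (EuclideanSpace ℝ (Fin m))
      (fun x : M => TangentSpace (𝓡 m) x)]
    [IsRiemannianManifold (𝓡 m) M]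
    (hRic : MinimalGraph.RicciNonneg m M)
    (o : M) (u : M → ℝ) (hu : ContMDiff (𝓡 m) 𝓘(ℝ, ℝ) ∞ u)
    (hMSE : MinimalGraph.MinimalHypersurfaceEq m u)
    (f : ℝ → ℝ) (hf_pos : ∀ t, 0 ≤ t → 0 < f t) (hf_mono : MonotoneOn f (Set.Ici 0))
    (huf : ∀ x, -f (dist o x) ≤ u x)
    (h : ℝ → ℝ) (hh_pos : ∀ t, 0 < t → 0 < h t)
    (t₀ A : ℝ) (ht₀ : 0 ≤ t₀) (hA : 0 ≤ A)
    (hh_two : ∀ t, t₀ < t → 2 < t * h t)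
    (hh_lim : Tendsto h atTop (𝓝 0))
    (hfh_lim : Tendsto (fun t => f t * h t) atTop (𝓝 A))
    (s₀ μ : ℝ) (hs₀ : 1 < s₀) (hμ : 0 < μ) :
    (∀ R, 0 < R → MinimalGraph.vol m M (Metric.ball o R) < ⊤) ∧
    (∀ R, 0 < R → IntegrableOn (fun x => Real.exp (-2 * MinimalGraph.CR h s₀ μ R * u x))
      (MinimalGraph.superlevel m o u f h s₀ μ R ∩ Metric.ball o (R / 2))
      (MinimalGraph.volGraph m u)) ∧
    (∃ ε : ℝ → ℝ, Tendsto ε atTop (𝓝 0) ∧ ∀ᶠ R in atTop,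
      ∫ x in MinimalGraph.superlevel m o u f h s₀ μ R ∩ Metric.ball o (R / 2),
          Real.exp (-2 * MinimalGraph.CR h s₀ μ R * u x) ∂(MinimalGraph.volGraph m u)
        ≤ Real.exp (-μ * R * h R) * (MinimalGraph.vol m M).real (Metric.ball o (2 * R))
          * (MinimalGraph.limitConst h s₀ μ A + ε R)) ∧
    ((fun R => (MinimalGraph.vol m M).real (Metric.ball o (2 * R)))
        =o[atTop] (fun R => Real.exp (μ * R * h R)) →
      BddAbove (Set.range (MinimalGraph.W (m := m) u)) ∧
      ⨆ x, MinimalGraph.W (m := m) u x ≤ s₀ * Real.exp (A * MinimalGraph.Lam s₀ μ)) := by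
  have : ProperSpace M := MinimalGraph.properSpace_of_complete m M
  set Λ := MinimalGraph.Lam s₀ μ with hΛ
  set K := MinimalGraph.limitConst h s₀ μ A with hK
  set V : ℝ → ℝ := fun R => (MinimalGraph.vol m M).real (Metric.ball o (2 * R)) with hV
  -- the estimate holds with `e^{2ΛA} + ε R` in place of `K + ε R`, and `e^{2ΛA} ≤ K`
  set ε : ℝ → ℝ := fun R => Real.exp (2 * Λ * (f R * h R)) - Real.exp (2 * Λ * A) with hε
  have hεlim : Tendsto ε atTop (𝓝 0) := by
    have h1 := ((Real.continuous_exp.tendsto _).comp (hfh_lim.const_mul (2 * Λ))).sub_const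
      (Real.exp (2 * Λ * A))
    rwa [sub_self] at h1
  have hest : ∀ᶠ R in atTop,
      ∫ x in MinimalGraph.superlevel m o u f h s₀ μ R ∩ Metric.ball o (R / 2),
          Real.exp (-2 * MinimalGraph.CR h s₀ μ R * u x) ∂(MinimalGraph.volGraph m u)
        ≤ Real.exp (-μ * R * h R) * V R * (K + ε R) := by
    filter_upwards [eventually_gt_atTop t₀, eventually_gt_atTop 0] with R hR hR0
    refine (MinimalGraph.setIntegral_superlevel_le_exp hRic hu hMSE o hf_mono huf hs₀ hμ hR0
      (hh_two R hR)).trans ?_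
    have hKA : Real.exp (2 * Λ * A) ≤ K := MinimalGraph.exp_le_limitConst hs₀ hh_two
    refine mul_le_mul_of_nonneg_left ?_ (mul_nonneg (Real.exp_pos _).le measureReal_nonneg)
    simp only [hε]
    linarith
  refine ⟨fun R _ => ?_, fun R _ => ?_, ⟨ε, hεlim, hest⟩, fun ho => ?_⟩
  · exact (measure_mono Metric.ball_subset_closedBall).trans_lt
      (isCompact_closedBall o R).measure_lt_top
  · exact MinimalGraph.integrableOn_volGraph hu
      ((MinimalGraph.isOpen_superlevel hu o f h s₀ μ R).measurableSet.inter
        Metric.isOpen_ball.measurableSet) (isCompact_closedBall o (R / 2))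
      (Set.inter_subset_right.trans Metric.ball_subset_closedBall)
      (Real.continuous_exp.comp (continuous_const.mul hu.continuous))
  · have hb : Tendsto (fun R => Real.exp (-μ * R * h R) * V R * (K + ε R)) atTop (𝓝 0) := by
      have h1 := ho.tendsto_div_nhds_zero.mul (hεlim.const_add K)
      rw [zero_mul] at h1
      refine h1.congr fun R => ?_
      rw [show -μ * R * h R = -(μ * R * h R) by ring, Real.exp_neg, div_eq_inv_mul]
    have hW := MinimalGraph.W_le_of_tendsto_zero hu o hh_lim hfh_lim hb hs₀ hh_pos hest
    exact ⟨⟨_, by rintro _ ⟨x, rfl⟩; exact hW x⟩, ciSup_le hW⟩
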